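/- Fix finite sets $\Sigma_V$ (vertex labels) and $\Sigma_E$ (edge labels). A finite fuzzy labeled graph is a triple $G=\langle V,E,L\rangle$ with $V$ a finite set, $E\colon V\times\Sigma_E\times V\to[0,1]$ and $L\colon V\to(\Sigma_V\to[0,1])$; $|E|$ denotes the number of triples $\langle x,r,y\rangle$ with $E(x,r,y)>0$. A (crisp) directed simulation between $G=\langle V,E,L\rangle$ and $G'=\langle V',E',L'\rangle$ is a relation $Z\subseteq V\times V'$ such that, for all $x,y\in V$, $x',y'\in V'$, $r\in\Sigma_E$: (1) if $Z(x,x')$, then $L(x)(p)\le L'(x')(p)$ for all $p\in\Sigma_V$; (2) if $Z(x,x')$ and $E(x,r,y)>0$, then there is $y'\in V'$ with $Z(y,y')$ and $E(x,r,y)\le E'(x',r,y')$; (3) if $Z(x,x')$ and $E'(x',r,y')>0$, then there is $y\in V$ with $Z(y,y')$ and $E'(x',r,y')\le E(x,r,y)$. **The algorithm.** The algorithm ComputeDirectedSimulationEfficiently takes as input two finite fuzzy graphs $G$ and $G'$, where vertices and labels are numbered from $0$ and the nonzero edges are listed with their degrees in any order. It works as follows. *Initialization.* Construct arrays $E[x,r,y]=E(x,r,y)$,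 vectors $\mathrm{Next}[r,x]=\{y: E(x,r,y)>0\}$ and $\mathrm{Prev}[r,y]=\{x: E(x,r,y)>0\}$, pairwise different numbers $\mathrm{EdgeID}[x,r,y]$ of the nonzero edges, and the analogous $E'$, $\mathrm{Next}'$, $\mathrm{Prev}'$, $\mathrm{EdgeID}'$ for $G'$. Set $Z[x,x']:=\big(L(x)\le L'(x')\big)$ and let $remove$ be the empty queue. Sort all the vectors $\mathrm{Next}$, $\mathrm{Next}'$, $\mathrm{Prev}$, $\mathrm{Prev}'$ in ascending order of the degrees of the corresponding edges. For each $\langle r,y,x'\rangle\in\Sigma_E\times V\times V'$, construct, preserving the order, the vector $\mathrm{rcPrev}[r,y,x']$ of all $x\in\mathrm{Prev}[r,y]$ with $Z[x,x']$ and the doubly linked list $\mathrm{rcNext}'[r,y,x']$ of all $y'\in\mathrm{Next}'[r,x']$ with $Z[y,y']$, storing in $\mathrm{rcNextElem}'[y,\mathrm{EdgeID}'[x',r,y']]$ a reference to the list element containing $y'$. Dually, for each $\langle r,x,y'\rangle\in\Sigma_E\times V\times V'$, construct the vector $\mathrm{rcPrev}'[r,x,y']$ of all $x'\in\mathrm{Prev}'[r,y']$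 with $Z[x,x']$ and the doubly linked list $\mathrm{rcNext}[r,x,y']$ of all $y\in\mathrm{Next}[r,x]$ with $Z[y,y']$, with references in $\mathrm{rcNextElem}[y',\mathrm{EdgeID}[x,r,y]]$. Then call $\mathrm{UpdateRcPrev}(r,y,x')$ for all $\langle r,y,x'\rangle$ and $\mathrm{UpdateRcPrev}'(r,x,y')$ for all $\langle r,x,y'\rangle$. *$\mathrm{UpdateRcPrev}(r,y,x')$.* Let $d:=0$ if $\mathrm{rcNext}'[r,y,x']$ is empty, and $d:=E'[x',r,y']$ for the last entry $y'$ of that list otherwise. While $\mathrm{rcPrev}[r,y,x']$ is nonempty and its last entry $x$ satisfies $E[x,r,y]>d$, delete that last entry and, if $Z[x,x']$ is true, set it to false and add $\langle x,x'\rangle$ to $remove$. *$\mathrm{UpdateRcPrev}'(r,x,y')$* is dual: it uses $\mathrm{rcNext}[r,x,y']$ and $E[x,r,y]$ for $d$, and deletes entries $x'$ with $E'[x',r,y']>d$ from the end of $\mathrm{rcPrev}'[r,x,y']$. *Main loop.* While $remove$ is nonempty, extract a pair $\langle y,y'\rangle$ from it; for each $r\in\Sigma_E$ and $x'\in\mathrm{Prev}'[r,y']$,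 use the reference $\mathrm{rcNextElem}'[y,\mathrm{EdgeID}'[x',r,y']]$ to delete $y'$ from $\mathrm{rcNext}'[r,y,x']$, set that reference to null and call $\mathrm{UpdateRcPrev}(r,y,x')$; then, dually, for each $r\in\Sigma_E$ and $x\in\mathrm{Prev}[r,y]$, use $\mathrm{rcNextElem}[y',\mathrm{EdgeID}[x,r,y]]$ to delete $y$ from $\mathrm{rcNext}[r,x,y']$, set that reference to null and call $\mathrm{UpdateRcPrev}'(r,x,y')$. Finally, return the list of all pairs $\langle x,x'\rangle$ with $Z[x,x']$. **Theorem.** Implement this algorithm (with insertion sort for the sorting steps and a first-in-first-out queue for $remove$) on a random access machine in which copying, incrementing, decrementing or testing a register, copying or comparing two degrees, and reading or writing one array entry each take one step. For all finite fuzzy graphs $G=\langle V,E,L\rangle$ and $G'=\langle V',E',L'\rangle$, the algorithm terminates and returns the largest directed simulation between $G$ and $G'$. Moreover, it runs in time $O((m+n)n)$, where $n=|V|+|V'|$ and $m=|E|+|E'|$: there is a constant $C$, depending only on $\Sigma_V$ and $\Sigma_E$, such that whenever $n\ge 1$ it takes at most $C(m+n)n$ steps. -/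

import Mathlib

/-! ## Fuzzy labeled graphs and directed simulations -/

/-- A fuzzy labeled graph with vertex set `V`, over the set `P` of vertex labels and the set `R`
of edge labels: `E x r y` is the degree of the `r`-labeled edge from `x` to `y`, and `L x p` is the
degree to which `p` is a member of the label of `x`. -/
structure FuzzyGraph (P R V : Type*) where
  E : V → R → V → unitInterval
  L : V → P → unitInterval

namespace FuzzyGraph

/-- The number of nonzero edges. -/
noncomputable def numEdges {P R V : Type*} (G : FuzzyGraph P R V) : ℕ :=
  Nat.card {t : V × R × V // 0 < G.E t.1 t.2.1 t.2.2}

/-- `Z` is a crisp directed simulation between `G` and `H`. -/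
structure IsDirectedSimulation {P R V W : Type*} (G : FuzzyGraph P R V) (H : FuzzyGraph P R W)
    (Z : Set (V × W)) : Prop where
  label : ∀ x x', (x, x') ∈ Z → ∀ p, G.L x p ≤ H.L x' p
  forward : ∀ x x' r y, (x, x') ∈ Z → 0 < G.E x r y →
    ∃ y', (y, y') ∈ Z ∧ G.E x r y ≤ H.E x' r y'
  backward : ∀ x x' r y', (x, x') ∈ Z → 0 < H.E x' r y' →
    ∃ y, (y, y') ∈ Z ∧ H.E x' r y' ≤ G.E x r y

end FuzzyGraph

set_option linter.constructorNameAsVariable false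

namespace DirSim

/-! ## A random access machine with a step count

Programs are `while` programs over natural-number registers, degree registers, and arrays with
multi-dimensional indices. Degrees can only be copied and compared. -/

/-- The two input graphs: `left` is the first one, `right` is the second (primed) one. -/
inductive Side
  | left
  | right
  deriving DecidableEq

/-- The opposite side. -/
def Side.opp : Side → Side
  | .left => .right
  | .right => .left

/-- Names of the natural-number registers. -/
inductive Reg
  /-- input: number of vertex labels -/
  | numP
  /-- input: number of edge labels -/
  | numR
  /-- input: number of vertices of the graph on the given side -/
  | numV (s : Side)
  /-- input: number of nonzero edges of the graph on the given side -/
  | numE (s : Side)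
  /-- loop variables: a vertex label, an edge label, a vertex of the given side, positions -/
  | p
  | r
  | vert (s : Side)
  | i
  | len
  /-- components of the pair extracted from the queue -/
  | ext (s : Side)
  /-- auxiliary variables -/
  | bit
  | go
  | j
  | k
  | x
  | y
  | z
  | e
  | u
  | before
  | after
  /-- number of allocated list elements -/
  | alloc
  /-- first and one-past-last position of the queue -/
  | head
  | tail
  /-- length of the output list -/
  | outLen
  deriving DecidableEq

/-- Names of the degree registers. -/
inductive WReg
  | d
  | w
  deriving DecidableEq

/-- Names of the natural-number arrays. Arrays that depend on a side exist once for each of the two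
graphs; the copy for `right` is the primed one. -/
inductive Arr
  /-- input: source, label and target of the nonzero edge number `i`, index `[i]` -/
  | inSrc (s : Side)
  | inLab (s : Side)
  | inDst (s : Side)
  /-- EdgeID, index `[x, r, y]` -/
  | edgeID (s : Side)
  /-- the vectors Next, index `[r, x, position]`, and their lengths, index `[r, x]` -/
  | next (s : Side)
  | nextLen (s : Side)
  /-- the vectors Prev, index `[r, y, position]`, and their lengths, index `[r, y]` -/
  | prev (s : Side)
  | prevLen (s : Side)
  /-- the Boolean array Z (`1` is true, `0` is false), index `[left vertex, right vertex]` -/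
  | Z
  /-- the queue remove of pairs, index `[position]` -/
  | queue (s : Side)
  /-- the vectors rcPrev, index `[r, y, x, position]`, and their lengths, index `[r, y, x]`, where
  `y` is a vertex of side `s` and `x` is a vertex of the opposite side -/
  | rcPrev (s : Side)
  | rcPrevLen (s : Side)
  /-- the doubly linked lists rcNext, index `[r, x, y]`, where `x` is a vertex of side `s` and `y`
  is a vertex of the opposite side: reference to the last element, `0` if the list is empty -/
  | rcNextLast (s : Side)
  /-- rcNextElem, index `[y, e]`, where `y` is a vertex of the side opposite to `s` and `e`
  is the number of an edge of the graph on side `s`; `0` is Null -/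
  | rcNextElem (s : Side)
  /-- key, predecessor and successor (`0` is Null) of a list element, index `[u]` -/
  | elemKey
  | elemBefore
  | elemAfter
  /-- output: the components of the returned pairs, index `[position]` -/
  | out (s : Side)
  deriving DecidableEq

/-- Names of the degree arrays. -/
inductive WArr
  /-- input: degree of the nonzero edge number `i`, index `[i]` -/
  | inDeg (s : Side)
  /-- input: vertex labels, index `[x, p]` -/
  | label (s : Side)
  /-- E, index `[x, r, y]` -/
  | edge (s : Side)
  deriving DecidableEq

/-- A memory state. -/
structure State where
  reg : Reg → ℕ
  wreg : WReg → unitInterval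
  arr : Arr → List ℕ → ℕ
  warr : WArr → List ℕ → unitInterval

/-- The elementary instructions; the index of an array access is read from registers. -/
inductive Instr
  /-- `x := k` -/
  | const (x : Reg) (k : ℕ)
  /-- `x := y` -/
  | move (x y : Reg)
  /-- `x := y + 1` -/
  | succ (x y : Reg)
  /-- `x := y - 1` -/
  | pred (x y : Reg)
  /-- `x := a[idx]` -/
  | load (x : Reg) (a : Arr) (idx : List Reg)
  /-- `a[idx] := x` -/
  | store (a : Arr) (idx : List Reg) (x : Reg)
  /-- `w := 0` -/
  | wzero (w : WReg)
  /-- `w := a[idx]` -/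
  | wload (w : WReg) (a : WArr) (idx : List Reg)
  /-- `a[idx] := w` -/
  | wstore (a : WArr) (idx : List Reg) (w : WReg)

namespace State

/-- Write a register. -/
def setReg (σ : State) (x : Reg) (v : ℕ) : State :=
  { σ with reg := Function.update σ.reg x v }

/-- Write a degree register. -/
def setWReg (σ : State) (w : WReg) (v : unitInterval) : State :=
  { σ with wreg := Function.update σ.wreg w v }

/-- Write an array entry. -/
def setArr (σ : State) (a : Arr) (idx : List ℕ) (v : ℕ) : State :=
  { σ with arr := Function.update σ.arr a (Function.update (σ.arr a) idx v) }

/-- Write a degree array entry. -/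
def setWArr (σ : State) (a : WArr) (idx : List ℕ) (v : unitInterval) : State :=
  { σ with warr := Function.update σ.warr a (Function.update (σ.warr a) idx v) }

end State

/-- The effect of an elementary instruction. -/
def Instr.apply : Instr → State → State
  | .const x k, σ => σ.setReg x k
  | .move x y, σ => σ.setReg x (σ.reg y)
  | .succ x y, σ => σ.setReg x (σ.reg y + 1)
  | .pred x y, σ => σ.setReg x (σ.reg y - 1)
  | .load x a idx, σ => σ.setReg x (σ.arr a (idx.map σ.reg))
  | .store a idx x, σ => σ.setArr a (idx.map σ.reg) (σ.reg x)
  | .wzero w, σ => σ.setWReg w 0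
  | .wload w a idx, σ => σ.setWReg w (σ.warr a (idx.map σ.reg))
  | .wstore a idx w, σ => σ.setWArr a (idx.map σ.reg) (σ.wreg w)

/-- Tests. -/
inductive Test
  /-- `x = k` -/
  | eq (x : Reg) (k : ℕ)
  /-- `x < y` -/
  | lt (x y : Reg)
  /-- `v ≤ w`, for degrees -/
  | wle (v w : WReg)

/-- The truth of a test. -/
def Test.holds : Test → State → Prop
  | .eq x k, σ => σ.reg x = k
  | .lt x y, σ => σ.reg x < σ.reg y
  | .wle v w, σ => σ.wreg v ≤ σ.wreg w

/-- Programs. -/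
inductive Cmd
  | skip
  | instr (a : Instr)
  | seq (c d : Cmd)
  | ite (b : Test) (c d : Cmd)
  | loop (b : Test) (c : Cmd)

/-- `Exec c σ τ t`: the program `c`, started in `σ`, terminates in `τ` after `t` steps.
Every elementary instruction and every evaluation of a test is one step. -/
inductive Exec : Cmd → State → State → ℕ → Prop
  | skip (σ : State) : Exec .skip σ σ 0
  | instr (a : Instr) (σ : State) : Exec (.instr a) σ (a.apply σ) 1
  | seq {c d : Cmd} {σ τ ρ : State} {t u : ℕ} :
      Exec c σ τ t → Exec d τ ρ u → Exec (.seq c d) σ ρ (t + u)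
  | iteTrue {b : Test} {c d : Cmd} {σ τ : State} {t : ℕ} :
      b.holds σ → Exec c σ τ t → Exec (.ite b c d) σ τ (1 + t)
  | iteFalse {b : Test} {c d : Cmd} {σ τ : State} {t : ℕ} :
      ¬ b.holds σ → Exec d σ τ t → Exec (.ite b c d) σ τ (1 + t)
  | loopTrue {b : Test} {c : Cmd} {σ τ ρ : State} {t u : ℕ} :
      b.holds σ → Exec c σ τ t → Exec (.loop b c) τ ρ u → Exec (.loop b c) σ ρ (1 + t + u)
  | loopFalse {b : Test} {c : Cmd} {σ : State} :
      ¬ b.holds σ → Exec (.loop b c) σ σ 1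

/-! Abbreviations for programs. -/

namespace Cmd

def const (x : Reg) (k : ℕ) : Cmd := .instr (.const x k)
def move (x y : Reg) : Cmd := .instr (.move x y)
def succ (x y : Reg) : Cmd := .instr (.succ x y)
def pred (x y : Reg) : Cmd := .instr (.pred x y)
def load (x : Reg) (a : Arr) (idx : List Reg) : Cmd := .instr (.load x a idx)
def store (a : Arr) (idx : List Reg) (x : Reg) : Cmd := .instr (.store a idx x)
def wzero (w : WReg) : Cmd := .instr (.wzero w)
def wload (w : WReg) (a : WArr) (idx : List Reg) : Cmd := .instr (.wload w a idx)
def wstore (a : WArr) (idx : List Reg) (w : WReg) : Cmd := .instr (.wstore a idx w)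

/-- Sequential composition. -/
def block : List Cmd → Cmd
  | [] => .skip
  | c :: cs => .seq c (block cs)

/-- `for i = 0, …, n - 1 do c`. -/
def forRange (i n : Reg) (c : Cmd) : Cmd :=
  block [const i 0, .loop (.lt i n) (block [c, succ i i])]

end Cmd

/-! ## The algorithm ComputeDirectedSimulationEfficiently -/

open Cmd

/-- The index into `Z` of the pair formed by the vertex `x` of side `s` and the vertex `y` of the
opposite side. -/
def pairIdx (s : Side) (x y : Reg) : List Reg :=
  match s with
  | .left => [x, y]
  | .right => [y, x]

/-- Construct Next, Prev, E and EdgeID for the graph on side `s` from its list of edges. -/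
def buildGraph (s : Side) : Cmd := block [
  forRange .r .numR (forRange .x (.numV s) (block [
    const .len 0,
    store (.nextLen s) [.r, .x] .len,
    store (.prevLen s) [.r, .x] .len,
    wzero .w,
    forRange .y (.numV s) (wstore (.edge s) [.x, .r, .y] .w)])),
  forRange .e (.numE s) (block [
    load .x (.inSrc s) [.e],
    load .r (.inLab s) [.e],
    load .y (.inDst s) [.e],
    wload .w (.inDeg s) [.e],
    wstore (.edge s) [.x, .r, .y] .w,
    store (.edgeID s) [.x, .r, .y] .e,
    load .len (.nextLen s) [.r, .x],
    store (.next s) [.r, .x, .len] .y,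
    succ .len .len,
    store (.nextLen s) [.r, .x] .len,
    load .len (.prevLen s) [.r, .y],
    store (.prev s) [.r, .y, .len] .x,
    succ .len .len,
    store (.prevLen s) [.r, .y] .len])]

/-- `Z[x, x'] := (L(x) ≤ L'(x'))` for all `x` and `x'`. -/
def initZ : Cmd :=
  forRange (.vert .left) (.numV .left) (forRange (.vert .right) (.numV .right) (block [
    const .bit 1,
    forRange .p .numP (block [
      wload .w (.label .left) [.vert .left, .p],
      wload .d (.label .right) [.vert .right, .p],
      .ite (.wle .w .d) .skip (const .bit 0)]),
    store .Z [.vert .left, .vert .right] .bit]))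

/-- Sort (by insertion) the vector in row `[r, v]` of `a`, whose length is in `aLen`, in ascending
order with respect to the degree that `E` has at `key z`, for the elements `z` of the vector. -/
def sortRow (a aLen : Arr) (E : WArr) (v : Reg) (key : Reg → List Reg) : Cmd := block [
  load .len aLen [.r, v],
  forRange .i .len (block [
    load .z a [.r, v, .i],
    wload .w E (key .z),
    move .j .i,
    const .go 1,
    .loop (.eq .go 1)
      (.ite (.eq .j 0) (const .go 0) (block [
        pred .k .j,
        load .y a [.r, v, .k],
        wload .d E (key .y),
        .ite (.wle .d .w) (const .go 0) (block [
          store a [.r, v, .j] .y,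
          move .j .k])])),
    store a [.r, v, .j] .z])]

/-- Sort `Next[r, x]` with respect to `E[x, r, y]`, for all `r` and `x`. -/
def sortNext (s : Side) : Cmd :=
  forRange .r .numR (forRange (.vert s) (.numV s)
    (sortRow (.next s) (.nextLen s) (.edge s) (.vert s) (fun z => [.vert s, .r, z])))

/-- Sort `Prev[r, y]` with respect to `E[x, r, y]`, for all `r` and `y`. -/
def sortPrev (s : Side) : Cmd :=
  forRange .r .numR (forRange (.vert s) (.numV s)
    (sortRow (.prev s) (.prevLen s) (.edge s) (.vert s) (fun z => [z, .r, .vert s])))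

/-- Set `rcNextElem[y, e]` to Null for all vertices `y` of the side opposite to `s` and all edges
`e` of the graph on side `s`. -/
def clearElem (s : Side) : Cmd := block [
  const .u 0,
  forRange (.vert s.opp) (.numV s.opp) (forRange .e (.numE s)
    (store (.rcNextElem s) [.vert s.opp, .e] .u))]

/-- For `s = left`: for all `r`, `y` and `x'`, construct the vector `rcPrev[r, y, x']` and the
doubly linked list `rcNext'[r, y, x']`, and store references to the elements of the latter in
`rcNextElem'`. For `s = right`: the dual. -/
def buildRc (s : Side) : Cmd :=
  forRange .r .numR (forRange (.vert s) (.numV s) (forRange (.vert s.opp) (.numV s.opp) (block [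
    const .j 0,
    load .len (.prevLen s) [.r, .vert s],
    forRange .i .len (block [
      load .x (.prev s) [.r, .vert s, .i],
      load .bit .Z (pairIdx s .x (.vert s.opp)),
      .ite (.eq .bit 1)
        (block [
          store (.rcPrev s) [.r, .vert s, .vert s.opp, .j] .x,
          succ .j .j])
        .skip]),
    store (.rcPrevLen s) [.r, .vert s, .vert s.opp] .j,
    const .before 0,
    load .len (.nextLen s.opp) [.r, .vert s.opp],
    forRange .i .len (block [
      load .y (.next s.opp) [.r, .vert s.opp, .i],
      load .bit .Z (pairIdx s (.vert s) .y),
      .ite (.eq .bit 1)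
        (block [
          succ .alloc .alloc,
          move .u .alloc,
          store .elemKey [.u] .y,
          store .elemBefore [.u] .before,
          const .after 0,
          store .elemAfter [.u] .after,
          .ite (.eq .before 0) .skip (store .elemAfter [.before] .u),
          load .e (.edgeID s.opp) [.vert s.opp, .r, .y],
          store (.rcNextElem s.opp) [.vert s, .e] .u,
          move .before .u])
        .skip]),
    store (.rcNextLast s.opp) [.r, .vert s.opp, .vert s] .before])))

/-- For `s = left` this is UpdateRcPrev(r, y, x'), for a vertex `y` of the left graph and a vertex
`x'` (register `x'`) of the right graph; for `s = right` it is the dual procedure, UpdateRcPrev'.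
The edge label is in the register `r`. -/
def updateRcPrev (s : Side) (y x' : Reg) : Cmd := block [
  load .u (.rcNextLast s.opp) [.r, x', y],
  .ite (.eq .u 0)
    (wzero .d)
    (block [
      load .z .elemKey [.u],
      wload .d (.edge s.opp) [x', .r, .z]]),
  const .go 1,
  .loop (.eq .go 1) (block [
    load .k (.rcPrevLen s) [.r, y, x'],
    .ite (.eq .k 0)
      (const .go 0)
      (block [
        pred .k .k,
        load .x (.rcPrev s) [.r, y, x', .k],
        wload .w (.edge s) [.x, .r, y],
        .ite (.wle .w .d)
          (const .go 0)
          (block [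
            store (.rcPrevLen s) [.r, y, x'] .k,
            load .bit .Z (pairIdx s .x x'),
            .ite (.eq .bit 1)
              (block [
                const .bit 0,
                store .Z (pairIdx s .x x') .bit,
                store (.queue s) [.tail] .x,
                store (.queue s.opp) [.tail] x',
                succ .tail .tail])
              .skip])])])]

/-- Call `updateRcPrev s` for all triples. -/
def updateAll (s : Side) : Cmd :=
  forRange .r .numR (forRange (.vert s) (.numV s) (forRange (.vert s.opp) (.numV s.opp)
    (updateRcPrev s (.vert s) (.vert s.opp))))

/-- The procedure InitializeDS. -/
def initializeDS : Cmd := block [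
  buildGraph .left,
  buildGraph .right,
  initZ,
  const .head 0,
  const .tail 0,
  sortNext .left,
  sortNext .right,
  sortPrev .left,
  sortPrev .right,
  clearElem .right,
  clearElem .left,
  const .alloc 0,
  buildRc .left,
  buildRc .right,
  updateAll .left,
  updateAll .right]

/-- Delete the element `u` from the doubly linked list `rcNext[r, x, y]`, where `x` is a vertex of
side `s` and `y` is a vertex of the opposite side. -/
def deleteElem (s : Side) (x y : Reg) : Cmd := block [
  load .before .elemBefore [.u],
  load .after .elemAfter [.u],
  .ite (.eq .before 0) .skip (store .elemAfter [.before] .after),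
  .ite (.eq .after 0)
    (store (.rcNextLast s) [.r, x, y] .before)
    (store .elemBefore [.after] .before)]

/-- For `s = left`: after the extraction of the pair `(y, y')`, for all `r` and all `x'` in
`Prev'[r, y']`, delete `y'` from `rcNext'[r, y, x']` and call UpdateRcPrev(r, y, x').
For `s = right`: the dual. -/
def propagate (s : Side) : Cmd :=
  forRange .r .numR (block [
    load .len (.prevLen s.opp) [.r, .ext s.opp],
    forRange .i .len (block [
      load (.vert s.opp) (.prev s.opp) [.r, .ext s.opp, .i],
      load .e (.edgeID s.opp) [.vert s.opp, .r, .ext s.opp],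
      load .u (.rcNextElem s.opp) [.ext s, .e],
      deleteElem s.opp (.vert s.opp) (.ext s),
      const .u 0,
      store (.rcNextElem s.opp) [.ext s, .e] .u,
      updateRcPrev s (.ext s) (.vert s.opp)])])

/-- Write the list of all pairs `(x, x')` with `Z[x, x']` to the output. -/
def returnZ : Cmd := block [
  const .outLen 0,
  forRange (.vert .left) (.numV .left) (forRange (.vert .right) (.numV .right) (block [
    load .bit .Z [.vert .left, .vert .right],
    .ite (.eq .bit 1)
      (block [
        store (.out .left) [.outLen] (.vert .left),
        store (.out .right) [.outLen] (.vert .right),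
        succ .outLen .outLen])
      .skip]))]

/-- The algorithm ComputeDirectedSimulationEfficiently. -/
def computeDirectedSimulationEfficiently : Cmd := block [
  initializeDS,
  .loop (.lt .head .tail) (block [
    load (.ext .left) (.queue .left) [.head],
    load (.ext .right) (.queue .right) [.head],
    succ .head .head,
    propagate .left,
    propagate .right]),
  returnZ]

/-! ## Input and output -/

/-- The memory `σ` holds on side `s` the graph `G`, whose vertices, vertex labels and edge labels
are numbered by `numV`, `numP` and `numR`: the number of vertices, the labels of the vertices, and
a list without repetitions, in an arbitrary order, of the nonzero edges with their degrees. -/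
structure HoldsGraph {P R V : Type*} [Fintype P] [Fintype R] [Fintype V]
    (numP : P ≃ Fin (Fintype.card P)) (numR : R ≃ Fin (Fintype.card R))
    (numV : V ≃ Fin (Fintype.card V)) (G : FuzzyGraph P R V) (s : Side) (σ : State) : Prop where
  vertices : σ.reg (.numV s) = Fintype.card V
  labels : ∀ x p, σ.warr (.label s) [numV x, numP p] = G.L x p
  numEdges : σ.reg (.numE s) = G.numEdges
  edges : ∃ f : Fin G.numEdges ≃ {t : V × R × V // 0 < G.E t.1 t.2.1 t.2.2},
    ∀ i : Fin G.numEdges,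
    σ.arr (.inSrc s) [(i : ℕ)] = numV (f i).1.1 ∧
    σ.arr (.inLab s) [(i : ℕ)] = numR (f i).1.2.1 ∧
    σ.arr (.inDst s) [(i : ℕ)] = numV (f i).1.2.2 ∧
    σ.warr (.inDeg s) [(i : ℕ)] = G.E (f i).1.1 (f i).1.2.1 (f i).1.2.2

/-- The memory `σ` holds an input of the algorithm that represents `G` and `H`. The content of all
registers and array entries that are not mentioned is arbitrary. -/
structure IsInput {P R V W : Type*} [Fintype P] [Fintype R] [Fintype V] [Fintype W]
    (numP : P ≃ Fin (Fintype.card P)) (numR : R ≃ Fin (Fintype.card R))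
    (numV : V ≃ Fin (Fintype.card V)) (numW : W ≃ Fin (Fintype.card W))
    (G : FuzzyGraph P R V) (H : FuzzyGraph P R W) (σ : State) : Prop where
  vertexLabels : σ.reg .numP = Fintype.card P
  edgeLabels : σ.reg .numR = Fintype.card R
  left : HoldsGraph numP numR numV G .left σ
  right : HoldsGraph numP numR numW H .right σ

/-- The relation that the output in the memory `σ` represents. -/
def output {V W : Type*} [Fintype V] [Fintype W]
    (numV : V ≃ Fin (Fintype.card V)) (numW : W ≃ Fin (Fintype.card W)) (σ : State) :
    Set (V × W) :=
  {q | ∃ i < σ.reg .outLen, σ.arr (.out .left) [i] = numV q.1 ∧ σ.arr (.out .right) [i] = numW q.2}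

end DirSim

/-!
The algorithm computes a greatest fixed point. It starts from the relation `Z` of all pairs of
vertices whose labels are compatible, which contains every directed simulation, and removes a pair
only if no directed simulation contained in the current `Z` contains it; hence `Z` contains every
directed simulation at any time. When nothing is left to be removed, `Z` is itself a directed
simulation, and so it is the largest one.

The content is in the invariant `Data.Core`. For `s = left`, a triple `(r, y, x')` comes with the
vector `rcPrev[r, y, x']` of the possible sources `x` of `r`-edges into `y` that are still related
to `x'`, and with the list `rcNext'[r, y, x']` of the `y'` that are still related to `y` and are
targets of `r`-edges from `x'`; for `s = right` the two graphs are exchanged, which accounts for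
condition (3) of a directed simulation in the same way as `s = left` accounts for condition (2).
Both are sorted by degree. So the pair `(x, x')` has a partner for the edge from `x` to `y` if and
only if the degree of that edge is at most the degree of the last element of the list, and the `x`
that violate this form a final segment of the vector: `updateRcPrev` pops exactly these
(`wp_updateRcPrev`), after which the triple is settled. A pair is put into the queue when it is
removed from `Z` (`Core.kill`). Treating the pair `(y, y')` deletes `y'` from all lists of the form
`rcNext'[r, y, x']`, and dually (`wp_propagate`), so that at any time the lists contain precisely
the elements whose pairs have not been treated yet (`Data.remaining`). At the end of the main loop
all removed pairs have been treated, the lists agree with `Z`, and all triples are settled; this is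
the property of a directed simulation (`Core.isSim`).

The references `rcNextElem` allow a list element to be found and unlinked in constant time. The list
elements are numbered in the order of their allocation, and since the lists are built from sorted
vectors, this order agrees with the order of the degrees. This makes it possible to describe a
doubly linked list by a set of numbers that is linked in ascending order (`IsLinked`); deletion of
an element preserves this (`IsLinked.delete`).

The time bound is amortized. A call of `updateRcPrev` takes constant time, apart from the iterations
that delete an entry of some `rcPrev`; these are paid for by a potential proportional to the number
of all such entries (`Data.potential`), which is `O(m n)` initially. Every pair enters the queue at
most once, so the main loop treats each triple of an edge of one graph and a vertex of the other at
most a constant number of times (`Core.sum_queue_le`, `sum_propagateTime`), which is `O((m + n) n)`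
in total. In the initialization, insertion sort takes time quadratic in the length of a vector; as a
vector has at most `n` entries and all vectors together have `m` entries, this is `O(m n)` as well.

Programs are analysed with a total-correctness predicate `Wp` that counts steps, rules for `for`
loops with an invariant and a potential, and the fact that a program only changes what it writes
syntactically (`Exec.frame`). The machine is deterministic (`Exec.unique`), so the terminating
execution that is constructed is the only one.
-/

namespace DirSim

open Cmd

/-! ### Total correctness with a step count -/

@[simp] theorem Side.ne_opp (s : Side) : s ≠ s.opp := by cases s <;> simp [Side.opp]

@[simp] theorem Side.opp_ne (s : Side) : s.opp ≠ s := s.ne_opp.symm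

/-- Total correctness: `c`, started in `σ`, terminates, and the final state and the number of
steps satisfy `Q`. -/
def Wp (c : Cmd) (σ : State) (Q : State → ℕ → Prop) : Prop :=
  ∃ τ t, Exec c σ τ t ∧ Q τ t

/-- The machine is deterministic. -/
theorem Exec.unique {c : Cmd} {σ τ τ' : State} {t t' : ℕ} (h : Exec c σ τ t)
    (h' : Exec c σ τ' t') : τ = τ' ∧ t = t' := by
  induction h generalizing τ' t' with
  | skip => cases h'; exact ⟨rfl, rfl⟩
  | instr => cases h'; exact ⟨rfl, rfl⟩
  | seq _ _ ih₁ ih₂ =>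
    cases h' with
    | seq h₁ h₂ =>
      obtain ⟨rfl, rfl⟩ := ih₁ h₁
      obtain ⟨rfl, rfl⟩ := ih₂ h₂
      exact ⟨rfl, rfl⟩
  | iteTrue hb _ ih =>
    cases h' with
    | iteTrue _ h => obtain ⟨rfl, rfl⟩ := ih h; exact ⟨rfl, rfl⟩
    | iteFalse hb' _ => exact absurd hb hb'
  | iteFalse hb _ ih =>
    cases h' with
    | iteTrue hb' _ => exact absurd hb' hb
    | iteFalse _ h => obtain ⟨rfl, rfl⟩ := ih h; exact ⟨rfl, rfl⟩
  | loopTrue hb _ _ ih₁ ih₂ =>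
    cases h' with
    | loopTrue _ h₁ h₂ =>
      obtain ⟨rfl, rfl⟩ := ih₁ h₁
      obtain ⟨rfl, rfl⟩ := ih₂ h₂
      exact ⟨rfl, rfl⟩
    | loopFalse hb' => exact absurd hb hb'
  | loopFalse hb =>
    cases h' with
    | loopTrue hb' _ _ => exact absurd hb' hb
    | loopFalse _ => exact ⟨rfl, rfl⟩

theorem Wp.mono {c : Cmd} {σ : State} {Q Q' : State → ℕ → Prop} (h : Wp c σ Q)
    (hQ : ∀ τ t, Q τ t → Q' τ t) : Wp c σ Q' := by
  obtain ⟨τ, t, he, hq⟩ := h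
  exact ⟨τ, t, he, hQ τ t hq⟩

@[simp] theorem wp_skip {σ : State} {Q : State → ℕ → Prop} : Wp .skip σ Q ↔ Q σ 0 := by
  constructor
  · rintro ⟨τ, t, h, hq⟩; cases h; exact hq
  · intro h; exact ⟨_, _, .skip σ, h⟩

@[simp] theorem wp_instr {a : Instr} {σ : State} {Q : State → ℕ → Prop} :
    Wp (.instr a) σ Q ↔ Q (a.apply σ) 1 := by
  constructor
  · rintro ⟨τ, t, h, hq⟩; cases h; exact hq
  · intro h; exact ⟨_, _, .instr a σ, h⟩

@[simp] theorem wp_seq {c d : Cmd} {σ : State} {Q : State → ℕ → Prop} :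
    Wp (.seq c d) σ Q ↔ Wp c σ fun τ t => Wp d τ fun ρ u => Q ρ (t + u) := by
  constructor
  · rintro ⟨τ, t, h, hq⟩
    cases h with
    | seq h₁ h₂ => exact ⟨_, _, h₁, _, _, h₂, hq⟩
  · rintro ⟨τ, t, h₁, ρ, u, h₂, hq⟩
    exact ⟨_, _, .seq h₁ h₂, hq⟩

@[simp] theorem wp_ite {b : Test} {c d : Cmd} {σ : State} {Q : State → ℕ → Prop} :
    Wp (.ite b c d) σ Q ↔
      (b.holds σ → Wp c σ fun τ t => Q τ (1 + t)) ∧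
        (¬ b.holds σ → Wp d σ fun τ t => Q τ (1 + t)) := by
  constructor
  · rintro ⟨τ, t, h, hq⟩
    cases h with
    | iteTrue hb h => exact ⟨fun _ => ⟨_, _, h, hq⟩, fun hb' => absurd hb hb'⟩
    | iteFalse hb h => exact ⟨fun hb' => absurd hb' hb, fun _ => ⟨_, _, h, hq⟩⟩
  · rintro ⟨h₁, h₂⟩
    by_cases hb : b.holds σ
    · obtain ⟨τ, t, h, hq⟩ := h₁ hb
      exact ⟨_, _, .iteTrue hb h, hq⟩
    · obtain ⟨τ, t, h, hq⟩ := h₂ hb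
      exact ⟨_, _, .iteFalse hb h, hq⟩

@[simp] theorem wp_block_nil {σ : State} {Q : State → ℕ → Prop} : Wp (block []) σ Q ↔ Q σ 0 :=
  wp_skip

@[simp] theorem wp_block_cons {c : Cmd} {cs : List Cmd} {σ : State} {Q : State → ℕ → Prop} :
    Wp (block (c :: cs)) σ Q ↔ Wp c σ fun τ t => Wp (block cs) τ fun ρ u => Q ρ (t + u) :=
  wp_seq

section Instr

variable {σ : State} {Q : State → ℕ → Prop}

@[simp] theorem wp_const {x k} : Wp (const x k) σ Q ↔ Q (σ.setReg x k) 1 := wp_instr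
@[simp] theorem wp_move {x y} : Wp (move x y) σ Q ↔ Q (σ.setReg x (σ.reg y)) 1 := wp_instr
@[simp] theorem wp_succ {x y} : Wp (succ x y) σ Q ↔ Q (σ.setReg x (σ.reg y + 1)) 1 := wp_instr
@[simp] theorem wp_pred {x y} : Wp (pred x y) σ Q ↔ Q (σ.setReg x (σ.reg y - 1)) 1 := wp_instr
@[simp] theorem wp_load {x a idx} :
    Wp (load x a idx) σ Q ↔ Q (σ.setReg x (σ.arr a (idx.map σ.reg))) 1 := wp_instr
@[simp] theorem wp_store {x a idx} :
    Wp (store a idx x) σ Q ↔ Q (σ.setArr a (idx.map σ.reg) (σ.reg x)) 1 := wp_instr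
@[simp] theorem wp_wzero {w} : Wp (wzero w) σ Q ↔ Q (σ.setWReg w 0) 1 := wp_instr
@[simp] theorem wp_wload {w a idx} :
    Wp (wload w a idx) σ Q ↔ Q (σ.setWReg w (σ.warr a (idx.map σ.reg))) 1 := wp_instr
@[simp] theorem wp_wstore {w a idx} :
    Wp (wstore a idx w) σ Q ↔ Q (σ.setWArr a (idx.map σ.reg) (σ.wreg w)) 1 := wp_instr

end Instr

namespace State

variable (σ : State)

@[simp] theorem reg_setReg (x v y) : (σ.setReg x v).reg y = if y = x then v else σ.reg y := by
  simp [setReg, Function.update_apply]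
@[simp] theorem arr_setReg (x v) : (σ.setReg x v).arr = σ.arr := rfl
@[simp] theorem warr_setReg (x v) : (σ.setReg x v).warr = σ.warr := rfl
@[simp] theorem wreg_setReg (x v) : (σ.setReg x v).wreg = σ.wreg := rfl
@[simp] theorem reg_setWReg (x v) : (σ.setWReg x v).reg = σ.reg := rfl
@[simp] theorem arr_setWReg (x v) : (σ.setWReg x v).arr = σ.arr := rfl
@[simp] theorem warr_setWReg (x v) : (σ.setWReg x v).warr = σ.warr := rfl
@[simp] theorem wreg_setWReg (x v y) : (σ.setWReg x v).wreg y = if y = x then v else σ.wreg y := by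
  simp [setWReg, Function.update_apply]
@[simp] theorem reg_setArr (a i v) : (σ.setArr a i v).reg = σ.reg := rfl
@[simp] theorem wreg_setArr (a i v) : (σ.setArr a i v).wreg = σ.wreg := rfl
@[simp] theorem warr_setArr (a i v) : (σ.setArr a i v).warr = σ.warr := rfl
@[simp] theorem arr_setArr (a i v b) : (σ.setArr a i v).arr b =
    if b = a then Function.update (σ.arr a) i v else σ.arr b := by
  simp [setArr, Function.update_apply]
@[simp] theorem reg_setWArr (a i v) : (σ.setWArr a i v).reg = σ.reg := rfl
@[simp] theorem wreg_setWArr (a i v) : (σ.setWArr a i v).wreg = σ.wreg := rfl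
@[simp] theorem arr_setWArr (a i v) : (σ.setWArr a i v).arr = σ.arr := rfl
@[simp] theorem warr_setWArr (a i v b) : (σ.setWArr a i v).warr b =
    if b = a then Function.update (σ.warr a) i v else σ.warr b := by
  simp [setWArr, Function.update_apply]

end State

/-! ### What a program may change -/

/-- Whether the instruction writes the register. -/
def Instr.writesReg : Instr → Reg → Bool
  | .const x _, y => decide (x = y)
  | .move x _, y => decide (x = y)
  | .succ x _, y => decide (x = y)
  | .pred x _, y => decide (x = y)
  | .load x _ _, y => decide (x = y)
  | _, _ => false

/-- Whether the instruction writes the array. -/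
def Instr.writesArr : Instr → Arr → Bool
  | .store a _ _, b => decide (a = b)
  | _, _ => false

/-- Whether the instruction writes the degree array. -/
def Instr.writesWArr : Instr → WArr → Bool
  | .wstore a _ _, b => decide (a = b)
  | _, _ => false

/-- Whether the register is written somewhere in the program. -/
def Cmd.writesReg : Cmd → Reg → Bool
  | .skip, _ => false
  | .instr a, x => a.writesReg x
  | .seq c d, x => c.writesReg x || d.writesReg x
  | .ite _ c d, x => c.writesReg x || d.writesReg x
  | .loop _ c, x => c.writesReg x

/-- Whether the array is written somewhere in the program. -/
def Cmd.writesArr : Cmd → Arr → Bool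
  | .skip, _ => false
  | .instr a, x => a.writesArr x
  | .seq c d, x => c.writesArr x || d.writesArr x
  | .ite _ c d, x => c.writesArr x || d.writesArr x
  | .loop _ c, x => c.writesArr x

/-- Whether the degree array is written somewhere in the program. -/
def Cmd.writesWArr : Cmd → WArr → Bool
  | .skip, _ => false
  | .instr a, x => a.writesWArr x
  | .seq c d, x => c.writesWArr x || d.writesWArr x
  | .ite _ c d, x => c.writesWArr x || d.writesWArr x
  | .loop _ c, x => c.writesWArr x

/-- The states `σ` and `τ` differ at most where `c` writes. -/
structure Frame (c : Cmd) (σ τ : State) : Prop where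
  reg : ∀ x, c.writesReg x = false → τ.reg x = σ.reg x
  arr : ∀ a, c.writesArr a = false → τ.arr a = σ.arr a
  warr : ∀ a, c.writesWArr a = false → τ.warr a = σ.warr a

theorem Frame.refl (c : Cmd) (σ : State) : Frame c σ σ :=
  ⟨fun _ _ => rfl, fun _ _ => rfl, fun _ _ => rfl⟩

theorem Frame.trans {c : Cmd} {σ τ ρ : State} (h : Frame c σ τ) (h' : Frame c τ ρ) :
    Frame c σ ρ :=
  ⟨fun x hx => (h'.reg x hx).trans (h.reg x hx), fun x hx => (h'.arr x hx).trans (h.arr x hx),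
    fun x hx => (h'.warr x hx).trans (h.warr x hx)⟩

theorem Frame.mono {c d : Cmd} {σ τ : State} (h : Frame c σ τ)
    (h₁ : ∀ x, d.writesReg x = false → c.writesReg x = false)
    (h₂ : ∀ x, d.writesArr x = false → c.writesArr x = false)
    (h₃ : ∀ x, d.writesWArr x = false → c.writesWArr x = false) : Frame d σ τ :=
  ⟨fun x hx => h.reg x (h₁ x hx), fun x hx => h.arr x (h₂ x hx), fun x hx => h.warr x (h₃ x hx)⟩

theorem Frame.instr (a : Instr) (σ : State) : Frame (.instr a) σ (a.apply σ) := by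
  refine ⟨fun x hx => ?_, fun x hx => ?_, fun x hx => ?_⟩ <;> cases a <;>
    first
    | rfl
    | exact Function.update_of_ne (fun h => of_decide_eq_false hx h.symm) _ _

theorem Exec.frame {c : Cmd} {σ τ : State} {t : ℕ} (h : Exec c σ τ t) : Frame c σ τ := by
  induction h with
  | skip => exact .refl _ _
  | instr a σ => exact .instr a σ
  | seq _ _ ih₁ ih₂ =>
    refine (ih₁.mono ?_ ?_ ?_).trans (ih₂.mono ?_ ?_ ?_) <;>
      simp +contextual [Cmd.writesReg, Cmd.writesArr, Cmd.writesWArr]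
  | iteTrue _ _ ih =>
    refine ih.mono ?_ ?_ ?_ <;> simp +contextual [Cmd.writesReg, Cmd.writesArr, Cmd.writesWArr]
  | iteFalse _ _ ih =>
    refine ih.mono ?_ ?_ ?_ <;> simp +contextual [Cmd.writesReg, Cmd.writesArr, Cmd.writesWArr]
  | loopTrue _ _ _ ih₁ ih₂ =>
    exact Frame.trans (ih₁.mono (fun _ h => h) (fun _ h => h) (fun _ h => h)) ih₂
  | loopFalse => exact .refl _ _

/-- The frame condition may be used together with any total-correctness statement. -/
theorem Wp.frame {c : Cmd} {σ : State} {Q : State → ℕ → Prop} (h : Wp c σ Q) :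
    Wp c σ fun τ t => Q τ t ∧ Frame c σ τ := by
  obtain ⟨τ, t, he, hq⟩ := h
  exact ⟨τ, t, he, hq, he.frame⟩

/-! ### Loops -/

/-- The rule for `while` loops. The time spent so far is the second argument of the invariant. -/
theorem wp_loop {b : Test} {c : Cmd} (I : State → ℕ → Prop) (μ : State → ℕ)
    (step : ∀ σ t, I σ t → b.holds σ → Wp c σ fun τ u => I τ (t + 1 + u) ∧ μ τ < μ σ)
    {σ : State} (h : I σ 0) :
    Wp (.loop b c) σ fun τ t => ∃ u, t = u + 1 ∧ I τ u ∧ ¬ b.holds τ := by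
  suffices H : ∀ k σ t, μ σ = k → I σ t →
      Wp (.loop b c) σ fun τ u => ∃ v, t + u = v + 1 ∧ I τ v ∧ ¬ b.holds τ by
    simpa using H _ σ 0 rfl h
  intro k
  induction k using Nat.strong_induction_on with
  | _ k ih =>
    rintro σ t rfl hI
    by_cases hb : b.holds σ
    · obtain ⟨τ, u, he, hI', hlt⟩ := step σ t hI hb
      obtain ⟨ρ, v, he', w, hw, hI'', hb'⟩ := ih _ hlt τ _ rfl hI'
      exact ⟨ρ, 1 + u + v, .loopTrue hb he he', w, by omega, hI'', hb'⟩
    · exact ⟨σ, 1, .loopFalse hb, t, rfl, hI, hb⟩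

/-- The rule for `for` loops with an invariant and a potential `Φ` that pays for a part of the
steps: the amortized cost of the `k`-th execution of the body is `cost k`. -/
theorem wp_for {i n : Reg} {c : Cmd} {σ : State} (N : ℕ) (Inv : ℕ → State → Prop)
    (Φ : (Arr → List ℕ → ℕ) → ℕ) (cost : ℕ → ℕ) (hN : σ.reg n = N)
    (hi : c.writesReg i = false) (hn : (forRange i n c).writesReg n = false)
    (init : Inv 0 (σ.setReg i 0))
    (step : ∀ k < N, ∀ τ, Inv k τ → τ.reg i = k → Frame (forRange i n c) σ τ →
      Wp c τ fun ρ t => Inv (k + 1) (ρ.setReg i (k + 1)) ∧ t + Φ ρ.arr ≤ Φ τ.arr + cost k) :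
    Wp (forRange i n c) σ fun τ t =>
      Inv N τ ∧ t + Φ τ.arr ≤ Φ σ.arr + (2 + ∑ k ∈ Finset.range N, (cost k + 2)) := by
  suffices H : ∀ j k τ, j + k = N → Inv k τ → τ.reg i = k → Frame (forRange i n c) σ τ →
      Wp (.loop (.lt i n) (block [c, succ i i])) τ fun ρ t => Inv N ρ ∧
        t + Φ ρ.arr + ∑ k ∈ Finset.range k, (cost k + 2) ≤
          Φ τ.arr + (1 + ∑ k ∈ Finset.range N, (cost k + 2)) by
    obtain ⟨ρ, t, he, hI, ht⟩ := H N 0 (σ.setReg i 0) rfl init (by simp [State.reg_setReg])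
      ⟨fun x hx => by
        have : ¬ x = i := by
          rintro rfl
          simp [forRange, block, Cmd.const, Cmd.writesReg, Instr.writesReg] at hx
        simp [State.reg_setReg, this], fun _ _ => rfl, fun _ _ => rfl⟩
    refine ⟨ρ, 1 + (t + 0), .seq (.instr _ _) (.seq he (.skip _)), hI, ?_⟩
    simp only [Finset.range_zero, Finset.sum_empty, State.arr_setReg] at ht
    omega
  have hni : n ≠ i := by
    rintro rfl
    simp [forRange, block, Cmd.const, Cmd.writesReg, Instr.writesReg] at hn
  intro j
  induction j with
  | zero =>
    intro k τ hk hI hr hF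
    obtain rfl : k = N := by omega
    refine ⟨τ, 1, .loopFalse ?_, hI, by omega⟩
    simp [Test.holds, hr, hF.reg n hn, hN]
  | succ j ih =>
    intro k τ hk hI hr hF
    obtain ⟨ρ, t, he, hI', ht⟩ := step k (by omega) τ hI hr hF
    have hri : ρ.reg i = k := by rw [he.frame.reg i hi, hr]
    have hF' : Frame (forRange i n c) σ (ρ.setReg i (k + 1)) := by
      refine hF.trans ⟨fun x hx => ?_, fun a ha => ?_, fun a ha => ?_⟩
      · simp [forRange, block, Cmd.const, Cmd.writesReg, Instr.writesReg] at hx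
        rw [State.reg_setReg, if_neg (fun h => hx.1 h.symm), he.frame.reg x hx.2.1]
      · simp [forRange, block, Cmd.const, Cmd.writesArr, Instr.writesArr] at ha
        exact he.frame.arr a ha.1
      · simp [forRange, block, Cmd.const, Cmd.writesWArr, Instr.writesWArr] at ha
        exact he.frame.warr a ha.1
    obtain ⟨ω, u, he', hI'', hu⟩ := ih (k + 1) (ρ.setReg i (k + 1)) (by omega) hI'
      (by simp [State.reg_setReg]) hF'
    refine ⟨ω, 1 + (t + (1 + 0)) + u, .loopTrue ?_ (.seq he (.seq (.instr _ _) (.skip _))) ?_,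
      hI'', ?_⟩
    · simp only [Test.holds, hr, hF.reg n hn, hN]; omega
    · simpa [Instr.apply, hri] using he'
    · rw [Finset.sum_range_succ] at hu
      rw [State.arr_setReg] at hu
      omega

theorem setOf_lt_union_setOf_eq (k M : ℕ) :
    {q : ℕ × ℕ | q.1 < k ∧ q.2 < M} ∪ {q | q.1 = k ∧ q.2 < M} = {q | q.1 < k + 1 ∧ q.2 < M} := by
  ext ⟨a, b⟩
  simp only [Set.mem_union, Set.mem_ofPred_eq]
  omega

theorem insert_union_setOf_eq (S : Set (ℕ × ℕ)) (k l : ℕ) :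
    insert (k, l) (S ∪ {q | q.1 = k ∧ q.2 < l}) = S ∪ {q | q.1 = k ∧ q.2 < l + 1} := by
  ext ⟨a, b⟩
  by_cases h : (a, b) ∈ S
  · simp [h]
  · simp only [Set.mem_insert_iff, Set.mem_union, Set.mem_ofPred_eq, Prod.mk.injEq, h, false_or]
    omega

theorem setOf_insert_prod (S : Set (ℕ × ℕ)) (k p O : ℕ) :
    {q : ℕ × ℕ × ℕ | (q.1, q.2.1) ∈ S ∧ q.2.2 < O} ∪ {q | q.1 = k ∧ q.2.1 = p ∧ q.2.2 < O} =
      {q | (q.1, q.2.1) ∈ insert (k, p) S ∧ q.2.2 < O} := by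
  ext ⟨a, b, c⟩
  simp only [Set.mem_union, Set.mem_ofPred_eq, Set.mem_insert_iff, Prod.mk.injEq]
  tauto

theorem insert_union_setOf_eq_and (S : Set (ℕ × ℕ × ℕ)) (k p l : ℕ) :
    insert (k, p, l) (S ∪ {q | q.1 = k ∧ q.2.1 = p ∧ q.2.2 < l}) =
      S ∪ {q | q.1 = k ∧ q.2.1 = p ∧ q.2.2 < l + 1} := by
  ext ⟨a, b, c⟩
  by_cases h : (a, b, c) ∈ S
  · simp [h]
  · simp only [Set.mem_insert_iff, Set.mem_union, Set.mem_ofPred_eq, Prod.mk.injEq, h, false_or]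
    omega

/-- Two nested `for` loops, with an invariant that is indexed by the set of the pairs that have
been treated and does not depend on the loop variables. -/
theorem wp_for₂ {i n j m : Reg} {c : Cmd} {σ : State} (N M : ℕ)
    (Inv : Set (ℕ × ℕ) → State → Prop)
    (Φ : (Arr → List ℕ → ℕ) → ℕ) (cost : ℕ → ℕ → ℕ) (hN : σ.reg n = N) (hM : σ.reg m = M)
    (hi : (forRange j m c).writesReg i = false)
    (hn : (forRange i n (forRange j m c)).writesReg n = false)
    (hj : c.writesReg j = false)
    (hm : (forRange i n (forRange j m c)).writesReg m = false)
    (hreg : ∀ S τ x k, Inv S τ → x = i ∨ x = j → Inv S (τ.setReg x k))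
    (init : Inv ∅ σ)
    (step : ∀ S, ∀ k < N, ∀ l < M, (k, l) ∉ S → ∀ τ, Inv S τ → τ.reg i = k → τ.reg j = l →
      Frame (forRange i n (forRange j m c)) σ τ →
      Wp c τ fun ρ t => Inv (insert (k, l) S) ρ ∧ t + Φ ρ.arr ≤ Φ τ.arr + cost k l) :
    Wp (forRange i n (forRange j m c)) σ fun τ t => Inv {q | q.1 < N ∧ q.2 < M} τ ∧
      t + Φ τ.arr ≤ Φ σ.arr +
        (2 + 4 * N + ∑ k ∈ Finset.range N, ∑ l ∈ Finset.range M, (cost k l + 2)) := by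
  have hm' : (forRange j m c).writesReg m = false := by
    simp [forRange, block, Cmd.const, Cmd.succ, Cmd.writesReg, Instr.writesReg] at hm ⊢
    exact hm.2.1
  have H := wp_for (i := i) (n := n) (c := forRange j m c) (σ := σ) N
    (fun k τ => Inv {q | q.1 < k ∧ q.2 < M} τ) Φ
    (fun k => 2 + ∑ l ∈ Finset.range M, (cost k l + 2)) hN hi hn
    (by simpa using hreg _ _ i 0 init (.inl rfl)) ?_
  · refine H.mono fun τ t h => ⟨h.1, h.2.trans_eq ?_⟩
    simp only [Finset.sum_add_distrib, Finset.sum_const, Finset.card_range, smul_eq_mul]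
    ring
  intro k hk τ hI hr hF
  have H' := wp_for (i := j) (n := m) (c := c) (σ := τ) M
    (fun l τ => Inv ({q | q.1 < k ∧ q.2 < M} ∪ {q | q.1 = k ∧ q.2 < l}) τ) Φ
    (fun l => cost k l) (by rw [hF.reg m hm, hM]) hj hm'
    (by simpa using hreg _ _ j 0 hI (.inr rfl)) ?_
  · refine H'.mono fun ρ t h => ⟨hreg _ _ _ _ ?_ (.inl rfl), h.2⟩
    rw [← setOf_lt_union_setOf_eq]
    exact h.1
  intro l hl ρ hI' hr' hF'
  have hri : ρ.reg i = k := by rw [hF'.reg i hi, hr]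
  refine (step _ k hk l hl ?_ ρ hI' hri hr' (hF.trans (hF'.mono ?_ ?_ ?_))).mono
    fun ω t h => ⟨hreg _ _ _ _ ?_ (.inr rfl), h.2⟩
  · simp
  · simp +contextual [forRange, block, Cmd.const, Cmd.succ, Cmd.writesReg, Instr.writesReg]
  · simp +contextual [forRange, block, Cmd.const, Cmd.succ, Cmd.writesArr, Instr.writesArr]
  · simp +contextual [forRange, block, Cmd.const, Cmd.succ, Cmd.writesWArr, Instr.writesWArr]
  · rw [← insert_union_setOf_eq]
    exact h.1

/-- Three nested `for` loops, with an invariant that is indexed by the set of the triples that have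
been treated and does not depend on the loop variables. -/
theorem wp_for₃ {i n j m l o : Reg} {c : Cmd} {σ : State} (N M O : ℕ)
    (Inv : Set (ℕ × ℕ × ℕ) → State → Prop)
    (Φ : (Arr → List ℕ → ℕ) → ℕ) (cost : ℕ → ℕ → ℕ → ℕ)
    (hN : σ.reg n = N) (hM : σ.reg m = M) (hO : σ.reg o = O)
    (hi : (forRange j m (forRange l o c)).writesReg i = false)
    (hn : (forRange i n (forRange j m (forRange l o c))).writesReg n = false)
    (hj : (forRange l o c).writesReg j = false)
    (hm : (forRange i n (forRange j m (forRange l o c))).writesReg m = false)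
    (hl : c.writesReg l = false)
    (ho : (forRange i n (forRange j m (forRange l o c))).writesReg o = false)
    (hreg : ∀ S τ x k, Inv S τ → x = i ∨ x = j ∨ x = l → Inv S (τ.setReg x k))
    (init : Inv ∅ σ)
    (step : ∀ S, ∀ k < N, ∀ p < M, ∀ q < O, (k, p, q) ∉ S → ∀ τ, Inv S τ →
      τ.reg i = k → τ.reg j = p → τ.reg l = q →
      Frame (forRange i n (forRange j m (forRange l o c))) σ τ →
      Wp c τ fun ρ t => Inv (insert (k, p, q) S) ρ ∧ t + Φ ρ.arr ≤ Φ τ.arr + cost k p q) :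
    Wp (forRange i n (forRange j m (forRange l o c))) σ fun τ t =>
      Inv {q | q.1 < N ∧ q.2.1 < M ∧ q.2.2 < O} τ ∧
      t + Φ τ.arr ≤ Φ σ.arr + (2 + 4 * N + 4 * (N * M) +
        ∑ k ∈ Finset.range N, ∑ p ∈ Finset.range M, ∑ q ∈ Finset.range O, (cost k p q + 2)) := by
  have ho' : (forRange l o c).writesReg o = false := by
    simp [forRange, block, Cmd.const, Cmd.succ, Cmd.writesReg, Instr.writesReg] at ho ⊢
    tauto
  have hi' : (forRange l o c).writesReg i = false := by
    simp [forRange, block, Cmd.const, Cmd.succ, Cmd.writesReg, Instr.writesReg] at hi ⊢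
    exact hi.2.1
  have H := wp_for₂ (i := i) (n := n) (j := j) (m := m) (c := forRange l o c) (σ := σ) N M
    (fun S τ => Inv {q | (q.1, q.2.1) ∈ S ∧ q.2.2 < O} τ) Φ
    (fun k p => 2 + ∑ q ∈ Finset.range O, (cost k p q + 2)) hN hM hi hn hj hm
    (fun S τ x k h hx => hreg _ _ _ _ h (by tauto)) (by simpa using init) ?_
  · refine H.mono fun τ t h => ⟨?_, h.2.trans_eq ?_⟩
    · convert h.1 using 1
      ext q
      simp [and_assoc]
    · simp only [Finset.sum_add_distrib, Finset.sum_const, Finset.card_range, smul_eq_mul]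
      ring
  intro S k hk p hp hkp τ hI hr hr₂ hF
  have H' := wp_for (i := l) (n := o) (c := c) (σ := τ) O
    (fun e τ => Inv ({q | (q.1, q.2.1) ∈ S ∧ q.2.2 < O} ∪ {q | q.1 = k ∧ q.2.1 = p ∧ q.2.2 < e}) τ)
    Φ (fun q => cost k p q) (by rw [hF.reg o ho, hO]) hl ho'
    (by simpa using hreg _ _ l 0 hI (by tauto)) ?_
  · refine H'.mono fun ρ t h => ⟨?_, h.2⟩
    rw [← setOf_insert_prod]
    exact h.1
  intro q hq ρ hI' hr' hF'
  refine (step _ k hk p hp q hq ?_ ρ hI' (by rw [hF'.reg i hi', hr]) (by rw [hF'.reg j hj, hr₂])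
    hr' (hF.trans (hF'.mono ?_ ?_ ?_))).mono
    fun ω t h => ⟨hreg _ _ _ _ ?_ (by tauto), h.2⟩
  · simp [hkp]
  · simp +contextual [forRange, block, Cmd.const, Cmd.succ, Cmd.writesReg, Instr.writesReg]
  · simp +contextual [forRange, block, Cmd.const, Cmd.succ, Cmd.writesArr, Instr.writesArr]
  · simp +contextual [forRange, block, Cmd.const, Cmd.succ, Cmd.writesWArr, Instr.writesWArr]
  · rw [← insert_union_setOf_eq_and]
    exact h.1

/-! ### The numerical form of the input -/

/-- Two fuzzy graphs whose vertices and labels are natural numbers: `W s x r y` is the degree of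
the `r`-labeled edge from `x` to `y` in the graph on side `s`, and the nonzero edges on side `s`
are numbered from `0` to `m s - 1`, with sources `src`, labels `lab` and targets `dst`. There are
`nP` vertex labels, `nR` edge labels and `nV s` vertices on side `s`, and `L s x p` is the degree
to which `x` carries the vertex label `p`. -/
structure Data where
  nP : ℕ
  nR : ℕ
  nV : Side → ℕ
  m : Side → ℕ
  W : Side → ℕ → ℕ → ℕ → unitInterval
  L : Side → ℕ → ℕ → unitInterval
  src : Side → ℕ → ℕ
  lab : Side → ℕ → ℕ
  dst : Side → ℕ → ℕ
  src_lt : ∀ {s i}, i < m s → src s i < nV s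
  lab_lt : ∀ {s i}, i < m s → lab s i < nR
  dst_lt : ∀ {s i}, i < m s → dst s i < nV s
  pos : ∀ {s i}, i < m s → 0 < W s (src s i) (lab s i) (dst s i)
  exists_edge : ∀ {s x r y}, 0 < W s x r y → ∃ i < m s, src s i = x ∧ lab s i = r ∧ dst s i = y
  edge_inj : ∀ {s i j}, i < m s → j < m s → src s i = src s j → lab s i = lab s j →
    dst s i = dst s j → i = j

namespace Data

variable (D : Data)

theorem lt_of_pos {D : Data} {s : Side} {x r y : ℕ} (h : 0 < D.W s x r y) :
    x < D.nV s ∧ r < D.nR ∧ y < D.nV s := by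
  obtain ⟨i, hi, rfl, rfl, rfl⟩ := D.exists_edge h
  exact ⟨D.src_lt hi, D.lab_lt hi, D.dst_lt hi⟩

/-- The registers that describe the sizes of the input. -/
structure Sizes (σ : State) : Prop where
  numP : σ.reg .numP = D.nP
  numR : σ.reg .numR = D.nR
  numV : ∀ s, σ.reg (.numV s) = D.nV s
  numE : ∀ s, σ.reg (.numE s) = D.m s

/-- The arrays of the input. -/
structure Input (σ : State) : Prop where
  label : ∀ s, ∀ x < D.nV s, ∀ p < D.nP, σ.warr (.label s) [x, p] = D.L s x p
  inSrc : ∀ s, ∀ i < D.m s, σ.arr (.inSrc s) [i] = D.src s i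
  inLab : ∀ s, ∀ i < D.m s, σ.arr (.inLab s) [i] = D.lab s i
  inDst : ∀ s, ∀ i < D.m s, σ.arr (.inDst s) [i] = D.dst s i
  inDeg : ∀ s, ∀ i < D.m s, σ.warr (.inDeg s) [i] = D.W s (D.src s i) (D.lab s i) (D.dst s i)

variable {D}

theorem Sizes.frame {c : Cmd} {σ τ : State} (h : D.Sizes σ) (hF : Frame c σ τ)
    (hP : c.writesReg .numP = false) (hR : c.writesReg .numR = false)
    (hV : ∀ s, c.writesReg (.numV s) = false) (hE : ∀ s, c.writesReg (.numE s) = false) :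
    D.Sizes τ :=
  ⟨(hF.reg _ hP).trans h.numP, (hF.reg _ hR).trans h.numR,
    fun s => (hF.reg _ (hV s)).trans (h.numV s), fun s => (hF.reg _ (hE s)).trans (h.numE s)⟩

theorem Input.frame {c : Cmd} {σ τ : State} (h : D.Input σ) (hF : Frame c σ τ)
    (hL : ∀ s, c.writesWArr (.label s) = false) (hS : ∀ s, c.writesArr (.inSrc s) = false)
    (hB : ∀ s, c.writesArr (.inLab s) = false) (hT : ∀ s, c.writesArr (.inDst s) = false)
    (hD : ∀ s, c.writesWArr (.inDeg s) = false) : D.Input τ := by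
  constructor
  · intro s; rw [hF.warr _ (hL s)]; exact h.label s
  · intro s; rw [hF.arr _ (hS s)]; exact h.inSrc s
  · intro s; rw [hF.arr _ (hB s)]; exact h.inLab s
  · intro s; rw [hF.arr _ (hT s)]; exact h.inDst s
  · intro s; rw [hF.warr _ (hD s)]; exact h.inDeg s

/-- The vector `Next[r, x]` in the order of the list of edges, when the first `e` edges of that
list have been read. -/
def nextList (D : Data) (s : Side) (r x e : ℕ) : List ℕ :=
  ((List.range e).filter fun i => D.src s i = x ∧ D.lab s i = r).map (D.dst s)

/-- The vector `Prev[r, y]` in the order of the list of edges, when the first `e` edges of that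
list have been read. -/
def prevList (D : Data) (s : Side) (r y e : ℕ) : List ℕ :=
  ((List.range e).filter fun i => D.dst s i = y ∧ D.lab s i = r).map (D.src s)

theorem mem_nextList {s : Side} {r x y : ℕ} :
    y ∈ D.nextList s r x (D.m s) ↔ 0 < D.W s x r y := by
  simp only [nextList, List.mem_map, List.mem_filter, List.mem_range, decide_eq_true_eq]
  constructor
  · rintro ⟨i, ⟨hi, rfl, rfl⟩, rfl⟩
    exact D.pos hi
  · intro h
    obtain ⟨i, hi, rfl, rfl, rfl⟩ := D.exists_edge h
    exact ⟨i, ⟨hi, rfl, rfl⟩, rfl⟩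

theorem mem_prevList {s : Side} {r x y : ℕ} :
    x ∈ D.prevList s r y (D.m s) ↔ 0 < D.W s x r y := by
  simp only [prevList, List.mem_map, List.mem_filter, List.mem_range, decide_eq_true_eq]
  constructor
  · rintro ⟨i, ⟨hi, rfl, rfl⟩, rfl⟩
    exact D.pos hi
  · intro h
    obtain ⟨i, hi, rfl, rfl, rfl⟩ := D.exists_edge h
    exact ⟨i, ⟨hi, rfl, rfl⟩, rfl⟩

theorem nodup_nextList (s : Side) (r x : ℕ) : (D.nextList s r x (D.m s)).Nodup := by
  refine List.Nodup.map_on ?_ (List.nodup_range.filter _)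
  simp only [List.mem_filter, List.mem_range, decide_eq_true_eq]
  rintro i ⟨hi, hx, hr⟩ j ⟨hj, hx', hr'⟩ h
  exact D.edge_inj hi hj (by rw [hx, hx']) (by rw [hr, hr']) h

theorem nodup_prevList (s : Side) (r y : ℕ) : (D.prevList s r y (D.m s)).Nodup := by
  refine List.Nodup.map_on ?_ (List.nodup_range.filter _)
  simp only [List.mem_filter, List.mem_range, decide_eq_true_eq]
  rintro i ⟨hi, hx, hr⟩ j ⟨hj, hx', hr'⟩ h
  exact D.edge_inj hi hj h (by rw [hr, hr']) (by rw [hx, hx'])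

theorem length_filter_range (e : ℕ) (p : ℕ → Prop) [DecidablePred p] :
    ((List.range e).filter p).length = ((Finset.range e).filter p).card := by
  rw [← List.toFinset_card_of_nodup (List.nodup_range.filter _)]
  congr 1
  ext i
  simp

/-- Every edge is counted once. -/
theorem sum_length_nextList (s : Side) :
    ∑ r ∈ Finset.range D.nR, ∑ x ∈ Finset.range (D.nV s), (D.nextList s r x (D.m s)).length =
      D.m s := by
  have := Finset.card_eq_sum_card_fiberwise (s := Finset.range (D.m s))
    (t := Finset.range D.nR ×ˢ Finset.range (D.nV s)) (f := fun i => (D.lab s i, D.src s i))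
    (fun i hi => by
      have hi : i < D.m s := by simpa using hi
      simp [D.lab_lt hi, D.src_lt hi])
  rw [Finset.card_range, Finset.sum_product] at this
  refine Eq.trans ?_ this.symm
  simp only [nextList, List.length_map, length_filter_range, Prod.mk.injEq, and_comm]

/-- Every edge is counted once. -/
theorem sum_length_prevList (s : Side) :
    ∑ r ∈ Finset.range D.nR, ∑ x ∈ Finset.range (D.nV s), (D.prevList s r x (D.m s)).length =
      D.m s := by
  have := Finset.card_eq_sum_card_fiberwise (s := Finset.range (D.m s))
    (t := Finset.range D.nR ×ˢ Finset.range (D.nV s)) (f := fun i => (D.lab s i, D.dst s i))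
    (fun i hi => by
      have hi : i < D.m s := by simpa using hi
      simp [D.lab_lt hi, D.dst_lt hi])
  rw [Finset.card_range, Finset.sum_product] at this
  refine Eq.trans ?_ this.symm
  simp only [prevList, List.length_map, length_filter_range, Prod.mk.injEq, and_comm]

theorem length_le_of_forall_lt {l : List ℕ} {n : ℕ} (hl : l.Nodup) (h : ∀ x ∈ l, x < n) :
    l.length ≤ n := by
  rw [← List.toFinset_card_of_nodup hl, ← Finset.card_range n]
  exact Finset.card_le_card fun x hx => by simpa using h x (by simpa using hx)

theorem length_nextList_le (s : Side) (r x : ℕ) : (D.nextList s r x (D.m s)).length ≤ D.nV s :=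
  length_le_of_forall_lt (nodup_nextList s r x) fun _ hy => (lt_of_pos (mem_nextList.1 hy)).2.2

theorem length_prevList_le (s : Side) (r x : ℕ) : (D.prevList s r x (D.m s)).length ≤ D.nV s :=
  length_le_of_forall_lt (nodup_prevList s r x) fun _ hy => (lt_of_pos (mem_prevList.1 hy)).1

end Data

/-! ### Vectors in the memory -/

/-- The first `n` entries of the row with index `idx` of a two-dimensional array. -/
def row (f : List ℕ → ℕ) (idx : List ℕ) (n : ℕ) : List ℕ :=
  (List.range n).map fun i => f (idx ++ [i])

theorem length_row (f : List ℕ → ℕ) (idx : List ℕ) (n : ℕ) : (row f idx n).length = n := by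
  simp [row]

theorem getElem_row (f : List ℕ → ℕ) (idx : List ℕ) (n i : ℕ) (h : i < (row f idx n).length) :
    (row f idx n)[i] = f (idx ++ [i]) := by
  simp [row]

theorem row_succ (f : List ℕ → ℕ) (idx : List ℕ) (n : ℕ) :
    row f idx (n + 1) = row f idx n ++ [f (idx ++ [n])] := by
  simp [row, List.range_succ]

theorem row_update_of_ne {f : List ℕ → ℕ} {idx idx' : List ℕ} {n j v : ℕ} (h : idx ≠ idx') :
    row (Function.update f (idx' ++ [j]) v) idx n = row f idx n := by
  refine List.map_congr_left fun i _ => Function.update_of_ne (fun h' => h ?_) _ _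
  exact (List.append_inj' h' rfl).1

theorem row_update_of_le {f : List ℕ → ℕ} {idx : List ℕ} {n j v : ℕ} (h : n ≤ j) :
    row (Function.update f (idx ++ [j]) v) idx n = row f idx n := by
  refine List.map_congr_left fun i hi => Function.update_of_ne (fun h' => ?_) _ _
  have := (List.append_inj' h' rfl).2
  simp only [List.mem_range, List.cons.injEq, and_true] at hi this
  omega

theorem row_update (f : List ℕ → ℕ) (idx : List ℕ) (n j v : ℕ) :
    row (Function.update f (idx ++ [j]) v) idx n = (row f idx n).set j v := by
  refine List.ext_getElem (by simp [length_row]) fun i h₁ h₂ => ?_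
  simp only [getElem_row, List.getElem_set, Function.update_apply, List.append_cancel_left_eq,
    List.cons.injEq, and_true, eq_comm (a := i)]

/-- The vector stored in a row of the array `a`, whose length is stored in the array `aLen`. -/
def State.vec (σ : State) (a aLen : Arr) (idx : List ℕ) : List ℕ :=
  row (σ.arr a) idx (σ.arr aLen idx)

theorem State.length_vec (σ : State) (a aLen : Arr) (idx : List ℕ) :
    (σ.vec a aLen idx).length = σ.arr aLen idx := length_row _ _ _

theorem State.arr_eq_of_vec {σ : State} {a aLen : Arr} {idx l : List ℕ} (h : σ.vec a aLen idx = l)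
    {i : ℕ} (hi : i < l.length) : σ.arr a (idx ++ [i]) = l[i] := by
  subst h
  simp [vec, getElem_row]

theorem State.vec_congr {σ τ : State} {a aLen : Arr} (h : τ.arr a = σ.arr a)
    (h' : τ.arr aLen = σ.arr aLen) : τ.vec a aLen = σ.vec a aLen := by
  funext idx
  simp [vec, h, h']

/-! ### Building the arrays of a graph -/

namespace Data

/-- `Next[r, x]` and `Prev[r, x]` have been emptied and all degrees `E[x, r, y]` have been set to
zero. -/
structure Cleared (D : Data) (s : Side) (σ : State) (r x : ℕ) : Prop where
  nextLen : σ.arr (.nextLen s) [r, x] = 0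
  prevLen : σ.arr (.prevLen s) [r, x] = 0
  edge : ∀ y < D.nV s, σ.warr (.edge s) [x, r, y] = 0

/-- The arrays of the graph on side `s` represent the first `e` edges. -/
structure Built (D : Data) (s : Side) (e : ℕ) (σ : State) : Prop where
  edge : ∀ x < D.nV s, ∀ r < D.nR, ∀ y < D.nV s, σ.warr (.edge s) [x, r, y] =
    if ∃ i < e, D.src s i = x ∧ D.lab s i = r ∧ D.dst s i = y then D.W s x r y else 0
  edgeID : ∀ i < e, σ.arr (.edgeID s) [D.src s i, D.lab s i, D.dst s i] = i
  next : ∀ r < D.nR, ∀ x < D.nV s, σ.vec (.next s) (.nextLen s) [r, x] = D.nextList s r x e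
  prev : ∀ r < D.nR, ∀ x < D.nV s, σ.vec (.prev s) (.prevLen s) [r, x] = D.prevList s r x e

/-- The first loop of `buildGraph`. The initial content of the arrays is arbitrary, so that degrees and
lengths have to be set to zero before the edges are read. -/
theorem wp_clear (D : Data) (s : Side) {σ : State} (hσ : D.Sizes σ) :
    Wp (forRange .r .numR (forRange .x (.numV s) (block [
      const .len 0,
      store (.nextLen s) [.r, .x] .len,
      store (.prevLen s) [.r, .x] .len,
      wzero .w,
      forRange .y (.numV s) (wstore (.edge s) [.x, .r, .y] .w)]))) σ fun τ t =>
      (∀ r < D.nR, ∀ x < D.nV s, D.Cleared s τ r x) ∧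
      t ≤ 2 + 4 * D.nR + D.nR * (D.nV s * (3 * D.nV s + 10)) := by
  have H := wp_for₂ (i := .r) (n := .numR) (j := .x) (m := .numV s) (σ := σ) (c := block [
      const .len 0,
      store (.nextLen s) [.r, .x] .len,
      store (.prevLen s) [.r, .x] .len,
      wzero .w,
      forRange .y (.numV s) (wstore (.edge s) [.x, .r, .y] .w)]) D.nR (D.nV s)
    (fun S τ => ∀ r x, (r, x) ∈ S → D.Cleared s τ r x) (fun _ => 0)
    (fun _ _ => 3 * D.nV s + 8) hσ.numR (hσ.numV s) rfl rfl rfl rfl ?_ (by simp) ?_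
  · refine H.mono fun τ t h => ⟨fun r hr x hx => h.1 r x ⟨hr, hx⟩, ?_⟩
    have := h.2
    simpa using this
  · intro S τ x k h _ r y hry
    exact ⟨(h r y hry).nextLen, (h r y hry).prevLen, (h r y hry).edge⟩
  intro S k hk l hl hkl τ hI hr hx hF
  simp only [wp_block_cons, wp_const, wp_store, wp_wzero, wp_block_nil]
  refine (wp_for (D.nV s) (fun j ρ => ρ.wreg .w = 0 ∧ ρ.reg .r = k ∧ ρ.reg .x = l ∧
    (∀ r x, (r, x) ∈ insert (k, l) S →
      ρ.arr (.nextLen s) [r, x] = 0 ∧ ρ.arr (.prevLen s) [r, x] = 0) ∧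
    (∀ r x, (r, x) ∈ S → ∀ y < D.nV s, ρ.warr (.edge s) [x, r, y] = 0) ∧
    ∀ y < j, ρ.warr (.edge s) [l, k, y] = 0) (fun _ => 0) (fun _ => 1) ?_ rfl rfl ?_ ?_).mono ?_
  · simp [hF.reg, hσ.numV s, forRange, block, Cmd.const, Cmd.store, Cmd.wzero, Cmd.wstore, Cmd.succ,
      Cmd.writesReg, Instr.writesReg]
  · simp only [State.wreg_setReg, State.reg_setReg, State.wreg_setArr, State.reg_setArr,
      State.wreg_setWReg, State.reg_setWReg, State.arr_setReg, State.arr_setWReg, State.arr_setArr,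
      State.warr_setReg, State.warr_setWReg, State.warr_setArr, hr, hx, List.map_cons, List.map_nil]
    refine ⟨by simp, by simp, by simp, ?_, fun r x h => (hI r x h).edge, by simp⟩
    intro r x h
    have : (r = k ∧ x = l) ∨ (r, x) ∈ S := by simpa using h
    rcases this with ⟨rfl, rfl⟩ | h
    · simp
    · simp [Function.update_apply, (hI r x h).nextLen, (hI r x h).prevLen]
  · rintro j hj ρ ⟨h₁, h₂, h₃, h₄, h₅, h₆⟩ hy _
    simp only [wp_wstore, State.arr_setReg, State.arr_setWArr, State.warr_setReg,
      State.warr_setWArr, State.reg_setReg, State.reg_setWArr, State.wreg_setReg,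
      State.wreg_setWArr, List.map_cons, List.map_nil, h₁, h₂, h₃, hy]
    refine ⟨⟨trivial, by simp, by simp, h₄, fun r x h y hy => ?_, fun y hy => ?_⟩, by simp⟩
    · simp [Function.update_apply, h₅ r x h y hy]
    · rcases Nat.lt_succ_iff_lt_or_eq.1 hy with hy | rfl
      · simp [Function.update_apply, h₆ y hy]
      · simp
  · rintro ρ t ⟨⟨h₁, h₂, h₃, h₄, h₅, h₆⟩, ht⟩
    refine ⟨fun r x h => ⟨(h₄ r x h).1, (h₄ r x h).2, ?_⟩, ?_⟩
    · have : (r = k ∧ x = l) ∨ (r, x) ∈ S := by simpa using h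
      rcases this with ⟨rfl, rfl⟩ | h
      · exact h₆
      · exact h₅ r x h
    · simp at ht ⊢
      omega

theorem nextList_succ (D : Data) (s : Side) (r x e : ℕ) : D.nextList s r x (e + 1) =
    D.nextList s r x e ++ if D.src s e = x ∧ D.lab s e = r then [D.dst s e] else [] := by
  simp only [nextList, List.range_succ, List.filter_append, List.map_append]
  split_ifs with h <;> simp [h]

theorem prevList_succ (D : Data) (s : Side) (r x e : ℕ) : D.prevList s r x (e + 1) =
    D.prevList s r x e ++ if D.dst s e = x ∧ D.lab s e = r then [D.src s e] else [] := by
  simp only [prevList, List.range_succ, List.filter_append, List.map_append]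
  split_ifs with h <;> simp [h]

/-- Appending an entry to a vector. -/
theorem row_push {f g : List ℕ → ℕ} {idx idx' l : List ℕ} {v : ℕ}
    (h : row f idx' (g idx') = l) :
    row (Function.update f (idx ++ [g idx]) v) idx'
      (Function.update g idx (g idx + 1) idx') = l ++ if idx = idx' then [v] else [] := by
  split_ifs with h'
  · subst h'
    rw [Function.update_self, row_succ, row_update_of_le le_rfl, h, Function.update_self]
  · rw [row_update_of_ne (Ne.symm h'), Function.update_of_ne (Ne.symm h'), h, List.append_nil]

/-- The second loop of `buildGraph`. -/
theorem wp_readEdges (D : Data) (s : Side) {σ : State} (hσ : D.Sizes σ) (hin : D.Input σ)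
    (hcl : ∀ r < D.nR, ∀ x < D.nV s, D.Cleared s σ r x) :
    Wp (forRange .e (.numE s) (block [
      load .x (.inSrc s) [.e],
      load .r (.inLab s) [.e],
      load .y (.inDst s) [.e],
      wload .w (.inDeg s) [.e],
      wstore (.edge s) [.x, .r, .y] .w,
      store (.edgeID s) [.x, .r, .y] .e,
      load .len (.nextLen s) [.r, .x],
      store (.next s) [.r, .x, .len] .y,
      succ .len .len,
      store (.nextLen s) [.r, .x] .len,
      load .len (.prevLen s) [.r, .y],
      store (.prev s) [.r, .y, .len] .x,
      succ .len .len,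
      store (.prevLen s) [.r, .y] .len])) σ fun τ t =>
      D.Built s (D.m s) τ ∧ t ≤ 2 + D.m s * 16 := by
  refine (wp_for (D.m s) (fun e τ => D.Built s e τ) (fun _ => 0) (fun _ => 14) (hσ.numE s) rfl rfl
    ?_ ?_).mono fun τ t h => ⟨h.1, by simpa using h.2⟩
  · constructor
    · intro x hx r hr y hy
      simp [(hcl r hr x hx).edge y hy]
    · simp
    · intro r hr x hx
      simp [State.vec, (hcl r hr x hx).nextLen, nextList, row]
    · intro r hr x hx
      simp [State.vec, (hcl r hr x hx).prevLen, prevList, row]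
  intro e he τ hI hreg hF
  have h₁ : τ.arr (.inSrc s) [e] = D.src s e := by
    rw [hF.arr _ rfl]; exact hin.inSrc s e he
  have h₂ : τ.arr (.inLab s) [e] = D.lab s e := by
    rw [hF.arr _ rfl]; exact hin.inLab s e he
  have h₃ : τ.arr (.inDst s) [e] = D.dst s e := by
    rw [hF.arr _ rfl]; exact hin.inDst s e he
  have h₄ : τ.warr (.inDeg s) [e] = D.W s (D.src s e) (D.lab s e) (D.dst s e) := by
    rw [hF.warr _ rfl]; exact hin.inDeg s e he
  simp [hreg, h₁, h₂, h₃, h₄]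
  constructor
  · intro x hx r hr y hy
    simp only [State.warr_setReg, State.warr_setArr, State.warr_setWArr, if_true,
      Function.update_apply, Nat.lt_succ_iff_lt_or_eq, or_and_right,
      exists_or, exists_eq_left, List.cons.injEq, and_true]
    by_cases h : x = D.src s e ∧ r = D.lab s e ∧ y = D.dst s e
    · obtain ⟨rfl, rfl, rfl⟩ := h
      simp
    · have h' : ¬ (D.src s e = x ∧ D.lab s e = r ∧ D.dst s e = y) := by tauto
      rw [if_neg h]
      simp [h', hI.edge x hx r hr y hy]
  · intro i hi
    simp only [State.arr_setReg, State.arr_setArr, State.arr_setWArr]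
    rcases Nat.lt_succ_iff_lt_or_eq.1 hi with hi | rfl
    · have : ¬ (D.src s i = D.src s e ∧ D.lab s i = D.lab s e ∧ D.dst s i = D.dst s e) :=
        fun h => hi.ne (D.edge_inj (hi.trans he) he h.1 h.2.1 h.2.2)
      simpa [Function.update_apply, this] using hI.edgeID i hi
    · simp
  · intro r hr x hx
    rw [nextList_succ]
    have := row_push (idx := [D.lab s e, D.src s e]) (v := D.dst s e) (hI.next r hr x hx)
    simpa [State.vec, and_comm] using this
  · intro r hr x hx
    rw [prevList_succ]
    have := row_push (idx := [D.lab s e, D.dst s e]) (v := D.src s e) (hI.prev r hr x hx)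
    simpa [State.vec, and_comm] using this

theorem wp_buildGraph (D : Data) (s : Side) {σ : State} (hσ : D.Sizes σ) (hin : D.Input σ) :
    Wp (buildGraph s) σ fun τ t => D.Built s (D.m s) τ ∧
      t ≤ 4 + 4 * D.nR + D.nR * (D.nV s * (3 * D.nV s + 10)) + 16 * D.m s := by
  rw [buildGraph, wp_block_cons]
  refine (D.wp_clear s hσ).frame.mono fun τ t h => ?_
  rw [wp_block_cons]
  refine (D.wp_readEdges s (hσ.frame h.2 rfl rfl (fun _ => rfl) fun _ => rfl)
    (hin.frame h.2 (fun _ => rfl) (fun _ => rfl) (fun _ => rfl) (fun _ => rfl) fun _ => rfl)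
    h.1.1).mono fun ρ u h' => ?_
  rw [wp_block_nil]
  exact ⟨h'.1, by have := h.1.2; have := h'.2; omega⟩

theorem Built.edge_eq {D : Data} {s : Side} {σ : State} (h : D.Built s (D.m s) σ) {x r y : ℕ}
    (hx : x < D.nV s) (hr : r < D.nR) (hy : y < D.nV s) :
    σ.warr (.edge s) [x, r, y] = D.W s x r y := by
  rw [h.edge x hx r hr y hy]
  split_ifs with h'
  · rfl
  · by_contra h''
    exact h' (D.exists_edge (unitInterval.pos_iff_ne_zero.2 (Ne.symm h'')))

/-- Different edges have different numbers. -/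
theorem Built.edgeID_inj {D : Data} {s : Side} {σ : State} (h : D.Built s (D.m s) σ)
    {x r y x' r' y' : ℕ} (h₁ : 0 < D.W s x r y) (h₂ : 0 < D.W s x' r' y')
    (he : σ.arr (.edgeID s) [x, r, y] = σ.arr (.edgeID s) [x', r', y']) :
    x = x' ∧ r = r' ∧ y = y' := by
  obtain ⟨i, hi, rfl, rfl, rfl⟩ := D.exists_edge h₁
  obtain ⟨j, hj, rfl, rfl, rfl⟩ := D.exists_edge h₂
  rw [h.edgeID i hi, h.edgeID j hj] at he
  subst he
  exact ⟨rfl, rfl, rfl⟩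

end Data

/-! ### Initialization of `Z` and sorting -/

/-- The pair formed by the vertex `x` of side `s` and the vertex `y` of the opposite side, with the
left vertex first. -/
def mkPair (s : Side) (x y : ℕ) : ℕ × ℕ :=
  match s with
  | .left => (x, y)
  | .right => (y, x)

theorem mkPair_opp (s : Side) (x y : ℕ) : mkPair s.opp x y = mkPair s y x := by cases s <;> rfl

@[simp] theorem map_pairIdx (f : Reg → ℕ) (s : Side) (x y : Reg) :
    (pairIdx s x y).map f = [(mkPair s (f x) (f y)).1, (mkPair s (f x) (f y)).2] := by
  cases s <;> rfl

namespace Data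

/-- The pairs of vertices whose labels satisfy the condition of a directed simulation. -/
def labelPairs (D : Data) : Set (ℕ × ℕ) :=
  {q | q.1 < D.nV .left ∧ q.2 < D.nV .right ∧ ∀ p < D.nP, D.L .left q.1 p ≤ D.L .right q.2 p}

theorem lt_of_mem_labelPairs {D : Data} {s : Side} {x y : ℕ} (h : mkPair s x y ∈ D.labelPairs) :
    x < D.nV s ∧ y < D.nV s.opp := by
  cases s
  · exact ⟨h.1, h.2.1⟩
  · exact ⟨h.2.1, h.1⟩

theorem wp_initZ (D : Data) {σ : State} (hσ : D.Sizes σ) (hin : D.Input σ) :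
    Wp initZ σ fun τ t =>
      (∀ x < D.nV .left, ∀ x' < D.nV .right, τ.arr .Z [x, x'] = 1 ↔ (x, x') ∈ D.labelPairs) ∧
      t ≤ 2 + 4 * D.nV .left + D.nV .left * (D.nV .right * (6 * D.nP + 6)) := by
  refine (wp_for₂ (D.nV .left) (D.nV .right)
    (fun S τ => ∀ x < D.nV .left, ∀ x' < D.nV .right, (x, x') ∈ S →
      (τ.arr .Z [x, x'] = 1 ↔ (x, x') ∈ D.labelPairs)) (fun _ => 0) (fun _ _ => 6 * D.nP + 4)
    (hσ.numV _) (hσ.numV _) rfl rfl rfl rfl (fun _ _ _ _ h _ => h) (by simp) ?_).mono ?_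
  swap
  · exact fun τ t h => ⟨fun x hx x' hx' => h.1 x hx x' hx' ⟨hx, hx'⟩, by simpa using h.2⟩
  intro S k hk l hl _ τ hI hr hr' hF
  rw [wp_block_cons, wp_const, wp_block_cons]
  refine (wp_for D.nP (fun j ρ => ρ.reg .bit = 1 ↔ ∀ p < j, D.L .left k p ≤ D.L .right l p)
    (fun _ => 0) (fun _ => 4) ?_ rfl rfl (by simp) ?_).frame.mono ?_
  · rw [State.reg_setReg, if_neg (by simp), hF.reg _ rfl, hσ.numP]
  · intro j hj ρ hb hp hF'
    have h₁ : ρ.reg (.vert .left) = k := (hF'.reg _ rfl).trans hr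
    have h₂ : ρ.reg (.vert .right) = l := (hF'.reg _ rfl).trans hr'
    have h₃ : ρ.warr (.label .left) [k, j] = D.L .left k j := by
      rw [hF'.warr _ rfl, State.warr_setReg, hF.warr _ rfl, hin.label _ k hk j hj]
    have h₄ : ρ.warr (.label .right) [l, j] = D.L .right l j := by
      rw [hF'.warr _ rfl, State.warr_setReg, hF.warr _ rfl, hin.label _ l hl j hj]
    simp only [wp_block_cons, wp_wload, wp_ite, wp_skip, wp_const, wp_block_nil, Test.holds]
    simp only [State.wreg_setWReg, State.reg_setWReg, State.reg_setReg, State.warr_setWReg,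
      List.map_cons, List.map_nil, h₁, h₂, h₃, h₄, hp]
    have hsplit : (∀ p < j + 1, D.L .left k p ≤ D.L .right l p) ↔
        (∀ p < j, D.L .left k p ≤ D.L .right l p) ∧ D.L .left k j ≤ D.L .right l j := by
      simp only [Nat.lt_succ_iff_lt_or_eq, or_imp, forall_and, forall_eq]
    rw [hsplit]
    refine ⟨fun h => ?_, fun h => ?_⟩
    · simp only [reduceCtorEq, if_false, if_true] at h ⊢
      exact ⟨by rw [hb]; tauto, by norm_num⟩
    · simp only [reduceCtorEq, if_false, if_true] at h ⊢
      exact ⟨⟨fun h' => by simp at h', fun h' => absurd h'.2 h⟩, by norm_num⟩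
  · rintro ρ t ⟨⟨hb, ht⟩, hF'⟩
    have h₁ : ρ.reg (.vert .left) = k := (hF'.reg _ rfl).trans hr
    have h₂ : ρ.reg (.vert .right) = l := (hF'.reg _ rfl).trans hr'
    have h₃ : ρ.arr .Z = τ.arr .Z := hF'.arr _ rfl
    simp only [wp_block_cons, wp_store, wp_block_nil, State.arr_setArr, if_true, List.map_cons,
      List.map_nil, h₁, h₂, h₃]
    refine ⟨fun x hx x' hx' h => ?_, by simp at ht ⊢; omega⟩
    by_cases he : x = k ∧ x' = l
    · obtain ⟨rfl, rfl⟩ := he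
      simpa [labelPairs, hk, hl] using hb
    · have : (x, x') ∈ S := by
        simp only [Set.mem_insert_iff, Prod.mk.injEq] at h
        tauto
      rw [Function.update_of_ne (by simpa using he)]
      exact hI x hx x' hx' this

/-- The inner loop of insertion sort, which looks for the position of `z₀` in the sorted vector `l₁`:
it shifts the entries of `l₁` with a degree greater than that of `z₀` by one position. -/
theorem wp_insert {a : Arr} {E : WArr} {v : Reg} {key : Reg → List Reg} {σ : State}
    (deg : ℕ → unitInterval) (r₀ v₀ z₀ n : ℕ) (l₁ l₂ : List ℕ) (h : ℕ)
    (hv : ∃ s, v = .vert s)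
    (hkey : ∀ τ : State, τ.reg .r = r₀ → τ.reg v = v₀ → τ.warr E = σ.warr E →
      ∀ z, τ.warr E ((key z).map τ.reg) = deg (τ.reg z))
    (hr : σ.reg .r = r₀) (hv₀ : σ.reg v = v₀) (hw : σ.wreg .w = deg z₀)
    (hj : σ.reg .j = l₁.length) (hgo : σ.reg .go = 1)
    (hrow : row (σ.arr a) [r₀, v₀] n = l₁ ++ h :: l₂)
    (hs : l₁.Pairwise fun x y => deg x ≤ deg y) :
    Wp (.loop (.eq .go 1)
      (.ite (.eq .j 0) (const .go 0) (block [
        pred .k .j,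
        load .y a [.r, v, .k],
        wload .d E (key .y),
        .ite (.wle .d .w) (const .go 0) (block [
          store a [.r, v, .j] .y,
          move .j .k])]))) σ fun τ t => ∃ p₁ p₂ h', p₁ ++ p₂ = l₁ ∧
        row (τ.arr a) [r₀, v₀] n = p₁ ++ h' :: (p₂ ++ l₂) ∧ τ.reg .j = p₁.length ∧
        (∀ x ∈ p₁, deg x ≤ deg z₀) ∧ (∀ x ∈ p₂, deg z₀ < deg x) ∧
        (∀ idx ≠ [r₀, v₀], ∀ k, row (τ.arr a) idx k = row (σ.arr a) idx k) ∧
        t ≤ 8 * l₁.length + 8 := by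
  obtain ⟨s, rfl⟩ := hv
  -- `p₂` is the part of `l₁` that has been shifted; the entry `h'` at the free position is arbitrary
  refine (wp_loop (fun τ t => ∃ p₁ p₂ h', p₁ ++ p₂ = l₁ ∧
        row (τ.arr a) [r₀, v₀] n = p₁ ++ h' :: (p₂ ++ l₂) ∧ τ.reg .j = p₁.length ∧
        (∀ x ∈ p₂, deg z₀ < deg x) ∧ τ.reg .r = r₀ ∧ τ.reg (.vert s) = v₀ ∧
        τ.wreg .w = deg z₀ ∧ τ.warr E = σ.warr E ∧
        (∀ idx ≠ [r₀, v₀], ∀ k, row (τ.arr a) idx k = row (σ.arr a) idx k) ∧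
        (τ.reg .go = 1 ∧ t ≤ 8 * p₂.length ∨ τ.reg .go ≠ 1 ∧ (∀ x ∈ p₁, deg x ≤ deg z₀) ∧
          t ≤ 8 * p₂.length + 7)) (fun τ => if τ.reg .go = 1 then τ.reg .j + 1 else 0)
    ?_ ⟨l₁, [], h, by simp, by simpa using hrow, hj, by simp, hr, hv₀, hw, rfl, fun _ _ _ => rfl,
      .inl ⟨hgo, by simp⟩⟩).mono ?_
  · rintro τ t ⟨p₁, p₂, h', rfl, hrow', hj', hp₂, hr', hv', hw', hE, hidx, hgo'⟩ hb
    have hb : τ.reg .go = 1 := hb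
    replace hgo' : t ≤ 8 * p₂.length := by tauto
    simp only [wp_ite, Test.holds, wp_const, wp_block_cons, wp_block_nil, wp_pred, wp_load,
      wp_wload, wp_store, wp_move]
    refine ⟨fun hj₀ => ?_, fun hj₀ => ?_⟩
    · have hp₁ : p₁ = [] := List.eq_nil_of_length_eq_zero (hj'.symm.trans hj₀)
      subst hp₁
      refine ⟨⟨[], p₂, h', rfl, hrow', ?_, hp₂, ?_, ?_, hw', hE, hidx, .inr ⟨?_, by simp, ?_⟩⟩, ?_⟩
      · simpa [State.reg_setReg] using hj'
      · simpa [State.reg_setReg] using hr'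
      · simpa [State.reg_setReg] using hv'
      · simp
      · omega
      · simp [State.reg_setReg, hb]
    · obtain ⟨q, y, rfl⟩ : ∃ q y, p₁ = q ++ [y] :=
        ⟨_, _, (List.dropLast_append_getLast
          (fun h => hj₀ (by simpa [h] using hj') : p₁ ≠ [])).symm⟩
      have hlen : q.length < n := by
        rw [← length_row (τ.arr a) [r₀, v₀] n, hrow']
        simp only [List.length_append, List.length_cons, List.length_nil]
        omega
      have hy : τ.arr a [r₀, v₀, q.length] = y := by
        have := getElem_row (τ.arr a) [r₀, v₀] n q.length (by rwa [length_row])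
        simpa [hrow'] using this.symm
      have hj'' : τ.reg .j = q.length + 1 := by simpa using hj'
      have hread : ∀ τ' : State, τ'.reg .r = r₀ → τ'.reg (.vert s) = v₀ → τ'.warr E = σ.warr E →
          τ'.reg .y = y → τ'.warr E ((key .y).map τ'.reg) = deg y := by
        intro τ' h₁ h₂ h₃ h₄
        rw [hkey τ' h₁ h₂ h₃, h₄]
      simp only [State.reg_setReg, State.arr_setReg, List.map_cons, List.map_nil, reduceCtorEq,
        if_false, if_true, hj'', hr', hv', hy, Nat.add_sub_cancel]
      rw [hread ((τ.setReg .k q.length).setReg .y y) (by simp [hr']) (by simp [hv']) hE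
        (by simp)]
      simp only [State.wreg_setWReg, State.wreg_setReg, reduceCtorEq, if_false, if_true, hw',
        State.reg_setWReg, State.reg_setArr, State.reg_setReg, hr', hv', hj'', State.arr_setReg,
        State.arr_setArr, State.arr_setWReg, State.warr_setReg, State.warr_setArr,
        State.warr_setWReg, State.wreg_setArr, hb]
      refine ⟨fun hle => ⟨⟨q ++ [y], p₂, h', rfl, hrow', by simp, hp₂, trivial, trivial,
        trivial, hE, hidx, .inr ⟨by simp, ?_, by omega⟩⟩, by simp⟩, fun hlt =>
          ⟨⟨q, y :: p₂, y, by simp, ?_, rfl, ?_, trivial, trivial, trivial, hE, ?_,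
            .inl ⟨trivial, ?_⟩⟩, by simp⟩⟩
      · have := (List.pairwise_append.1 (List.pairwise_append.1 hs).1).2.2
        intro x hx
        rcases List.mem_append.1 hx with hx | hx
        · exact (this x hx y (by simp)).trans hle
        · simpa [List.mem_singleton.1 hx] using hle
      · have := row_update (τ.arr a) [r₀, v₀] n (q.length + 1) y
        rw [hrow'] at this
        rw [show [r₀, v₀, q.length + 1] = [r₀, v₀] ++ [q.length + 1] from rfl, this]
        rw [List.set_append_right _ _ (by simp)]
        simp
      · intro x hx
        rcases List.mem_cons.1 hx with rfl | hx
        · exact not_le.1 hlt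
        · exact hp₂ x hx
      · intro idx hidx' k
        have := row_update_of_ne (f := τ.arr a) (n := k) (j := q.length + 1) (v := y) hidx'
        rw [← hidx idx hidx' k, ← this]
        rfl
      · simp only [List.length_cons]
        omega
  · rintro τ t ⟨u, rfl, ⟨p₁, p₂, h', rfl, hrow', hj', hp₂, hr', hv', hw', hE, hidx, hgo'⟩, hb⟩
    rcases hgo' with hgo' | ⟨_, h₁, h₂⟩
    · exact absurd hgo'.1 hb
    · refine ⟨p₁, p₂, h', rfl, hrow', hj', h₁, hp₂, hidx, ?_⟩
      simp only [List.length_append]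
      omega

theorem wp_sortRow {a aLen : Arr} {E : WArr} {s : Side} {key : Reg → List Reg} {σ : State}
    (deg : ℕ → unitInterval) (r₀ v₀ : ℕ) (l : List ℕ) (ha : a ≠ aLen)
    (hkey : ∀ τ : State, τ.reg .r = r₀ → τ.reg (.vert s) = v₀ → τ.warr E = σ.warr E →
      ∀ z, τ.warr E ((key z).map τ.reg) = deg (τ.reg z))
    (hr : σ.reg .r = r₀) (hv₀ : σ.reg (.vert s) = v₀) (hl : σ.vec a aLen [r₀, v₀] = l) :
    Wp (sortRow a aLen E (.vert s) key) σ fun τ t =>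
      (∃ l' : List ℕ, τ.vec a aLen [r₀, v₀] = l' ∧ l'.Perm l ∧
        l'.Pairwise fun x y => deg x ≤ deg y) ∧
      (∀ idx ≠ [r₀, v₀], τ.vec a aLen idx = σ.vec a aLen idx) ∧
      t ≤ 3 + l.length * (8 * l.length + 15) := by
  have hlen : σ.arr aLen [r₀, v₀] = l.length := by rw [← hl, State.length_vec]
  have hwr : (sortRow a aLen E (.vert s) key).writesArr aLen = false := by
    simp [sortRow, forRange, block, Cmd.writesArr, Instr.writesArr, Cmd.const, Cmd.store, Cmd.load,
      Cmd.wload, Cmd.move, Cmd.pred, Cmd.succ, ha]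
  suffices H : Wp (sortRow a aLen E (.vert s) key) σ fun τ t =>
      (∃ l' : List ℕ, row (τ.arr a) [r₀, v₀] l.length = l' ∧ l'.Perm l ∧
        l'.Pairwise fun x y => deg x ≤ deg y) ∧
      (∀ idx ≠ [r₀, v₀], ∀ k, row (τ.arr a) idx k = row (σ.arr a) idx k) ∧
      t ≤ 3 + l.length * (8 * l.length + 15) by
    refine H.frame.mono fun τ t h => ?_
    simp only [State.vec, h.2.arr _ hwr, hlen]
    exact ⟨h.1.1, fun idx hidx => h.1.2.1 idx hidx _, h.1.2.2⟩
  rw [sortRow, wp_block_cons, wp_load, wp_block_cons]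
  -- the first `i` entries have been sorted
  refine (wp_for l.length (fun i τ => ∃ l₁ l₂, row (τ.arr a) [r₀, v₀] l.length = l₁ ++ l₂ ∧
    l₁.length = i ∧ (l₁ ++ l₂).Perm l ∧ (l₁.Pairwise fun x y => deg x ≤ deg y) ∧
    ∀ idx ≠ [r₀, v₀], ∀ k, row (τ.arr a) idx k = row (σ.arr a) idx k) (fun _ => 0)
    (fun _ => 8 * l.length + 13) ?_ rfl rfl ?_ ?_).mono ?_
  · simp [State.reg_setReg, hr, hv₀, hlen]
  · exact ⟨[], l, by rw [← hlen]; exact hl, rfl, by simp, List.Pairwise.nil, fun _ _ _ => rfl⟩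
  · rintro i hi τ ⟨l₁, l₂, hrow, rfl, hp, hs, hidx⟩ hir hF
    obtain ⟨z₀, l₂, rfl⟩ : ∃ z₀ l₃, l₂ = z₀ :: l₃ := by
      cases l₂ with
      | nil =>
        have := congrArg List.length hrow
        rw [length_row] at this
        simp at this
        omega
      | cons z₀ l₃ => exact ⟨_, _, rfl⟩
    have hz : τ.arr a [r₀, v₀, l₁.length] = z₀ := by
      have := getElem_row (τ.arr a) [r₀, v₀] l.length l₁.length (by rwa [length_row])
      simpa [hrow] using this.symm
    have hr' : τ.reg .r = r₀ := (hF.reg _ rfl).trans hr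
    have hv' : τ.reg (.vert s) = v₀ := (hF.reg _ rfl).trans hv₀
    have hE : τ.warr E = σ.warr E := hF.warr _ rfl
    have hread : ∀ τ' : State, τ'.reg .r = r₀ → τ'.reg (.vert s) = v₀ → τ'.warr E = σ.warr E →
        τ'.reg .z = z₀ → τ'.warr E ((key .z).map τ'.reg) = deg z₀ := by
      intro τ' h₁ h₂ h₃ h₄
      rw [hkey τ' h₁ h₂ h₃, h₄]
    simp only [wp_block_cons, wp_load, wp_wload, wp_move, wp_const, State.reg_setReg, hr', hv', hir,
      List.map_cons, List.map_nil, hz, reduceCtorEq, if_false, State.reg_setWReg]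
    rw [hread (τ.setReg .z z₀) (by simp [hr']) (by simp [hv']) hE (by simp)]
    refine Wp.mono (Wp.frame (wp_insert deg r₀ v₀ z₀ l.length l₁ l₂ z₀ ⟨s, rfl⟩ ?_ ?_ ?_ ?_ ?_ ?_
      hrow hs)) ?_
    · intro τ' h₁ h₂ h₃ z
      exact hkey τ' h₁ h₂ (h₃.trans hE) z
    · simp [hr']
    · simp [hv']
    · simp
    · simp
    · simp
    rintro ρ t ⟨⟨p₁, p₂, h', hpp, hrow', hj', hp₁, hp₂, hidx', ht⟩, hF'⟩
    subst hpp
    have hr'' : ρ.reg .r = r₀ := by rw [hF'.reg _ rfl]; simp [hr']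
    have hv'' : ρ.reg (.vert s) = v₀ := by rw [hF'.reg _ rfl]; simp [hv']
    have hz'' : ρ.reg .z = z₀ := by rw [hF'.reg _ rfl]; simp
    simp only [wp_store, wp_block_nil, List.map_cons, List.map_nil, hr'', hv'', hj', hz'',
      State.arr_setArr, State.arr_setReg, if_true]
    refine ⟨⟨p₁ ++ z₀ :: p₂, l₂, ?_, by simp; omega, ?_, ?_, ?_⟩, ?_⟩
    · have := row_update (ρ.arr a) [r₀, v₀] l.length p₁.length z₀
      rw [hrow'] at this
      rw [show [r₀, v₀, p₁.length] = [r₀, v₀] ++ [p₁.length] from rfl, this]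
      simp
    · refine List.Perm.trans ?_ hp
      simp only [List.append_assoc, List.cons_append]
      exact List.Perm.append_left _ List.perm_middle.symm
    · rw [List.pairwise_append] at hs ⊢
      refine ⟨hs.1, List.pairwise_cons.2 ⟨fun x hx => (hp₂ x hx).le, hs.2.1⟩, ?_⟩
      intro x hx y hy
      rcases List.mem_cons.1 hy with rfl | hy
      · exact hp₁ x hx
      · exact hs.2.2 x hx y hy
    · intro idx hidx'' k
      have := row_update_of_ne (f := ρ.arr a) (n := k) (j := p₁.length) (v := z₀) hidx''
      rw [← hidx idx hidx'' k]
      exact this.trans (hidx' idx hidx'' k)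
    · have : (p₁ ++ p₂).length < l.length := hi
      simp only [Nat.add_zero]
      omega
  · rintro τ t ⟨⟨l₁, l₂, hrow, h₁, hp, hs, hidx⟩, ht⟩
    rw [wp_block_nil]
    refine ⟨⟨_, hrow, hp, ?_⟩, hidx, ?_⟩
    · have : l₂ = [] := by
        have := hp.length_eq
        rw [List.length_append] at this
        exact List.eq_nil_of_length_eq_zero (by omega)
      subst this
      simpa using hs
    · simp at ht
      linarith

theorem wp_clearElem (D : Data) (s : Side) {σ : State} (hσ : D.Sizes σ) :
    Wp (clearElem s) σ fun _ t => t ≤ 3 + 4 * D.nV s.opp + D.nV s.opp * (D.m s * 3) := by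
  rw [clearElem, wp_block_cons, wp_const, wp_block_cons]
  refine Wp.mono (wp_for₂ (D.nV s.opp) (D.m s) (fun _ _ => True) (fun _ => 0) (fun _ _ => 1)
    (hσ.numV _) (hσ.numE _) rfl rfl rfl rfl (fun _ _ _ _ h _ => h) trivial ?_) ?_
  · intro S k hk l hl _ τ _ hr hr' hF
    simp [wp_store]
  · intro τ t h
    rw [wp_block_nil]
    have := h.2
    simp at this
    omega

end Data

namespace Data

open Classical in
theorem wp_sortAll (D : Data) {a aLen : Arr} {E : WArr} {s : Side} {key : Reg → List Reg}
    {σ : State} (deg : ℕ → ℕ → ℕ → unitInterval) (hσ : D.Sizes σ) (ha : a ≠ aLen)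
    (hkey : ∀ τ : State, τ.warr E = σ.warr E → ∀ z,
      τ.warr E ((key z).map τ.reg) = deg (τ.reg .r) (τ.reg (.vert s)) (τ.reg z)) :
    Wp (forRange .r .numR (forRange (.vert s) (.numV s) (sortRow a aLen E (.vert s) key))) σ
      fun τ t =>
      (∀ r < D.nR, ∀ x < D.nV s, (τ.vec a aLen [r, x]).Perm (σ.vec a aLen [r, x]) ∧
        (τ.vec a aLen [r, x]).Pairwise fun y z => deg r x y ≤ deg r x z) ∧
      t ≤ 2 + 4 * D.nR + ∑ r ∈ Finset.range D.nR, ∑ x ∈ Finset.range (D.nV s),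
        (3 + (σ.vec a aLen [r, x]).length * (8 * (σ.vec a aLen [r, x]).length + 15) + 2) := by
  refine Wp.mono (wp_for₂ D.nR (D.nV s) (fun S τ => ∀ r x, if (r, x) ∈ S then
      (τ.vec a aLen [r, x]).Perm (σ.vec a aLen [r, x]) ∧
        (τ.vec a aLen [r, x]).Pairwise (fun y z => deg r x y ≤ deg r x z)
      else τ.vec a aLen [r, x] = σ.vec a aLen [r, x]) (fun _ => 0)
    (fun r x => 3 + (σ.vec a aLen [r, x]).length * (8 * (σ.vec a aLen [r, x]).length + 15))
    hσ.numR (hσ.numV s) rfl rfl rfl rfl (fun _ _ _ _ h _ => h) (by simp) ?_) ?_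
  · intro S k hk l hl hkl τ hI hr hx hF
    have h₁ := hI k l
    rw [if_neg hkl] at h₁
    refine Wp.mono (wp_sortRow (deg k l) k l _ ha ?_ hr hx h₁) ?_
    · intro τ' h₁ h₂ h₃ z
      rw [hkey τ' (h₃.trans ?_) z, h₁, h₂]
      exact hF.warr _ rfl
    · rintro ρ t ⟨⟨l', rfl, h₂, h₃⟩, h₄, h₅⟩
      refine ⟨fun r x => ?_, by simpa using h₅⟩
      by_cases h : (r, x) = (k, l)
      · obtain ⟨rfl, rfl⟩ := Prod.mk.inj h
        simp [h₂, h₃]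
      · have h' : [r, x] ≠ [k, l] := by simpa using h
        simp only [Set.mem_insert_iff, h, false_or, h₄ _ h']
        exact hI r x
  · rintro τ t ⟨h₁, h₂⟩
    refine ⟨fun r hr x hx => ?_, by simpa using h₂⟩
    have := h₁ r x
    rwa [if_pos ⟨hr, hx⟩] at this

/-- The vector `Next[r, x]` in the memory is complete and sorted. -/
structure NextSorted (D : Data) (s : Side) (r x : ℕ) (l : List ℕ) : Prop where
  nodup : l.Nodup
  mem : ∀ y, y ∈ l ↔ 0 < D.W s x r y
  sorted : l.Pairwise fun y z => D.W s x r y ≤ D.W s x r z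
  length : l.length = (D.nextList s r x (D.m s)).length

/-- The vector `Prev[r, y]` in the memory is complete and sorted. -/
structure PrevSorted (D : Data) (s : Side) (r y : ℕ) (l : List ℕ) : Prop where
  nodup : l.Nodup
  mem : ∀ x, x ∈ l ↔ 0 < D.W s x r y
  sorted : l.Pairwise fun x z => D.W s x r y ≤ D.W s z r y
  length : l.length = (D.prevList s r y (D.m s)).length

/-- A bound for the time that is needed to sort the vectors of the graph on side `s`. -/
def sortTime (D : Data) (s : Side) : ℕ :=
  2 + 4 * D.nR + (D.nR * (D.nV s * 5) + D.m s * (8 * D.nV s + 15))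

/-- The time of insertion sort is quadratic in the length of a vector, the length is at most the number
of vertices, and the sum of the lengths is the number of edges. -/
theorem sum_sort_le (D : Data) (s : Side) (f : ℕ → ℕ → ℕ)
    (h₁ : ∀ r < D.nR, ∀ x < D.nV s, f r x ≤ D.nV s)
    (h₂ : ∑ r ∈ Finset.range D.nR, ∑ x ∈ Finset.range (D.nV s), f r x = D.m s) :
    2 + 4 * D.nR + ∑ r ∈ Finset.range D.nR, ∑ x ∈ Finset.range (D.nV s),
      (3 + f r x * (8 * f r x + 15) + 2) ≤ D.sortTime s := by
  rw [sortTime]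
  gcongr
  calc _ ≤ ∑ r ∈ Finset.range D.nR, ∑ x ∈ Finset.range (D.nV s),
        (5 + f r x * (8 * D.nV s + 15)) := by
        refine Finset.sum_le_sum fun r hr => Finset.sum_le_sum fun x hx => ?_
        have := h₁ r (by simpa using hr) x (by simpa using hx)
        have : f r x * (8 * f r x + 15) ≤ f r x * (8 * D.nV s + 15) := by gcongr
        omega
    _ = _ := by
        simp only [Finset.sum_add_distrib, ← Finset.sum_mul, h₂]
        simp

theorem wp_sortNext (D : Data) (s : Side) {σ : State} (hσ : D.Sizes σ)
    (hE : ∀ x < D.nV s, ∀ r < D.nR, ∀ y < D.nV s, σ.warr (.edge s) [x, r, y] = D.W s x r y)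
    (hN : ∀ r < D.nR, ∀ x < D.nV s, σ.vec (.next s) (.nextLen s) [r, x] =
      D.nextList s r x (D.m s)) :
    Wp (sortNext s) σ fun τ t =>
      (∀ r < D.nR, ∀ x < D.nV s, D.NextSorted s r x (τ.vec (.next s) (.nextLen s) [r, x])) ∧
      t ≤ D.sortTime s := by
  refine Wp.mono (D.wp_sortAll (fun r x y => σ.warr (.edge s) [x, r, y]) hσ (by simp) ?_) ?_
  · intro τ h z
    rw [h]
    rfl
  · rintro τ t ⟨h₁, h₂⟩
    refine ⟨fun r hr x hx => ?_, h₂.trans (D.sum_sort_le s _ ?_ ?_)⟩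
    · obtain ⟨hp, hs⟩ := h₁ r hr x hx
      rw [hN r hr x hx] at hp
      have hmem : ∀ y, y ∈ τ.vec (.next s) (.nextLen s) [r, x] ↔ 0 < D.W s x r y := fun y => by
        rw [hp.mem_iff, mem_nextList]
      refine ⟨hp.nodup_iff.2 (nodup_nextList s r x), hmem, hs.imp_of_mem fun hy hz h => ?_,
        hp.length_eq⟩
      rwa [hE x hx r hr _ (lt_of_pos ((hmem _).1 hy)).2.2,
        hE x hx r hr _ (lt_of_pos ((hmem _).1 hz)).2.2] at h
    · intro r hr x hx
      rw [hN r hr x hx]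
      exact length_nextList_le s r x
    · rw [← sum_length_nextList s]
      refine Finset.sum_congr rfl fun r hr => Finset.sum_congr rfl fun x hx => ?_
      rw [hN r (by simpa using hr) x (by simpa using hx)]

theorem wp_sortPrev (D : Data) (s : Side) {σ : State} (hσ : D.Sizes σ)
    (hE : ∀ x < D.nV s, ∀ r < D.nR, ∀ y < D.nV s, σ.warr (.edge s) [x, r, y] = D.W s x r y)
    (hN : ∀ r < D.nR, ∀ x < D.nV s, σ.vec (.prev s) (.prevLen s) [r, x] =
      D.prevList s r x (D.m s)) :
    Wp (sortPrev s) σ fun τ t =>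
      (∀ r < D.nR, ∀ x < D.nV s, D.PrevSorted s r x (τ.vec (.prev s) (.prevLen s) [r, x])) ∧
      t ≤ D.sortTime s := by
  refine Wp.mono (D.wp_sortAll (fun r x y => σ.warr (.edge s) [y, r, x]) hσ (by simp) ?_) ?_
  · intro τ h z
    rw [h]
    rfl
  · rintro τ t ⟨h₁, h₂⟩
    refine ⟨fun r hr x hx => ?_, h₂.trans (D.sum_sort_le s _ ?_ ?_)⟩
    · obtain ⟨hp, hs⟩ := h₁ r hr x hx
      rw [hN r hr x hx] at hp
      have hmem : ∀ y, y ∈ τ.vec (.prev s) (.prevLen s) [r, x] ↔ 0 < D.W s y r x := fun y => by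
        rw [hp.mem_iff, mem_prevList]
      refine ⟨hp.nodup_iff.2 (nodup_prevList s r x), hmem, hs.imp_of_mem fun hy hz h => ?_,
        hp.length_eq⟩
      rwa [hE _ (lt_of_pos ((hmem _).1 hy)).1 r hr x hx,
        hE _ (lt_of_pos ((hmem _).1 hz)).1 r hr x hx] at h
    · intro r hr x hx
      rw [hN r hr x hx]
      exact length_prevList_le s r x
    · rw [← sum_length_prevList s]
      refine Finset.sum_congr rfl fun r hr => Finset.sum_congr rfl fun x hx => ?_
      rw [hN r (by simpa using hr) x (by simpa using hx)]

end Data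

/-! ### Doubly linked lists -/

/-- The numbers in `A` are the elements of a doubly linked list in ascending order, with the given
references to the predecessor and the successor of each element and to the last element; `0` is the
null reference. -/
structure IsLinked (A : Set ℕ) (before after : ℕ → ℕ) (last : ℕ) : Prop where
  zero_notMem : 0 ∉ A
  last_mem : last = 0 ∨ last ∈ A
  le_last : ∀ v ∈ A, v ≤ last
  before_mem : ∀ u ∈ A, before u = 0 ∨ before u ∈ A
  before_lt : ∀ u ∈ A, before u < u
  le_before : ∀ u ∈ A, ∀ v ∈ A, v < u → v ≤ before u
  after_spec : ∀ u ∈ A, (after u = 0 ∧ ∀ v ∈ A, v ≤ u) ∨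
    (after u ∈ A ∧ u < after u ∧ ∀ v ∈ A, u < v → after u ≤ v)

theorem IsLinked.congr {A : Set ℕ} {before after before' after' : ℕ → ℕ} {last : ℕ}
    (h : IsLinked A before after last) (hb : ∀ u ∈ A, before' u = before u)
    (ha : ∀ u ∈ A, after' u = after u) : IsLinked A before' after' last where
  zero_notMem := h.zero_notMem
  last_mem := h.last_mem
  le_last := h.le_last
  before_mem u hu := by rw [hb u hu]; exact h.before_mem u hu
  before_lt u hu := by rw [hb u hu]; exact h.before_lt u hu
  le_before u hu := by rw [hb u hu]; exact h.le_before u hu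
  after_spec u hu := by rw [ha u hu]; exact h.after_spec u hu

/-- Elements that were allocated one after the other form a list. -/
theorem IsLinked.of_consecutive {a n : ℕ} {before after : ℕ → ℕ}
    (hb : ∀ j < n, before (a + 1 + j) = if j = 0 then 0 else a + j)
    (ha : ∀ j < n, after (a + 1 + j) = if j + 1 = n then 0 else a + j + 2) :
    IsLinked {u | a < u ∧ u ≤ a + n} before after (if n = 0 then 0 else a + n) := by
  have key : ∀ u, a < u ∧ u ≤ a + n → ∃ j < n, u = a + 1 + j := fun u hu =>
    ⟨u - (a + 1), by omega, by omega⟩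
  constructor
  · simp
  · simp only [Set.mem_ofPred_eq]; split_ifs <;> omega
  · intro v hv
    simp only [Set.mem_ofPred_eq] at hv
    split_ifs <;> omega
  · intro u hu
    obtain ⟨j, hj, rfl⟩ := key u hu
    rw [hb j hj]
    simp only [Set.mem_ofPred_eq]
    split_ifs <;> omega
  · intro u hu
    obtain ⟨j, hj, rfl⟩ := key u hu
    rw [hb j hj]
    split_ifs <;> omega
  · intro u hu v hv hvu
    obtain ⟨j, hj, rfl⟩ := key u hu
    rw [hb j hj]
    simp only [Set.mem_ofPred_eq] at hv
    split_ifs <;> omega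
  · intro u hu
    obtain ⟨j, hj, rfl⟩ := key u hu
    rw [ha j hj]
    simp only [Set.mem_ofPred_eq]
    split_ifs with h
    · exact .inl ⟨rfl, fun v hv => by omega⟩
    · exact .inr ⟨by omega, by omega, fun v hv hv' => by omega⟩

/-- Deletion of the element `u`. -/
theorem IsLinked.delete {A : Set ℕ} {before after : ℕ → ℕ} {last u : ℕ}
    (h : IsLinked A before after last) (hu : u ∈ A) :
    IsLinked (A \ {u})
      (if after u = 0 then before else Function.update before (after u) (before u))
      (if before u = 0 then after else Function.update after (before u) (after u))
      (if after u = 0 then before u else last) := by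
  obtain ⟨h₀, h₁, h₂, h₃, h₄, h₅, h₆⟩ := h
  have hb := h₃ u hu
  have hb' := h₄ u hu
  have hb'' := h₅ u hu
  have ha := h₆ u hu
  have hu₀ : u ≠ 0 := fun h => h₀ (h ▸ hu)
  have hB : ∀ v ∈ A, (if after u = 0 then before else
      Function.update before (after u) (before u)) v =
      if v = after u then before u else before v := by
    intro v hv
    have hv₀ : v ≠ 0 := fun h => h₀ (h ▸ hv)
    by_cases h : after u = 0
    · rw [if_pos h, if_neg (by omega)]
    · rw [if_neg h, Function.update_apply]
  have hA : ∀ v ∈ A, (if before u = 0 then after else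
      Function.update after (before u) (after u)) v =
      if v = before u then after u else after v := by
    intro v hv
    have hv₀ : v ≠ 0 := fun h => h₀ (h ▸ hv)
    by_cases h : before u = 0
    · rw [if_pos h, if_neg (by omega)]
    · rw [if_neg h, Function.update_apply]
  have ha₀ : after u ∈ A → after u ≠ 0 := fun h h' => h₀ (h' ▸ h)
  constructor
  · exact fun h => h₀ h.1
  · rcases ha with ⟨ha, ha'⟩ | ⟨ha, ha', ha''⟩
    · rw [if_pos ha]
      rcases hb with hb | hb
      · exact .inl hb
      · exact .inr ⟨hb, fun h => hb'.ne h⟩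
    · rw [if_neg (ha₀ ha)]
      have := h₂ _ ha
      rcases h₁ with h₁ | h₁
      · exact .inl h₁
      · exact .inr ⟨h₁, fun h => by
          have h : last = u := h
          omega⟩
  · rintro v ⟨hv, hvu⟩
    have hvu : v ≠ u := hvu
    rcases ha with ⟨ha, ha'⟩ | ⟨ha, ha', ha''⟩
    · rw [if_pos ha]
      exact hb'' v hv (lt_of_le_of_ne (ha' v hv) hvu)
    · rw [if_neg (ha₀ ha)]
      exact h₂ v hv
  · rintro v ⟨hv, hvu⟩
    have hvu : v ≠ u := hvu
    rw [hB v hv]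
    split_ifs with h
    · exact hb.imp_right fun h => ⟨h, fun h' => hb'.ne h'⟩
    · refine (h₃ v hv).imp_right fun h' => ⟨h', fun h'' => ?_⟩
      have h'' : before v = u := h''
      have h₄v := h₄ v hv
      rcases ha with ⟨ha, ha'⟩ | ⟨ha, ha', ha''⟩
      · have := ha' v hv
        omega
      · have := ha'' v hv (by omega)
        have := h₅ v hv _ ha (by omega)
        omega
  · rintro v ⟨hv, hvu⟩
    rw [hB v hv]
    split_ifs with h
    · rcases ha with ⟨ha, ha'⟩ | ⟨ha, ha', ha''⟩
      · exact absurd hv (by rw [h, ha]; exact h₀)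
      · omega
    · exact h₄ v hv
  · rintro v ⟨hv, hvu⟩ w ⟨hw, hwu⟩ hwv
    have hwu : w ≠ u := hwu
    rw [hB v hv]
    split_ifs with h
    · by_cases h' : w < u
      · exact hb'' w hw h'
      · rcases ha with ⟨ha, ha'⟩ | ⟨ha, ha', ha''⟩
        · exact absurd (ha' w hw) (by omega)
        · exact absurd (ha'' w hw (by omega)) (by omega)
    · exact h₅ v hv w hw hwv
  · rintro v ⟨hv, hvu⟩
    have hvu : v ≠ u := hvu
    rw [hA v hv]
    split_ifs with h
    · rcases ha with ⟨ha, ha'⟩ | ⟨ha, ha', ha''⟩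
      · refine .inl ⟨ha, fun w hw => ?_⟩
        rw [h]
        exact hb'' w hw.1 (lt_of_le_of_ne (ha' w hw.1) hw.2)
      · refine .inr ⟨⟨ha, fun h => ha'.ne' h⟩, by omega, fun w hw hvw => ha'' w hw.1 ?_⟩
        by_contra hlt
        have hwu : w ≠ u := hw.2
        have := hb'' w hw.1 (by omega)
        omega
    · rcases h₆ v hv with ⟨hv₁, hv₂⟩ | ⟨hv₁, hv₂, hv₃⟩
      · exact .inl ⟨hv₁, fun w hw => hv₂ w hw.1⟩
      · refine .inr ⟨⟨hv₁, fun h' => ?_⟩, hv₂, fun w hw => hv₃ w hw.1⟩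
        have h' : after v = u := h'
        have h₈ := hb'' v hv (by omega)
        have hb₂ : before u ∈ A := hb.resolve_left (by omega)
        have := hv₃ _ hb₂ (by omega)
        omega

/-! ### Building the vectors rcPrev and the lists rcNext -/

namespace Data

open Classical in
/-- The sublist of the vertices `x` of side `s` for which the labels of `x` and `y` satisfy the
condition of a directed simulation. -/
noncomputable def keep (D : Data) (s : Side) (y : ℕ) (l : List ℕ) : List ℕ :=
  l.filter fun x => mkPair s x y ∈ D.labelPairs

theorem mem_keep {D : Data} {s : Side} {x y : ℕ} {l : List ℕ} :
    x ∈ D.keep s y l ↔ x ∈ l ∧ mkPair s x y ∈ D.labelPairs := by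
  simp [keep]

theorem keep_concat_of_mem {D : Data} {s : Side} {x y : ℕ} {l : List ℕ}
    (h : mkPair s x y ∈ D.labelPairs) : D.keep s y (l ++ [x]) = D.keep s y l ++ [x] := by
  simp [keep, h]

theorem keep_concat_of_notMem {D : Data} {s : Side} {x y : ℕ} {l : List ℕ}
    (h : mkPair s x y ∉ D.labelPairs) : D.keep s y (l ++ [x]) = D.keep s y l := by
  simp [keep, h]

/-- The array `Z` has its initial content. -/
def ZInit (D : Data) (σ : State) : Prop :=
  ∀ x < D.nV .left, ∀ x' < D.nV .right, σ.arr .Z [x, x'] = 1 ↔ (x, x') ∈ D.labelPairs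

theorem ZInit.pair {D : Data} {σ : State} (h : D.ZInit σ) {s : Side} {x y : ℕ} (hx : x < D.nV s)
    (hy : y < D.nV s.opp) :
    σ.arr .Z [(mkPair s x y).1, (mkPair s x y).2] = 1 ↔ mkPair s x y ∈ D.labelPairs := by
  cases s
  · exact h x hx y hy
  · exact h y hy x hx

/-- The first loop in the construction for a triple: it fills `rcPrev[r, y, x']`. -/
theorem wp_fillRcPrev (D : Data) (s : Side) {σ : State} (r₀ y₀ x₀ : ℕ) (hZ : D.ZInit σ)
    (hr : σ.reg .r = r₀) (hy : σ.reg (.vert s) = y₀) (hx : σ.reg (.vert s.opp) = x₀)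
    (hx₀ : x₀ < D.nV s.opp)
    (hlt : ∀ x ∈ σ.vec (.prev s) (.prevLen s) [r₀, y₀], x < D.nV s) (hj : σ.reg .j = 0)
    (hlen : σ.reg .len = (σ.vec (.prev s) (.prevLen s) [r₀, y₀]).length) :
    Wp (forRange .i .len (block [
      load .x (.prev s) [.r, .vert s, .i],
      load .bit .Z (pairIdx s .x (.vert s.opp)),
      .ite (.eq .bit 1)
        (block [
          store (.rcPrev s) [.r, .vert s, .vert s.opp, .j] .x,
          succ .j .j])
        .skip])) σ fun τ t =>
      τ.reg .j = (D.keep s x₀ (σ.vec (.prev s) (.prevLen s) [r₀, y₀])).length ∧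
      row (τ.arr (.rcPrev s)) [r₀, y₀, x₀] (τ.reg .j) =
        D.keep s x₀ (σ.vec (.prev s) (.prevLen s) [r₀, y₀]) ∧
      (∀ idx ≠ [r₀, y₀, x₀], ∀ k, row (τ.arr (.rcPrev s)) idx k =
        row (σ.arr (.rcPrev s)) idx k) ∧
      t ≤ 2 + (σ.vec (.prev s) (.prevLen s) [r₀, y₀]).length * 7 := by
  generalize hl : σ.vec (.prev s) (.prevLen s) [r₀, y₀] = l at *
  refine Wp.mono (wp_for l.length (fun i τ =>
    τ.reg .j = (D.keep s x₀ (l.take i)).length ∧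
      row (τ.arr (.rcPrev s)) [r₀, y₀, x₀] (τ.reg .j) = D.keep s x₀ (l.take i) ∧
      (∀ idx ≠ [r₀, y₀, x₀], ∀ k, row (τ.arr (.rcPrev s)) idx k =
        row (σ.arr (.rcPrev s)) idx k)) (fun _ => 0) (fun _ => 5) hlen rfl rfl ?_ ?_) ?_
  · simp [hj, keep, row]
  · rintro i hi τ ⟨h₁, h₂, h₃⟩ hi' hF
    have hr' : τ.reg .r = r₀ := (hF.reg _ rfl).trans hr
    have hy' : τ.reg (.vert s) = y₀ := (hF.reg _ (by cases s <;> rfl)).trans hy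
    have hx' : τ.reg (.vert s.opp) = x₀ := (hF.reg _ (by cases s <;> rfl)).trans hx
    have hread : τ.arr (.prev s) [r₀, y₀, i] = l[i] := by
      rw [hF.arr _ rfl]
      exact State.arr_eq_of_vec hl hi
    have hZ' : τ.arr .Z [(mkPair s l[i] x₀).1, (mkPair s l[i] x₀).2] = 1 ↔
        mkPair s l[i] x₀ ∈ D.labelPairs := by
      rw [hF.arr _ rfl]
      exact hZ.pair (hlt _ (List.getElem_mem hi)) hx₀
    have htake : l.take (i + 1) = l.take i ++ [l[i]] := by simp
    simp only [wp_block_cons, wp_load, wp_ite, wp_store, wp_succ, wp_skip, wp_block_nil,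
      Test.holds, State.reg_setReg, List.map_cons, List.map_nil, map_pairIdx, reduceCtorEq,
      if_true, if_false, hr', hy', hx', hi', hread, State.arr_setReg, hZ', State.reg_setArr,
      State.arr_setArr, htake]
    refine ⟨fun h => ⟨⟨?_, ?_, ?_⟩, by norm_num⟩, fun h => ⟨⟨?_, ?_, ?_⟩, by norm_num⟩⟩
    · rw [keep_concat_of_mem h, h₁]
      simp
    · rw [keep_concat_of_mem h, ← h₂, row_succ]
      congr 1
      · exact row_update_of_le le_rfl
      · simp
    · intro idx hidx k
      rw [← h₃ idx hidx k]
      exact row_update_of_ne (idx' := [r₀, y₀, x₀]) hidx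
    · rw [keep_concat_of_notMem h, h₁]
    · rw [keep_concat_of_notMem h, h₂]
    · exact h₃
  · rintro τ t ⟨⟨h₁, h₂, h₃⟩, h₄⟩
    rw [List.take_length] at h₁ h₂
    exact ⟨h₁, h₂, h₃, by simpa using h₄⟩

/-- During the construction of the list `rcNext'[r, y, x']` (for `s = left`; or the dual), which is
started in the state `σ` with `a` allocated elements, the elements with the keys `l` have been
constructed. -/
structure Chain (s : Side) (σ : State) (r y x' a : ℕ) (l : List ℕ) (τ : State) : Prop where
  alloc : τ.reg .alloc = a + l.length
  key : ∀ (j : ℕ) (h : j < l.length), τ.arr .elemKey [a + 1 + j] = l[j]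
  elem : ∀ (j : ℕ) (h : j < l.length),
    τ.arr (.rcNextElem s.opp) [y, τ.arr (.edgeID s.opp) [x', r, l[j]]] = a + 1 + j
  before : ∀ j < l.length, τ.arr .elemBefore [a + 1 + j] = if j = 0 then 0 else a + j
  after : ∀ j < l.length, τ.arr .elemAfter [a + 1 + j] = if j + 1 = l.length then 0 else a + j + 2
  last : τ.reg .before = if l.length = 0 then 0 else a + l.length
  old_key : ∀ u ≤ a, τ.arr .elemKey [u] = σ.arr .elemKey [u]
  old_before : ∀ u ≤ a, τ.arr .elemBefore [u] = σ.arr .elemBefore [u]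
  old_after : ∀ u ≤ a, τ.arr .elemAfter [u] = σ.arr .elemAfter [u]
  old_elem : ∀ y₁ e, (∀ y' ∈ l, ¬ (y₁ = y ∧ e = τ.arr (.edgeID s.opp) [x', r, y'])) →
    τ.arr (.rcNextElem s.opp) [y₁, e] = σ.arr (.rcNextElem s.opp) [y₁, e]

/-- One element is appended. -/
theorem wp_appendElem {s : Side} {σ τ : State} {r₀ y₀ x₀ a y₁ : ℕ} {l : List ℕ}
    (h : Chain s σ r₀ y₀ x₀ a l τ) (hr : τ.reg .r = r₀) (hy : τ.reg (.vert s) = y₀)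
    (hx : τ.reg (.vert s.opp) = x₀) (hy₁ : τ.reg .y = y₁)
    (hinj : ∀ y' ∈ l, τ.arr (.edgeID s.opp) [x₀, r₀, y'] ≠ τ.arr (.edgeID s.opp) [x₀, r₀, y₁]) :
    Wp (block [
          succ .alloc .alloc,
          move .u .alloc,
          store .elemKey [.u] .y,
          store .elemBefore [.u] .before,
          const .after 0,
          store .elemAfter [.u] .after,
          .ite (.eq .before 0) .skip (store .elemAfter [.before] .u),
          load .e (.edgeID s.opp) [.vert s.opp, .r, .y],
          store (.rcNextElem s.opp) [.vert s, .e] .u,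
          move .before .u]) τ fun ρ t => Chain s σ r₀ y₀ x₀ a (l ++ [y₁]) ρ ∧ t ≤ 11 := by
  have hb := h.last
  have ha := h.alloc
  have key : ∀ j, j < (l ++ [y₁]).length → (j < l.length ∨ j = l.length) := by
    intro j hj
    simp at hj
    omega
  simp only [wp_block_cons, wp_load, wp_ite, wp_store, wp_succ, wp_skip, wp_block_nil, wp_move,
    wp_const, Test.holds, State.reg_setReg, List.map_cons, List.map_nil, reduceCtorEq, if_true,
    if_false, hr, hy, hx, hy₁, State.arr_setReg, State.reg_setArr, State.arr_setArr, ha, hb]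
  refine ⟨fun hl => ⟨?_, by norm_num⟩, fun hl => ⟨?_, by norm_num⟩⟩
  · have hl : l = [] := by
      by_contra hne
      have := List.length_pos_of_ne_nil hne
      rw [if_neg (by omega)] at hl
      omega
    subst hl
    constructor
    · simp
    · intro j hj; obtain rfl : j = 0 := by simpa using hj
      simp
    · intro j hj; obtain rfl : j = 0 := by simpa using hj
      simp
    · intro j hj; obtain rfl : j = 0 := by simpa using hj
      simp
    · intro j hj; obtain rfl : j = 0 := by simpa using hj
      simp
    · simp
    · intro u hu
      have : u ≠ a + 1 := by omega
      simpa [Function.update_apply, this] using h.old_key u hu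
    · intro u hu
      have : u ≠ a + 1 := by omega
      simpa [Function.update_apply, this] using h.old_before u hu
    · intro u hu
      have : u ≠ a + 1 := by omega
      simpa [Function.update_apply, this] using h.old_after u hu
    · intro y₂ e he
      have he : ¬ (y₂ = y₀ ∧ e = τ.arr (.edgeID s.opp) [x₀, r₀, y₁]) := by simpa using he
      simpa [Function.update_apply, he] using h.old_elem y₂ e (by simp)
  · have hl₀ : l.length ≠ 0 := fun h' => hl (by simp [h'])
    simp only [if_neg hl₀]
    constructor
    · simp [add_assoc]
    · intro j hj
      rcases key j hj with hj' | rfl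
      · have : a + 1 + j ≠ a + l.length + 1 := by omega
        simpa [Function.update_apply, this, List.getElem_append_left hj'] using h.key j hj'
      · have : a + 1 + l.length = a + l.length + 1 := by omega
        simp [this]
    · intro j hj
      rcases key j hj with hj' | rfl
      · have := hinj l[j] (List.getElem_mem hj')
        simpa [Function.update_apply, this, List.getElem_append_left hj'] using h.elem j hj'
      · have : a + 1 + l.length = a + l.length + 1 := by omega
        simp [this]
    · intro j hj
      rcases key j hj with hj' | rfl
      · have : a + 1 + j ≠ a + l.length + 1 := by omega
        simpa [Function.update_apply, this] using h.before j hj'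
      · have : a + 1 + l.length = a + l.length + 1 := by omega
        simp [this, hl₀]
    · intro j hj
      rcases key j hj with hj' | rfl
      · have h₁ : a + 1 + j ≠ a + l.length + 1 := by omega
        have h₂ := h.after j hj'
        have h₃ : ¬ j = l.length := by omega
        simp only [State.arr_setReg, State.arr_setArr, reduceCtorEq, if_false, if_true,
          Function.update_apply, List.cons.injEq, and_true, h₁, h₂, List.length_append,
          List.length_cons, List.length_nil, zero_add, Nat.add_right_cancel_iff, h₃]
        by_cases h₄ : j + 1 = l.length
        · rw [if_pos (by omega)]
          omega
        · rw [if_neg (by omega), if_neg h₄]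
      · have : a + 1 + l.length = a + l.length + 1 := by omega
        simp [this]
    · simp [add_assoc]
    · intro u hu
      have : u ≠ a + l.length + 1 := by omega
      simpa [Function.update_apply, this] using h.old_key u hu
    · intro u hu
      have : u ≠ a + l.length + 1 := by omega
      simpa [Function.update_apply, this] using h.old_before u hu
    · intro u hu
      have h₁ : u ≠ a + l.length + 1 := by omega
      have h₂ : u ≠ a + l.length := by omega
      simpa [Function.update_apply, h₁, h₂] using h.old_after u hu
    · intro y₂ e he
      have he₁ : ¬ (y₂ = y₀ ∧ e = τ.arr (.edgeID s.opp) [x₀, r₀, y₁]) := he y₁ (by simp)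
      simpa [Function.update_apply, he₁] using
        h.old_elem y₂ e fun y' hy' => he y' (List.mem_append_left _ hy')

/-- The second loop in the construction for a triple: it builds `rcNext'[r, y, x']`. -/
theorem wp_fillRcNext (D : Data) (s : Side) {σ : State} (r₀ y₀ x₀ : ℕ) (hZ : D.ZInit σ)
    (hr : σ.reg .r = r₀) (hy : σ.reg (.vert s) = y₀) (hx : σ.reg (.vert s.opp) = x₀)
    (hy₀ : y₀ < D.nV s) {l : List ℕ}
    (hl : σ.vec (.next s.opp) (.nextLen s.opp) [r₀, x₀] = l)
    (hlt : ∀ y ∈ l, y < D.nV s.opp) (hnd : l.Nodup)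
    (hinj : ∀ y ∈ l, ∀ y' ∈ l, σ.arr (.edgeID s.opp) [x₀, r₀, y] =
      σ.arr (.edgeID s.opp) [x₀, r₀, y'] → y = y') (hb : σ.reg .before = 0)
    (hlen : σ.reg .len = l.length) :
    Wp (forRange .i .len (block [
      load .y (.next s.opp) [.r, .vert s.opp, .i],
      load .bit .Z (pairIdx s (.vert s) .y),
      .ite (.eq .bit 1)
        (block [
          succ .alloc .alloc,
          move .u .alloc,
          store .elemKey [.u] .y,
          store .elemBefore [.u] .before,
          const .after 0,
          store .elemAfter [.u] .after,
          .ite (.eq .before 0) .skip (store .elemAfter [.before] .u),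
          load .e (.edgeID s.opp) [.vert s.opp, .r, .y],
          store (.rcNextElem s.opp) [.vert s, .e] .u,
          move .before .u])
        .skip])) σ fun τ t =>
      Chain s σ r₀ y₀ x₀ (σ.reg .alloc) (D.keep s.opp y₀ l) τ ∧ t ≤ 2 + l.length * 16 := by
  refine Wp.mono (wp_for l.length
    (fun i τ => Chain s σ r₀ y₀ x₀ (σ.reg .alloc) (D.keep s.opp y₀ (l.take i)) τ) (fun _ => 0)
    (fun _ => 14) hlen rfl rfl ?_ ?_) ?_
  · constructor <;> simp [keep, hb]
  · rintro i hi τ h hi' hF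
    have hr' : τ.reg .r = r₀ := (hF.reg _ rfl).trans hr
    have hy' : τ.reg (.vert s) = y₀ := (hF.reg _ (by cases s <;> rfl)).trans hy
    have hx' : τ.reg (.vert s.opp) = x₀ := (hF.reg _ (by cases s <;> rfl)).trans hx
    have hread : τ.arr (.next s.opp) [r₀, x₀, i] = l[i] := by
      rw [hF.arr _ rfl]
      exact State.arr_eq_of_vec hl hi
    have hZ' : τ.arr .Z [(mkPair s y₀ l[i]).1, (mkPair s y₀ l[i]).2] = 1 ↔
        mkPair s.opp l[i] y₀ ∈ D.labelPairs := by
      rw [hF.arr _ rfl, mkPair_opp]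
      exact hZ.pair hy₀ (hlt _ (List.getElem_mem hi))
    have htake : l.take (i + 1) = l.take i ++ [l[i]] := by simp
    have hid : τ.arr (.edgeID s.opp) = σ.arr (.edgeID s.opp) := hF.arr _ rfl
    rw [wp_block_cons, wp_load, wp_block_cons, wp_load, wp_block_cons, wp_ite]
    simp only [Test.holds, State.reg_setReg, List.map_cons, List.map_nil, map_pairIdx, reduceCtorEq,
      if_true, if_false, hr', hy', hx', hi', hread, State.arr_setReg, hZ', wp_skip, wp_block_nil,
      htake]
    refine ⟨fun hm => ?_, fun hm => ?_⟩
    · rw [keep_concat_of_mem hm]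
      refine Wp.mono (wp_appendElem (σ := σ) (r₀ := r₀) (y₀ := y₀) (x₀ := x₀) (a := σ.reg .alloc)
        (y₁ := l[i]) (l := D.keep s.opp y₀ (l.take i)) ?_ ?_ ?_ ?_ ?_ ?_) ?_
      · exact ⟨h.alloc, h.key, h.elem, h.before, h.after, h.last, h.old_key, h.old_before,
          h.old_after, h.old_elem⟩
      · simpa using hr'
      · simpa using hy'
      · simpa using hx'
      · simp
      · intro y hy he
        have hy := (mem_keep.1 hy).1
        have he : τ.arr (.edgeID s.opp) [x₀, r₀, y] = τ.arr (.edgeID s.opp) [x₀, r₀, l[i]] := he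
        rw [hid] at he
        have := hinj y (List.mem_of_mem_take hy) _ (List.getElem_mem hi) he
        subst this
        rw [← List.take_append_drop i l, List.nodup_append, List.drop_eq_getElem_cons hi] at hnd
        exact hnd.2.2 _ hy _ List.mem_cons_self rfl
      · rintro ρ t ⟨h₁, h₂⟩
        exact ⟨⟨h₁.alloc, h₁.key, h₁.elem, h₁.before, h₁.after, h₁.last, h₁.old_key,
          h₁.old_before, h₁.old_after, h₁.old_elem⟩, by omega⟩
    · rw [keep_concat_of_notMem hm]
      exact ⟨⟨h.alloc, h.key, h.elem, h.before, h.after, h.last, h.old_key, h.old_before,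
          h.old_after, h.old_elem⟩, by norm_num⟩
  · rintro τ t ⟨h₁, h₂⟩
    rw [List.take_length] at h₁
    exact ⟨h₁, by simpa using h₂⟩

end Data

/-- The reference stored in `rcNextElem` to the element with key `y'` of the list with index
`[r, x', y]`, where `y` is a vertex of side `s` and `x'` and `y'` are vertices of the opposite
side. -/
def State.node (σ : State) (s : Side) (r y x' y' : ℕ) : ℕ :=
  σ.arr (.rcNextElem s.opp) [y, σ.arr (.edgeID s.opp) [x', r, y']]

namespace Data

/-- The vertex `y'` initially belongs to the list with index `[r, x', y]`. -/
def InitAlive (D : Data) (s : Side) (r y x' y' : ℕ) : Prop :=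
  0 < D.W s.opp x' r y' ∧ mkPair s y y' ∈ D.labelPairs

/-- The vector `rcPrev[r, y, x']` and the list `rcNext'[r, y, x']` (for `s = left`; or the duals)
have been built, with list elements greater than `a₀`. -/
structure RcBuilt (D : Data) (s : Side) (a₀ r y x' : ℕ) (σ : State) : Prop where
  rcPrev : σ.vec (.rcPrev s) (.rcPrevLen s) [r, y, x'] =
    D.keep s x' (σ.vec (.prev s) (.prevLen s) [r, y])
  lt_node : ∀ y', D.InitAlive s r y x' y' → a₀ < σ.node s r y x' y'
  node_le : ∀ y', D.InitAlive s r y x' y' → σ.node s r y x' y' ≤ σ.reg .alloc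
  key : ∀ y', D.InitAlive s r y x' y' → σ.arr .elemKey [σ.node s r y x' y'] = y'
  mono : ∀ y₁ y₂, D.InitAlive s r y x' y₁ → D.InitAlive s r y x' y₂ →
    σ.node s r y x' y₁ ≤ σ.node s r y x' y₂ → D.W s.opp x' r y₁ ≤ D.W s.opp x' r y₂
  linked : IsLinked {u | ∃ y', D.InitAlive s r y x' y' ∧ u = σ.node s r y x' y'}
    (fun u => σ.arr .elemBefore [u]) (fun u => σ.arr .elemAfter [u])
    (σ.arr (.rcNextLast s.opp) [r, x', y])

/-- The arrays of the graph on side `s` are complete: they contain the degrees, pairwise different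
numbers of the edges, and sorted vectors Next and Prev. -/
structure GraphReady (D : Data) (s : Side) (σ : State) : Prop where
  edge : ∀ x < D.nV s, ∀ r < D.nR, ∀ y < D.nV s, σ.warr (.edge s) [x, r, y] = D.W s x r y
  edgeID_inj : ∀ {x r y x' r' y'}, 0 < D.W s x r y → 0 < D.W s x' r' y' →
    σ.arr (.edgeID s) [x, r, y] = σ.arr (.edgeID s) [x', r', y'] → x = x' ∧ r = r' ∧ y = y'
  next : ∀ r < D.nR, ∀ x < D.nV s, D.NextSorted s r x (σ.vec (.next s) (.nextLen s) [r, x])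
  prev : ∀ r < D.nR, ∀ y < D.nV s, D.PrevSorted s r y (σ.vec (.prev s) (.prevLen s) [r, y])

theorem GraphReady.congr {D : Data} {s : Side} {σ τ : State} (h : D.GraphReady s σ)
    (h₁ : τ.warr (.edge s) = σ.warr (.edge s)) (h₂ : τ.arr (.edgeID s) = σ.arr (.edgeID s))
    (h₃ : τ.arr (.next s) = σ.arr (.next s)) (h₄ : τ.arr (.nextLen s) = σ.arr (.nextLen s))
    (h₅ : τ.arr (.prev s) = σ.arr (.prev s)) (h₆ : τ.arr (.prevLen s) = σ.arr (.prevLen s)) :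
    D.GraphReady s τ := by
  constructor
  · rw [h₁]; exact h.edge
  · rw [h₂]; exact h.edgeID_inj
  · rw [State.vec_congr h₃ h₄]; exact h.next
  · rw [State.vec_congr h₅ h₆]; exact h.prev

/-- The construction for one triple. -/
theorem wp_buildRc_body (D : Data) (s : Side) {σ : State} {r₀ y₀ x₀ : ℕ} (hZ : D.ZInit σ)
    (hG : D.GraphReady s σ) (hG' : D.GraphReady s.opp σ)
    (hr : σ.reg .r = r₀) (hy : σ.reg (.vert s) = y₀) (hx : σ.reg (.vert s.opp) = x₀)
    (hr₀ : r₀ < D.nR) (hy₀ : y₀ < D.nV s) (hx₀ : x₀ < D.nV s.opp) :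
    Wp (block [
    const .j 0,
    load .len (.prevLen s) [.r, .vert s],
    forRange .i .len (block [
      load .x (.prev s) [.r, .vert s, .i],
      load .bit .Z (pairIdx s .x (.vert s.opp)),
      .ite (.eq .bit 1)
        (block [
          store (.rcPrev s) [.r, .vert s, .vert s.opp, .j] .x,
          succ .j .j])
        .skip]),
    store (.rcPrevLen s) [.r, .vert s, .vert s.opp] .j,
    const .before 0,
    load .len (.nextLen s.opp) [.r, .vert s.opp],
    forRange .i .len (block [
      load .y (.next s.opp) [.r, .vert s.opp, .i],
      load .bit .Z (pairIdx s (.vert s) .y),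
      .ite (.eq .bit 1)
        (block [
          succ .alloc .alloc,
          move .u .alloc,
          store .elemKey [.u] .y,
          store .elemBefore [.u] .before,
          const .after 0,
          store .elemAfter [.u] .after,
          .ite (.eq .before 0) .skip (store .elemAfter [.before] .u),
          load .e (.edgeID s.opp) [.vert s.opp, .r, .y],
          store (.rcNextElem s.opp) [.vert s, .e] .u,
          move .before .u])
        .skip]),
    store (.rcNextLast s.opp) [.r, .vert s.opp, .vert s] .before]) σ fun τ t =>
      τ.vec (.rcPrev s) (.rcPrevLen s) [r₀, y₀, x₀] =
        D.keep s x₀ (σ.vec (.prev s) (.prevLen s) [r₀, y₀]) ∧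
      (∀ idx ≠ [r₀, y₀, x₀], τ.vec (.rcPrev s) (.rcPrevLen s) idx =
        σ.vec (.rcPrev s) (.rcPrevLen s) idx) ∧
      Chain s σ r₀ y₀ x₀ (σ.reg .alloc)
        (D.keep s.opp y₀ (σ.vec (.next s.opp) (.nextLen s.opp) [r₀, x₀])) τ ∧
      τ.arr (.rcNextLast s.opp) = Function.update (σ.arr (.rcNextLast s.opp)) [r₀, x₀, y₀]
        (τ.reg .before) ∧
      t ≤ 10 + 7 * (σ.vec (.prev s) (.prevLen s) [r₀, y₀]).length +
        16 * (σ.vec (.next s.opp) (.nextLen s.opp) [r₀, x₀]).length := by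
  have hP := hG.prev r₀ hr₀ y₀ hy₀
  have hN := hG'.next r₀ hr₀ x₀ hx₀
  have hlenP := σ.length_vec (.prev s) (.prevLen s) [r₀, y₀]
  have hlenN := σ.length_vec (.next s.opp) (.nextLen s.opp) [r₀, x₀]
  rw [wp_block_cons, wp_const, wp_block_cons, wp_load, wp_block_cons]
  refine Wp.mono (Wp.frame (D.wp_fillRcPrev s r₀ y₀ x₀ (by exact hZ) ?_ ?_ ?_ hx₀ ?_ ?_ ?_)) ?_
  · simpa using hr
  · simpa using hy
  · simpa using hx
  · exact fun x hx => (lt_of_pos ((hP.mem x).1 hx)).1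
  · simp
  · simp only [List.map_cons, List.map_nil, State.reg_setReg, State.arr_setReg, reduceCtorEq,
      if_false, if_true, hr, hy]
    exact hlenP.symm
  rintro τ t ⟨⟨h₁, h₂, h₃, ht⟩, hF⟩
  have hr' : τ.reg .r = r₀ := by rw [hF.reg _ rfl]; simpa using hr
  have hy' : τ.reg (.vert s) = y₀ := by rw [hF.reg _ (by cases s <;> rfl)]; simpa using hy
  have hx' : τ.reg (.vert s.opp) = x₀ := by rw [hF.reg _ (by cases s <;> rfl)]; simpa using hx
  have ha' : τ.reg .alloc = σ.reg .alloc := by rw [hF.reg _ rfl]; simp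
  rw [wp_block_cons, wp_store, wp_block_cons, wp_const, wp_block_cons, wp_load, wp_block_cons]
  simp only [List.map_cons, List.map_nil, State.reg_setReg, State.arr_setReg, reduceCtorEq,
    if_false, State.reg_setArr, State.arr_setArr, hr', hy', hx']
  have hnl : τ.arr (.nextLen s.opp) = σ.arr (.nextLen s.opp) := hF.arr _ rfl
  have hn : τ.arr (.next s.opp) = σ.arr (.next s.opp) := hF.arr _ rfl
  have hid : τ.arr (.edgeID s.opp) = σ.arr (.edgeID s.opp) := hF.arr _ rfl
  have hvec : ∀ idx, State.vec (((τ.setArr (.rcPrevLen s) [r₀, y₀, x₀] (τ.reg .j)).setReg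
      .before 0).setReg .len (τ.arr (.nextLen s.opp) [r₀, x₀])) (.next s.opp) (.nextLen s.opp) idx =
      σ.vec (.next s.opp) (.nextLen s.opp) idx := by
    intro idx
    rw [State.vec_congr (σ := σ)]
    · simpa using hn
    · simpa using hnl
  refine Wp.mono (Wp.frame (D.wp_fillRcNext s r₀ y₀ x₀ ?_ ?_ ?_ ?_ hy₀ (hvec _)
    (fun y hy => (lt_of_pos ((hN.mem y).1 hy)).2.2) hN.nodup ?_ ?_ ?_)) ?_
  · intro x hx x' hx'
    rw [← hZ x hx x' hx']
    simp only [State.arr_setReg, State.arr_setArr, reduceCtorEq, if_false]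
    rw [hF.arr _ rfl]
    rfl
  · simpa using hr'
  · simpa using hy'
  · simpa using hx'
  · intro y hy y' hy' he
    simp only [State.arr_setReg, State.arr_setArr, reduceCtorEq, if_false, hid] at he
    exact (hG'.edgeID_inj ((hN.mem y).1 hy) ((hN.mem y').1 hy') he).2.2
  · simp
  · simp only [State.reg_setReg, if_true, hnl]
    exact hlenN.symm
  rintro ρ u ⟨⟨h₄, hu⟩, hF'⟩
  have hr'' : ρ.reg .r = r₀ := by rw [hF'.reg _ rfl]; simpa using hr'
  have hy'' : ρ.reg (.vert s) = y₀ := by rw [hF'.reg _ (by cases s <;> rfl)]; simpa using hy'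
  have hx'' : ρ.reg (.vert s.opp) = x₀ := by rw [hF'.reg _ (by cases s <;> rfl)]; simpa using hx'
  rw [wp_block_cons, wp_store, wp_block_nil]
  simp only [List.map_cons, List.map_nil, hr'', hx'', hy'']
  have hrp : ρ.arr (.rcPrev s) = τ.arr (.rcPrev s) := by
    rw [hF'.arr _ rfl]; simp
  have hrl : ρ.arr (.rcPrevLen s) =
      Function.update (σ.arr (.rcPrevLen s)) [r₀, y₀, x₀] (τ.reg .j) := by
    rw [hF'.arr _ rfl]
    simp only [State.arr_setReg, State.arr_setArr, if_true]
    rw [hF.arr _ rfl]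
    rfl
  have hall : (((τ.setArr (.rcPrevLen s) [r₀, y₀, x₀] (τ.reg .j)).setReg
      .before 0).setReg .len (τ.arr (.nextLen s.opp) [r₀, x₀])).reg .alloc = σ.reg .alloc := by
    simpa using ha'
  rw [hall] at h₄
  refine ⟨?_, ?_, ?_, ?_, ?_⟩
  · simp only [State.vec, State.arr_setArr, reduceCtorEq, if_false, hrp, hrl, Function.update_self]
    exact h₂
  · intro idx hidx
    simp only [State.vec, State.arr_setArr, reduceCtorEq, if_false, hrp, hrl,
      Function.update_of_ne hidx]
    exact h₃ idx hidx _
  · refine ⟨h₄.alloc, h₄.key, ?_, h₄.before, h₄.after, h₄.last, fun u hu => ?_, fun u hu => ?_,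
      fun u hu => ?_, fun y₁ e he => ?_⟩
    · simpa using h₄.elem
    · have := h₄.old_key u hu
      simp only [State.arr_setReg, State.arr_setArr, reduceCtorEq, if_false] at this ⊢
      rw [this, hF.arr _ rfl]
      rfl
    · have := h₄.old_before u hu
      simp only [State.arr_setReg, State.arr_setArr, reduceCtorEq, if_false] at this ⊢
      rw [this, hF.arr _ rfl]
      rfl
    · have := h₄.old_after u hu
      simp only [State.arr_setReg, State.arr_setArr, reduceCtorEq, if_false] at this ⊢
      rw [this, hF.arr _ rfl]
      rfl
    · have := h₄.old_elem y₁ e (by simpa using he)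
      simp only [State.arr_setReg, State.arr_setArr, reduceCtorEq, if_false] at this ⊢
      rw [this, hF.arr _ rfl]
      rfl
  · simp only [State.arr_setArr, if_true, State.reg_setArr]
    rw [hF'.arr _ rfl]
    simp only [State.arr_setReg, State.arr_setArr, reduceCtorEq, if_false]
    rw [hF.arr _ rfl]
    rfl
  · have : t ≤ 2 + (σ.vec (.prev s) (.prevLen s) [r₀, y₀]).length * 7 := ht
    omega

/-- The elements of a complete chain are numbered in the order of the sorted vector Next, so that
ascending numbers mean ascending degrees. -/
theorem Chain.rcBuilt {D : Data} {s : Side} {σ τ : State} {r y x' a a₀ : ℕ} {l : List ℕ}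
    (h : Chain s σ r y x' a (D.keep s.opp y l) τ) (hl : D.NextSorted s.opp r x' l) (ha : a₀ ≤ a)
    (hP : τ.vec (.rcPrev s) (.rcPrevLen s) [r, y, x'] =
      D.keep s x' (τ.vec (.prev s) (.prevLen s) [r, y]))
    (hlast : τ.arr (.rcNextLast s.opp) [r, x', y] = τ.reg .before) :
    D.RcBuilt s a₀ r y x' τ ∧ ∀ y', D.InitAlive s r y x' y' → a < τ.node s r y x' y' := by
  have hmem : ∀ y', D.InitAlive s r y x' y' ↔ y' ∈ D.keep s.opp y l := by
    intro y'
    rw [mem_keep, hl.mem, mkPair_opp]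
    rfl
  have hnode : ∀ y', D.InitAlive s r y x' y' → ∃ j, ∃ h : j < (D.keep s.opp y l).length,
      (D.keep s.opp y l)[j] = y' ∧ τ.node s r y x' y' = a + 1 + j := by
    intro y' hy'
    obtain ⟨j, hj, rfl⟩ := List.getElem_of_mem ((hmem y').1 hy')
    exact ⟨j, hj, rfl, h.elem j hj⟩
  have hset : {u | ∃ y', D.InitAlive s r y x' y' ∧ u = τ.node s r y x' y'} =
      {u | a < u ∧ u ≤ a + (D.keep s.opp y l).length} := by
    ext u
    constructor
    · rintro ⟨y', hy', rfl⟩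
      obtain ⟨j, hj, -, h'⟩ := hnode y' hy'
      rw [h']
      exact ⟨by omega, by omega⟩
    · rintro ⟨h₁, h₂⟩
      have hj : u - (a + 1) < (D.keep s.opp y l).length := by omega
      refine ⟨(D.keep s.opp y l)[u - (a + 1)], (hmem _).2 (List.getElem_mem _), ?_⟩
      have := h.elem _ hj
      rw [State.node, this]
      omega
  have hsort : (D.keep s.opp y l).Pairwise fun y z => D.W s.opp x' r y ≤ D.W s.opp x' r z :=
    hl.sorted.filter _
  refine ⟨⟨hP, ?_, ?_, ?_, ?_, ?_⟩, ?_⟩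
  · intro y' hy'
    obtain ⟨j, hj, -, h'⟩ := hnode y' hy'
    omega
  · intro y' hy'
    obtain ⟨j, hj, -, h'⟩ := hnode y' hy'
    rw [h', h.alloc]
    omega
  · intro y' hy'
    obtain ⟨j, hj, h'', h'⟩ := hnode y' hy'
    rw [h', h.key j hj, h'']
  · intro y₁ y₂ h₁ h₂ hle
    obtain ⟨j₁, hj₁, rfl, h'⟩ := hnode y₁ h₁
    obtain ⟨j₂, hj₂, rfl, h''⟩ := hnode y₂ h₂
    rw [h', h''] at hle
    rcases (show j₁ ≤ j₂ by omega).lt_or_eq with hlt | rfl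
    · exact List.pairwise_iff_getElem.1 hsort j₁ j₂ hj₁ hj₂ hlt
    · exact le_rfl
  · rw [hset, hlast, h.last]
    exact IsLinked.of_consecutive h.before h.after
  · intro y' hy'
    obtain ⟨j, hj, -, h'⟩ := hnode y' hy'
    omega

/-- The construction for a triple does not affect the other triples. -/
theorem RcBuilt.of_chain {D : Data} {s : Side} {σ τ : State} {r y x' a₀ r₁ y₁ x₁ : ℕ} {l : List ℕ}
    (hb : D.RcBuilt s a₀ r₁ y₁ x₁ σ)
    (hnode : ∀ y', D.InitAlive s r₁ y₁ x₁ y' → τ.node s r₁ y₁ x₁ y' = σ.node s r₁ y₁ x₁ y')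
    (h : Chain s σ r y x' (σ.reg .alloc) l τ)
    (hP : τ.vec (.rcPrev s) (.rcPrevLen s) [r₁, y₁, x₁] =
      σ.vec (.rcPrev s) (.rcPrevLen s) [r₁, y₁, x₁])
    (hP' : τ.vec (.prev s) (.prevLen s) = σ.vec (.prev s) (.prevLen s))
    (hlast : τ.arr (.rcNextLast s.opp) [r₁, x₁, y₁] = σ.arr (.rcNextLast s.opp) [r₁, x₁, y₁]) :
    D.RcBuilt s a₀ r₁ y₁ x₁ τ := by
  constructor
  · rw [hP, hP', hb.rcPrev]
  · intro y' hy'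
    rw [hnode y' hy']
    exact hb.lt_node y' hy'
  · intro y' hy'
    rw [hnode y' hy', h.alloc]
    exact (hb.node_le y' hy').trans (Nat.le_add_right _ _)
  · intro y' hy'
    rw [hnode y' hy', h.old_key _ (hb.node_le y' hy')]
    exact hb.key y' hy'
  · intro z₁ z₂ h₁ h₂
    rw [hnode _ h₁, hnode _ h₂]
    exact hb.mono z₁ z₂ h₁ h₂
  · have hset : {u | ∃ y', D.InitAlive s r₁ y₁ x₁ y' ∧ u = τ.node s r₁ y₁ x₁ y'} =
        {u | ∃ y', D.InitAlive s r₁ y₁ x₁ y' ∧ u = σ.node s r₁ y₁ x₁ y'} := by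
      ext u
      exact exists_congr fun y' => and_congr_right fun hy' => by rw [hnode y' hy']
    rw [hset, hlast]
    refine hb.linked.congr ?_ ?_
    · rintro u ⟨y', hy', rfl⟩
      exact h.old_before _ (hb.node_le y' hy')
    · rintro u ⟨y', hy', rfl⟩
      exact h.old_after _ (hb.node_le y' hy')

/-- A bound for the time of `buildRc`. -/
def rcTime (D : Data) (s : Side) : ℕ :=
  2 + 4 * D.nR + 4 * (D.nR * D.nV s) + (D.nR * (D.nV s * (D.nV s.opp * 12)) +
    7 * (D.nV s.opp * D.m s) + 16 * (D.nV s * D.m s.opp))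

/-- Lists for different triples have no element in common, since the elements of each list are greater
than all those that were allocated before; in particular, older elements are not affected. -/
theorem wp_buildRc (D : Data) (s : Side) {σ : State} (hσ : D.Sizes σ) (hZ : D.ZInit σ)
    (hG : D.GraphReady s σ) (hG' : D.GraphReady s.opp σ) :
    Wp (buildRc s) σ fun τ t =>
      (∀ r < D.nR, ∀ y < D.nV s, ∀ x' < D.nV s.opp, D.RcBuilt s (σ.reg .alloc) r y x' τ) ∧
      (∀ r₁ < D.nR, ∀ y₁ < D.nV s, ∀ x₁ < D.nV s.opp, ∀ r₂ < D.nR, ∀ y₂ < D.nV s,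
        ∀ x₂ < D.nV s.opp, ∀ z₁ z₂, D.InitAlive s r₁ y₁ x₁ z₁ → D.InitAlive s r₂ y₂ x₂ z₂ →
        τ.node s r₁ y₁ x₁ z₁ = τ.node s r₂ y₂ x₂ z₂ → r₁ = r₂ ∧ y₁ = y₂ ∧ x₁ = x₂) ∧
      (∀ u ≤ σ.reg .alloc, τ.arr .elemKey [u] = σ.arr .elemKey [u] ∧
        τ.arr .elemBefore [u] = σ.arr .elemBefore [u] ∧
        τ.arr .elemAfter [u] = σ.arr .elemAfter [u]) ∧
      σ.reg .alloc ≤ τ.reg .alloc ∧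
      t ≤ D.rcTime s := by
  refine Wp.mono (wp_for₃ D.nR (D.nV s) (D.nV s.opp) (fun S τ =>
      (∀ r y x', (r, y, x') ∈ S → D.RcBuilt s (σ.reg .alloc) r y x' τ) ∧
      (∀ r₁ y₁ x₁ r₂ y₂ x₂, (r₁, y₁, x₁) ∈ S → (r₂, y₂, x₂) ∈ S → ∀ z₁ z₂,
        D.InitAlive s r₁ y₁ x₁ z₁ → D.InitAlive s r₂ y₂ x₂ z₂ →
        τ.node s r₁ y₁ x₁ z₁ = τ.node s r₂ y₂ x₂ z₂ → r₁ = r₂ ∧ y₁ = y₂ ∧ x₁ = x₂) ∧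
      (∀ u ≤ σ.reg .alloc, τ.arr .elemKey [u] = σ.arr .elemKey [u] ∧
        τ.arr .elemBefore [u] = σ.arr .elemBefore [u] ∧
        τ.arr .elemAfter [u] = σ.arr .elemAfter [u]) ∧
      σ.reg .alloc ≤ τ.reg .alloc) (fun _ => 0)
    (fun r y x' => 10 + 7 * (D.prevList s r y (D.m s)).length +
      16 * (D.nextList s.opp r x' (D.m s.opp)).length)
    hσ.numR (hσ.numV s) (hσ.numV s.opp) rfl rfl (by cases s <;> rfl) rfl rfl rfl ?_ (by simp) ?_) ?_
  · rintro S τ x k ⟨h₁, h₂, h₃, h₄⟩ hx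
    have hal : (τ.setReg x k).reg .alloc = τ.reg .alloc := by
      rcases hx with rfl | rfl | rfl <;> simp
    refine ⟨fun r y x' h => ?_, h₂, h₃, hal.symm ▸ h₄⟩
    have := h₁ r y x' h
    exact ⟨this.rcPrev, this.lt_node, fun y' hy' => by rw [hal]; exact this.node_le y' hy',
      this.key, this.mono, this.linked⟩
  · rintro S r hr y hy x' hx' hS τ ⟨h₁, h₂, h₃, h₄⟩ hrr hyr hxr hF
    have hZ' : D.ZInit τ := by
      intro x hx x' hx'
      rw [hF.arr _ rfl]
      exact hZ x hx x' hx'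
    have hGτ : D.GraphReady s τ := hG.congr (hF.warr _ rfl) (hF.arr _ rfl) (hF.arr _ rfl)
      (hF.arr _ rfl) (hF.arr _ rfl) (hF.arr _ rfl)
    have hGτ' : D.GraphReady s.opp τ := hG'.congr (hF.warr _ rfl) (hF.arr _ rfl) (hF.arr _ rfl)
      (hF.arr _ rfl) (hF.arr _ rfl) (hF.arr _ rfl)
    refine Wp.mono (Wp.frame (D.wp_buildRc_body s hZ' hGτ hGτ' hrr hyr hxr hr hy hx')) ?_
    rintro ρ t ⟨⟨h₅, h₆, h₇, h₈, h₉⟩, hF'⟩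
    have hPv : ρ.vec (.prev s) (.prevLen s) = τ.vec (.prev s) (.prevLen s) :=
      State.vec_congr (hF'.arr _ rfl) (hF'.arr _ rfl)
    have hid : ρ.arr (.edgeID s.opp) = τ.arr (.edgeID s.opp) := hF'.arr _ rfl
    have hN := hGτ'.next r hr x' hx'
    obtain ⟨hnew, hnew'⟩ := h₇.rcBuilt hN h₄ (by rw [h₅, hPv])
      (by rw [h₈, Function.update_self])
    have hnode : ∀ r₁ y₁ x₁, (r₁, y₁, x₁) ∈ S → ∀ z, D.InitAlive s r₁ y₁ x₁ z →
        ρ.node s r₁ y₁ x₁ z = τ.node s r₁ y₁ x₁ z := by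
      intro r₁ y₁ x₁ hS₁ z hz
      rw [State.node, State.node, hid]
      refine h₇.old_elem _ _ fun z' hz' h => hS ?_
      obtain ⟨rfl, h⟩ := h
      rw [hid] at h
      obtain ⟨rfl, rfl, -⟩ := hGτ'.edgeID_inj hz.1 ((hN.mem z').1 (mem_keep.1 hz').1) h
      exact hS₁
    refine ⟨⟨?_, ?_, ?_, ?_⟩, ?_⟩
    · intro r₁ y₁ x₁ hS₁
      by_cases he : (r₁, y₁, x₁) = (r, y, x')
      · simp only [Prod.mk.injEq] at he
        obtain ⟨rfl, rfl, rfl⟩ := he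
        exact hnew
      · have hS₁ := hS₁.resolve_left he
        refine (h₁ _ _ _ hS₁).of_chain (hnode _ _ _ hS₁) h₇ (h₆ _ (by simpa using he)) hPv ?_
        rw [h₈, Function.update_of_ne]
        simp only [Prod.mk.injEq] at he
        simp only [ne_eq, List.cons.injEq, and_true]
        tauto
    · intro r₁ y₁ x₁ r₂ y₂ x₂ hS₁ hS₂ z₁ z₂ hz₁ hz₂ he
      simp only [Set.mem_insert_iff, Prod.mk.injEq] at hS₁ hS₂
      rcases hS₁ with ⟨rfl, rfl, rfl⟩ | hS₁ <;> rcases hS₂ with ⟨rfl, rfl, rfl⟩ | hS₂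
      · exact ⟨rfl, rfl, rfl⟩
      · rw [hnode _ _ _ hS₂ _ hz₂] at he
        exact absurd (he ▸ hnew' _ hz₁) (not_lt.2 ((h₁ _ _ _ hS₂).node_le _ hz₂))
      · rw [hnode _ _ _ hS₁ _ hz₁] at he
        exact absurd (he ▸ hnew' _ hz₂) (not_lt.2 ((h₁ _ _ _ hS₁).node_le _ hz₁))
      · rw [hnode _ _ _ hS₁ _ hz₁, hnode _ _ _ hS₂ _ hz₂] at he
        exact h₂ _ _ _ _ _ _ hS₁ hS₂ _ _ hz₁ hz₂ he
    · intro u hu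
      rw [h₇.old_key u (hu.trans h₄), h₇.old_before u (hu.trans h₄), h₇.old_after u (hu.trans h₄)]
      exact h₃ u hu
    · rw [h₇.alloc]
      omega
    · rw [(hGτ.prev r hr y hy).length, hN.length] at h₉
      simpa using h₉
  · rintro τ t ⟨⟨h₁, h₂, h₃, h₄⟩, h₅⟩
    refine ⟨fun r hr y hy x' hx' => h₁ r y x' ⟨hr, hy, hx'⟩, fun r₁ hr₁ y₁ hy₁ x₁ hx₁ r₂ hr₂ y₂ hy₂
      x₂ hx₂ => h₂ _ _ _ _ _ _ ⟨hr₁, hy₁, hx₁⟩ ⟨hr₂, hy₂, hx₂⟩, h₃, h₄, ?_⟩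
    simp only [Nat.add_zero, Nat.zero_add] at h₅
    refine h₅.trans (le_of_eq ?_)
    rw [rcTime]
    congr 1
    simp only [Finset.sum_add_distrib, ← Finset.mul_sum, Finset.sum_const, Finset.card_range,
      smul_eq_mul, sum_length_prevList, sum_length_nextList]
    ring

end Data

/-! ### The invariant of the main loop -/

/-- The pair at position `i` of the queue. -/
def State.qpair (σ : State) (i : ℕ) : ℕ × ℕ :=
  (σ.arr (.queue .left) [i], σ.arr (.queue .right) [i])

/-- The queue of `τ` extends the queue of `σ`. -/
def QueueLE (σ τ : State) : Prop :=
  σ.reg .tail ≤ τ.reg .tail ∧ ∀ i < σ.reg .tail, τ.qpair i = σ.qpair i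

theorem QueueLE.refl (σ : State) : QueueLE σ σ := ⟨le_rfl, fun _ _ => rfl⟩

theorem QueueLE.trans {σ τ ρ : State} (h : QueueLE σ τ) (h' : QueueLE τ ρ) : QueueLE σ ρ :=
  ⟨h.1.trans h'.1, fun i hi => (h'.2 i (hi.trans_le h.1)).trans (h.2 i hi)⟩

namespace Data

/-- The relation that is stored in the array `Z`. -/
def zset (D : Data) (σ : State) : Set (ℕ × ℕ) :=
  {p | p.1 < D.nV .left ∧ p.2 < D.nV .right ∧ σ.arr .Z [p.1, p.2] = 1}

theorem mem_zset {D : Data} {σ : State} {s : Side} {x y : ℕ} (hx : x < D.nV s)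
    (hy : y < D.nV s.opp) : mkPair s x y ∈ D.zset σ ↔
      σ.arr .Z [(mkPair s x y).1, (mkPair s x y).2] = 1 := by
  cases s
  · exact ⟨fun h => h.2.2, fun h => ⟨hx, hy, h⟩⟩
  · exact ⟨fun h => h.2.2, fun h => ⟨hy, hx, h⟩⟩

/-- Directed simulations between the graphs of `D`. -/
def IsSim (D : Data) (Y : Set (ℕ × ℕ)) : Prop :=
  Y ⊆ D.labelPairs ∧ ∀ s x x' r y, mkPair s x x' ∈ Y → 0 < D.W s x r y →
    ∃ y', mkPair s y y' ∈ Y ∧ D.W s x r y ≤ D.W s.opp x' r y'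

/-- What is needed about the numbers `N s r y x' y'` of the list elements: they are different from
the null reference and from each other, and in each list they are ordered by the degrees. -/
structure Nodes (D : Data) (N : Side → ℕ → ℕ → ℕ → ℕ → ℕ) : Prop where
  ne_zero : ∀ {s r y x' y'}, D.InitAlive s r y x' y' → N s r y x' y' ≠ 0
  inj : ∀ {s r y x' y' s₁ r₁ y₁ x₁ z₁}, D.InitAlive s r y x' y' → D.InitAlive s₁ r₁ y₁ x₁ z₁ →
    N s r y x' y' = N s₁ r₁ y₁ x₁ z₁ → s = s₁ ∧ r = r₁ ∧ y = y₁ ∧ x' = x₁ ∧ y' = z₁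
  mono : ∀ {s r y x' y₁ y₂}, D.InitAlive s r y x' y₁ → D.InitAlive s r y x' y₂ →
    N s r y x' y₁ ≤ N s r y x' y₂ → D.W s.opp x' r y₁ ≤ D.W s.opp x' r y₂

/-- The set of the elements of the list with index `[r, x', y]` that have not been deleted. -/
def members (N : Side → ℕ → ℕ → ℕ → ℕ → ℕ) (Al : Set (Side × ℕ × ℕ × ℕ × ℕ)) (s : Side)
    (r y x' : ℕ) : Set ℕ :=
  {u | ∃ y', (s, r, y, x', y') ∈ Al ∧ u = N s r y x' y'}

/-- The invariant of the main part of the algorithm. The set `Al` contains `(s, r, y, x', y')` if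
`y'` still belongs to the list with index `[r, x', y]`, where `y` is a vertex of side `s`, and
`N s r y x' y'` is the number of the corresponding list element. The triples `(s, r, y, x')` in `St`
are those for which the deletions from `rcPrev[r, y, x']` are up to date. Entries are deleted from
the end of a vector `rcPrev`, and only when their pairs have been removed (`rcPrev`). The list
elements of the pairs in `Z` have not been deleted (`alive_of_mem`), `Z` contains all directed
simulations (`sound`), and the queue, including the pairs that have been extracted from it, lists
the removed pairs without repetitions (`queue_mem`, `queue_inj`, `queue_surj`). -/
structure Core (D : Data) (N : Side → ℕ → ℕ → ℕ → ℕ → ℕ) (Al : Set (Side × ℕ × ℕ × ℕ × ℕ))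
    (St : Set (Side × ℕ × ℕ × ℕ)) (σ : State) : Prop where
  graph : ∀ s, D.GraphReady s σ
  alive : ∀ {s r y x' y'}, (s, r, y, x', y') ∈ Al → D.InitAlive s r y x' y'
  node : ∀ {s r y x' y'}, (s, r, y, x', y') ∈ Al → σ.node s r y x' y' = N s r y x' y'
  key : ∀ {s r y x' y'}, (s, r, y, x', y') ∈ Al → σ.arr .elemKey [N s r y x' y'] = y'
  linked : ∀ {s r y x'}, r < D.nR → y < D.nV s → x' < D.nV s.opp →
    IsLinked (members N Al s r y x') (fun u => σ.arr .elemBefore [u])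
      (fun u => σ.arr .elemAfter [u]) (σ.arr (.rcNextLast s.opp) [r, x', y])
  rcPrev : ∀ {s r y x'}, r < D.nR → y < D.nV s → x' < D.nV s.opp →
    ∃ dead, σ.vec (.rcPrev s) (.rcPrevLen s) [r, y, x'] ++ dead =
      D.keep s x' (σ.vec (.prev s) (.prevLen s) [r, y]) ∧ ∀ x ∈ dead, mkPair s x x' ∉ D.zset σ
  settled : ∀ {s r y x'}, (s, r, y, x') ∈ St →
    ∀ x ∈ σ.vec (.rcPrev s) (.rcPrevLen s) [r, y, x'],
      ∃ y', (s, r, y, x', y') ∈ Al ∧ D.W s x r y ≤ D.W s.opp x' r y'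
  zset_sub : D.zset σ ⊆ D.labelPairs
  alive_of_mem : ∀ {s r y x' y'}, mkPair s y y' ∈ D.zset σ → 0 < D.W s.opp x' r y' →
    (s, r, y, x', y') ∈ Al
  sound : ∀ Y, D.IsSim Y → Y ⊆ D.zset σ
  queue_mem : ∀ i < σ.reg .tail, σ.qpair i ∈ D.labelPairs ∧ σ.qpair i ∉ D.zset σ
  queue_inj : ∀ i < σ.reg .tail, ∀ j < σ.reg .tail, σ.qpair i = σ.qpair j → i = j
  queue_surj : ∀ p ∈ D.labelPairs, p ∉ D.zset σ → ∃ i < σ.reg .tail, σ.qpair i = p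

variable {D : Data} {N : Side → ℕ → ℕ → ℕ → ℕ → ℕ} {Al : Set (Side × ℕ × ℕ × ℕ × ℕ)}
  {St : Set (Side × ℕ × ℕ × ℕ)} {σ τ : State}

theorem Core.congr (h : D.Core N Al St σ) (ha : τ.arr = σ.arr) (hw : τ.warr = σ.warr)
    (ht : τ.reg .tail = σ.reg .tail) : D.Core N Al St τ := by
  obtain ⟨reg, wreg, arr, warr⟩ := σ
  obtain ⟨reg', wreg', arr', warr'⟩ := τ
  obtain rfl : arr' = arr := ha
  obtain rfl : warr' = warr := hw
  have ht : reg' .tail = reg .tail := ht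
  exact ⟨fun s => (h.graph s).congr rfl rfl rfl rfl rfl rfl, h.alive, h.node, h.key, h.linked,
    h.rcPrev, h.settled, h.zset_sub, h.alive_of_mem, h.sound,
    fun i hi => h.queue_mem i (hi.trans_eq ht),
    fun i hi j hj => h.queue_inj i (hi.trans_eq ht) j (hj.trans_eq ht),
    fun p hp hp' => (h.queue_surj p hp hp').imp fun i hi => ⟨hi.1.trans_eq ht.symm, hi.2⟩⟩

theorem qpair_update {s : Side} {x x' i k : ℕ}
    (hq : τ.arr (.queue s) = Function.update (σ.arr (.queue s)) [k] x)
    (hq' : τ.arr (.queue s.opp) = Function.update (σ.arr (.queue s.opp)) [k] x') :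
    τ.qpair i = if i = k then mkPair s x x' else σ.qpair i := by
  cases s <;> simp only [Side.opp] at hq hq' <;>
    simp only [State.qpair, hq, hq', Function.update_apply, List.cons.injEq, and_true] <;>
    split_ifs <;> rfl

/-- A pair that belongs to no simulation contained in the current relation is removed from the
relation and put into the queue. -/
theorem Core.kill (h : D.Core N Al St σ) {s : Side} {r x y x' : ℕ}
    (hmem : mkPair s x x' ∈ D.zset σ) (hpos : 0 < D.W s x r y)
    (hlt : ∀ y', (s, r, y, x', y') ∈ Al → ¬ D.W s x r y ≤ D.W s.opp x' r y')
    (hZ : τ.arr .Z = Function.update (σ.arr .Z) [(mkPair s x x').1, (mkPair s x x').2] 0)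
    (hq : τ.arr (.queue s) = Function.update (σ.arr (.queue s)) [σ.reg .tail] x)
    (hq' : τ.arr (.queue s.opp) = Function.update (σ.arr (.queue s.opp)) [σ.reg .tail] x')
    (ho : ∀ a, a ≠ .Z → (∀ s, a ≠ .queue s) → τ.arr a = σ.arr a) (hw : τ.warr = σ.warr)
    (ht : τ.reg .tail = σ.reg .tail + 1) : D.Core N Al St τ ∧ QueueLE σ τ := by
  have hz : D.zset τ = D.zset σ \ {mkPair s x x'} := by
    ext p
    simp only [zset, Set.mem_ofPred_eq, Set.mem_sdiff, Set.mem_singleton_iff, hZ,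
      Function.update_apply, List.cons.injEq, and_true, Prod.ext_iff]
    split_ifs with hp
    · simp [hp]
    · tauto
  have hqp : ∀ i, τ.qpair i = if i = σ.reg .tail then mkPair s x x' else σ.qpair i :=
    fun i => qpair_update hq hq'
  have hqp' : ∀ i < σ.reg .tail, τ.qpair i = σ.qpair i := fun i hi => by
    rw [hqp, if_neg hi.ne]
  have hsub : D.zset τ ⊆ D.zset σ := hz ▸ Set.sdiff_subset
  have hvec : ∀ s, τ.vec (.rcPrev s) (.rcPrevLen s) = σ.vec (.rcPrev s) (.rcPrevLen s) := fun s =>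
    State.vec_congr (ho _ (by simp) (by simp)) (ho _ (by simp) (by simp))
  have hvec' : ∀ s, τ.vec (.prev s) (.prevLen s) = σ.vec (.prev s) (.prevLen s) := fun s =>
    State.vec_congr (ho _ (by simp) (by simp)) (ho _ (by simp) (by simp))
  refine ⟨⟨fun s => (h.graph s).congr (by rw [hw]) (ho _ (by simp) (by simp))
    (ho _ (by simp) (by simp)) (ho _ (by simp) (by simp)) (ho _ (by simp) (by simp))
    (ho _ (by simp) (by simp)), h.alive, ?_, ?_, ?_, ?_, ?_, hsub.trans h.zset_sub,
    fun hm => h.alive_of_mem (hsub hm), ?_, ?_, ?_, ?_⟩, by omega, hqp'⟩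
  · intro s r y x' y' hA
    rw [State.node, ho (.rcNextElem s.opp) (by simp) (by simp), ho (.edgeID s.opp) (by simp)
      (by simp)]
    exact h.node hA
  · intro s r y x' y' hA
    rw [ho _ (by simp) (by simp)]
    exact h.key hA
  · intro s r y x' hr hy hx'
    rw [ho .elemBefore (by simp) (by simp), ho .elemAfter (by simp) (by simp),
      ho (.rcNextLast s.opp) (by simp) (by simp)]
    exact h.linked hr hy hx'
  · intro s r y x' hr hy hx'
    rw [hvec, hvec']
    obtain ⟨dead, h₁, h₂⟩ := h.rcPrev hr hy hx'
    exact ⟨dead, h₁, fun x hx hm => h₂ x hx (hsub hm)⟩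
  · intro s r y x' hS
    rw [hvec]
    exact h.settled hS
  · intro Y hY p hp
    rw [hz]
    refine ⟨h.sound Y hY hp, ?_⟩
    -- a partner of `y` in the simulation would still be in the list
    rintro rfl
    obtain ⟨y', hy', hle⟩ := hY.2 s x x' r y hp hpos
    exact hlt y' (h.alive_of_mem (h.sound Y hY hy') (hpos.trans_le hle)) hle
  · intro i hi
    rw [ht] at hi
    rw [hqp, hz]
    split_ifs with h'
    · exact ⟨h.zset_sub hmem, fun h => h.2 rfl⟩
    · have := h.queue_mem i (by omega)
      exact ⟨this.1, fun h => this.2 h.1⟩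
  · have hnew : ∀ i < σ.reg .tail, σ.qpair i ≠ mkPair s x x' := fun i hi he =>
      (h.queue_mem i hi).2 (he ▸ hmem)
    intro i hi j hj he
    rw [ht] at hi hj
    rw [hqp, hqp] at he
    split_ifs at he with h₁ h₂ h₂
    · omega
    · exact absurd he.symm (hnew j (by omega))
    · exact absurd he (hnew i (by omega))
    · exact h.queue_inj i (by omega) j (by omega) he
  · intro p hp hp'
    by_cases he : p = mkPair s x x'
    · exact ⟨σ.reg .tail, by omega, by rw [hqp, if_pos rfl, he]⟩
    · obtain ⟨i, hi, hi'⟩ := h.queue_surj p hp fun h => hp' (hz ▸ ⟨h, he⟩)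
      exact ⟨i, by omega, by rw [hqp' i hi, hi']⟩

/-- The last entry of `rcPrev[r, y, x']` may be deleted if it is not related to `x'`. -/
theorem Core.pop (h : D.Core N Al St σ) {s : Side} {r x y x' : ℕ} {l : List ℕ}
    (hl : σ.vec (.rcPrev s) (.rcPrevLen s) [r, y, x'] = l ++ [x])
    (hmem : mkPair s x x' ∉ D.zset σ)
    (hlen : τ.arr (.rcPrevLen s) = Function.update (σ.arr (.rcPrevLen s)) [r, y, x'] l.length)
    (ho : ∀ a, a ≠ .rcPrevLen s → τ.arr a = σ.arr a) (hw : τ.warr = σ.warr)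
    (ht : τ.reg .tail = σ.reg .tail) :
    D.Core N Al St τ ∧ τ.vec (.rcPrev s) (.rcPrevLen s) [r, y, x'] = l := by
  have hz : D.zset τ = D.zset σ := by
    simp [zset, ho .Z (by simp)]
  have hqp : ∀ i, τ.qpair i = σ.qpair i := fun i => by simp [State.qpair, ho]
  have hvec' : ∀ s, τ.vec (.prev s) (.prevLen s) = σ.vec (.prev s) (.prevLen s) := fun s =>
    State.vec_congr (ho _ (by simp)) (ho _ (by simp))
  have hvec₁ : τ.vec (.rcPrev s) (.rcPrevLen s) [r, y, x'] = l := by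
    have hlen' : σ.arr (.rcPrevLen s) [r, y, x'] = l.length + 1 := by
      rw [← σ.length_vec (.rcPrev s), hl]
      simp
    rw [State.vec, hlen, ho _ (by simp), Function.update_self]
    rw [State.vec, hlen', row_succ] at hl
    exact (List.append_inj' hl rfl).1
  have hvec₂ : ∀ s₁ r₁ y₁ x₁, (s₁, r₁, y₁, x₁) ≠ (s, r, y, x') →
      τ.vec (.rcPrev s₁) (.rcPrevLen s₁) [r₁, y₁, x₁] =
        σ.vec (.rcPrev s₁) (.rcPrevLen s₁) [r₁, y₁, x₁] := by
    intro s₁ r₁ y₁ x₁ hne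
    by_cases hs : s₁ = s
    · subst hs
      have : [r₁, y₁, x₁] ≠ [r, y, x'] := by simpa using hne
      simp only [State.vec, hlen, ho (.rcPrev s₁) (by simp), Function.update_of_ne this]
    · rw [State.vec_congr (ho _ (by simp)) (ho _ (by simpa using hs))]
  refine ⟨⟨fun s => (h.graph s).congr (by rw [hw]) (ho _ (by simp)) (ho _ (by simp))
    (ho _ (by simp)) (ho _ (by simp)) (ho _ (by simp)), h.alive, ?_, ?_, ?_, ?_, ?_, ?_, ?_, ?_, ?_,
    ?_, ?_⟩, hvec₁⟩
  · intro s r y x' y' hA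
    rw [State.node, ho (.rcNextElem s.opp) (by simp), ho (.edgeID s.opp) (by simp)]
    exact h.node hA
  · intro s r y x' y' hA
    rw [ho _ (by simp)]
    exact h.key hA
  · intro s r y x' hr hy hx'
    rw [ho .elemBefore (by simp), ho .elemAfter (by simp), ho (.rcNextLast s.opp) (by simp)]
    exact h.linked hr hy hx'
  · intro s₁ r₁ y₁ x₁ hr hy hx'
    rw [hvec', hz]
    obtain ⟨dead, h₁, h₂⟩ := h.rcPrev hr hy hx'
    by_cases he : (s₁, r₁, y₁, x₁) = (s, r, y, x')
    · simp only [Prod.mk.injEq] at he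
      obtain ⟨rfl, rfl, rfl, rfl⟩ := he
      refine ⟨x :: dead, by rw [hvec₁, ← h₁, hl]; simp, ?_⟩
      intro z hz
      rcases List.mem_cons.1 hz with rfl | hz
      · exact hmem
      · exact h₂ z hz
    · rw [hvec₂ _ _ _ _ he]
      exact ⟨dead, h₁, h₂⟩
  · intro s₁ r₁ y₁ x₁ hS z hz
    refine h.settled hS z ?_
    by_cases he : (s₁, r₁, y₁, x₁) = (s, r, y, x')
    · simp only [Prod.mk.injEq] at he
      obtain ⟨rfl, rfl, rfl, rfl⟩ := he
      rw [hvec₁] at hz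
      rw [hl]
      exact List.mem_append_left _ hz
    · rwa [hvec₂ _ _ _ _ he] at hz
  · rw [hz]; exact h.zset_sub
  · intro s r y x' y' hm
    rw [hz] at hm
    exact h.alive_of_mem hm
  · rw [hz]; exact h.sound
  · simp only [hz, ht, hqp]; exact h.queue_mem
  · simp only [ht, hqp]; exact h.queue_inj
  · simp only [hz, ht, hqp]; exact h.queue_surj

/-- Deletion of `y'` from the list with index `[r, x', y]`, for a pair of vertices `y` and `y'` that
is not related any more. -/
theorem Core.delete (hN : D.Nodes N) (h : D.Core N Al St σ) {s : Side} {r y x' y' u b a : ℕ}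
    (hA : (s, r, y, x', y') ∈ Al) (hmem : mkPair s y y' ∉ D.zset σ)
    (hu : σ.node s r y x' y' = u) (hb : σ.arr .elemBefore [u] = b) (ha : σ.arr .elemAfter [u] = a)
    (hB : τ.arr .elemBefore = if a = 0 then σ.arr .elemBefore else
      Function.update (σ.arr .elemBefore) [a] b)
    (hAf : τ.arr .elemAfter = if b = 0 then σ.arr .elemAfter else
      Function.update (σ.arr .elemAfter) [b] a)
    (hL : τ.arr (.rcNextLast s.opp) = if a = 0 then
      Function.update (σ.arr (.rcNextLast s.opp)) [r, x', y] b else σ.arr (.rcNextLast s.opp))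
    (hE : τ.arr (.rcNextElem s.opp) = Function.update (σ.arr (.rcNextElem s.opp))
      [y, σ.arr (.edgeID s.opp) [x', r, y']] 0)
    (ho : ∀ a, a ≠ .elemBefore → a ≠ .elemAfter → a ≠ .rcNextLast s.opp → a ≠ .rcNextElem s.opp →
      τ.arr a = σ.arr a) (hw : τ.warr = σ.warr) (ht : τ.reg .tail = σ.reg .tail) :
    D.Core N (Al \ {(s, r, y, x', y')}) (St \ {(s, r, y, x')}) τ := by
  have hI := h.alive hA
  have hlt := lt_of_mem_labelPairs hI.2
  have hlt' := lt_of_pos hI.1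
  have hz : D.zset τ = D.zset σ := by
    simp [zset, ho .Z]
  have hqp : ∀ i, τ.qpair i = σ.qpair i := fun i => by simp [State.qpair, ho]
  have hvec : ∀ s, τ.vec (.rcPrev s) (.rcPrevLen s) = σ.vec (.rcPrev s) (.rcPrevLen s) := fun s =>
    State.vec_congr (ho _ (by simp) (by simp) (by simp) (by simp))
      (ho _ (by simp) (by simp) (by simp) (by simp))
  have hvec' : ∀ s, τ.vec (.prev s) (.prevLen s) = σ.vec (.prev s) (.prevLen s) := fun s =>
    State.vec_congr (ho _ (by simp) (by simp) (by simp) (by simp))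
      (ho _ (by simp) (by simp) (by simp) (by simp))
  have hid : ∀ s, τ.arr (.edgeID s) = σ.arr (.edgeID s) := fun s => ho _ (by simp) (by simp)
    (by simp) (by simp)
  have huN : N s r y x' y' = u := by rw [← h.node hA, hu]
  have hlink := h.linked hlt'.2.1 hlt.1 hlt'.1
  have huM : u ∈ members N Al s r y x' := ⟨y', hA, huN.symm⟩
  have hbM := hlink.before_mem u huM
  have haM := hlink.after_spec u huM
  rw [hb] at hbM
  rw [ha] at haM
  refine ⟨fun s => (h.graph s).congr (by rw [hw]) (hid s)
    (ho _ (by simp) (by simp) (by simp) (by simp)) (ho _ (by simp) (by simp) (by simp) (by simp))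
    (ho _ (by simp) (by simp) (by simp) (by simp)) (ho _ (by simp) (by simp) (by simp) (by simp)),
    fun hA => h.alive hA.1, ?_, ?_, ?_, ?_, ?_, ?_, ?_, ?_, ?_, ?_, ?_⟩
  · rintro s₁ r₁ y₁ x₁ z₁ ⟨hA₁, hne⟩
    rw [State.node, hid, ← h.node hA₁, State.node]
    by_cases hs : s₁ = s
    · subst hs
      rw [hE, Function.update_of_ne]
      intro he
      simp only [List.cons.injEq, and_true] at he
      obtain ⟨rfl, he⟩ := he
      obtain ⟨rfl, rfl, rfl⟩ := (h.graph _).edgeID_inj (h.alive hA₁).1 hI.1 he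
      exact hne rfl
    · have hs' : s₁.opp ≠ s.opp := by cases s₁ <;> cases s <;> simp_all [Side.opp]
      rw [ho _ (by simp) (by simp) (by simp) (by simpa using hs')]
  · rintro s₁ r₁ y₁ x₁ z₁ ⟨hA₁, -⟩
    rw [ho _ (by simp) (by simp) (by simp) (by simp)]
    exact h.key hA₁
  · intro s₁ r₁ y₁ x₁ hr₁ hy₁ hx₁
    by_cases he : (s₁, r₁, y₁, x₁) = (s, r, y, x')
    · simp only [Prod.mk.injEq] at he
      obtain ⟨rfl, rfl, rfl, rfl⟩ := he
      have hset : members N (Al \ {(s₁, r₁, y₁, x₁, y')}) s₁ r₁ y₁ x₁ =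
          members N Al s₁ r₁ y₁ x₁ \ {u} := by
        ext v
        constructor
        · rintro ⟨z, ⟨hz, hne⟩, rfl⟩
          refine ⟨⟨z, hz, rfl⟩, fun he => hne ?_⟩
          obtain ⟨-, -, -, -, rfl⟩ := hN.inj (h.alive hz) hI (he.trans huN.symm)
          rfl
        · rintro ⟨⟨z, hz, rfl⟩, hne⟩
          refine ⟨z, ⟨hz, fun he => hne ?_⟩, rfl⟩
          simp only [Set.mem_singleton_iff, Prod.mk.injEq, true_and] at he
          rw [he, huN]
          rfl
      rw [hset]
      convert hlink.delete huM using 1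
      · funext v
        rw [hB, ha, hb]
        split_ifs <;> simp [Function.update_apply]
      · funext v
        rw [hAf, ha, hb]
        split_ifs <;> simp [Function.update_apply]
      · rw [hL, ha, hb]
        split_ifs <;> simp
    · have hset : members N (Al \ {(s, r, y, x', y')}) s₁ r₁ y₁ x₁ = members N Al s₁ r₁ y₁ x₁ := by
        ext v
        refine exists_congr fun z => and_congr_left fun _ => ⟨fun h => h.1, fun h => ⟨h, ?_⟩⟩
        simp only [Set.mem_singleton_iff, Prod.mk.injEq] at he ⊢
        tauto
      have hdisj : ∀ v ∈ members N Al s₁ r₁ y₁ x₁, v ∉ members N Al s r y x' := by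
        rintro v ⟨z, hz, rfl⟩ ⟨z', hz', hv⟩
        obtain ⟨rfl, rfl, rfl, rfl, -⟩ := hN.inj (h.alive hz) (h.alive hz') hv
        exact he rfl
      have hlast : τ.arr (.rcNextLast s₁.opp) [r₁, x₁, y₁] =
          σ.arr (.rcNextLast s₁.opp) [r₁, x₁, y₁] := by
        by_cases hs : s₁ = s
        · subst hs
          rw [hL]
          split_ifs
          · rw [Function.update_of_ne]
            simp only [Prod.mk.injEq, true_and, ne_eq, List.cons.injEq, and_true] at he ⊢
            tauto
          · rfl
        · have hs' : s₁.opp ≠ s.opp := by cases s₁ <;> cases s <;> simp_all [Side.opp]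
          rw [ho _ (by simp) (by simp) (by simpa using hs') (by simp)]
      rw [hset, hlast]
      refine (h.linked hr₁ hy₁ hx₁).congr (fun v hv => ?_) (fun v hv => ?_)
      · rw [hB]
        split_ifs with ha₀
        · rfl
        · rw [Function.update_of_ne]
          rintro he
          obtain rfl : v = a := by simpa using he
          rcases haM with haM | haM
          · exact ha₀ haM.1
          · exact hdisj _ hv haM.1
      · rw [hAf]
        split_ifs with hb₀
        · rfl
        · rw [Function.update_of_ne]
          rintro he
          obtain rfl : v = b := by simpa using he
          exact hdisj _ hv (hbM.resolve_left hb₀)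
  · intro s₁ r₁ y₁ x₁ hr hy hx'
    rw [hvec, hvec', hz]
    exact h.rcPrev hr hy hx'
  · rintro s₁ r₁ y₁ x₁ ⟨hS, hne⟩ x hx
    rw [hvec] at hx
    obtain ⟨z, hz, hle⟩ := h.settled hS x hx
    refine ⟨z, ⟨hz, fun he => hne ?_⟩, hle⟩
    simp only [Set.mem_singleton_iff, Prod.mk.injEq] at he ⊢
    tauto
  · rw [hz]; exact h.zset_sub
  · intro s₁ r₁ y₁ x₁ z₁ hm hpos
    rw [hz] at hm
    refine ⟨h.alive_of_mem hm hpos, fun he => hmem ?_⟩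
    simp only [Set.mem_singleton_iff, Prod.mk.injEq] at he
    obtain ⟨rfl, rfl, rfl, rfl, rfl⟩ := he
    exact hm
  · rw [hz]; exact h.sound
  · simp only [hz, ht, hqp]; exact h.queue_mem
  · simp only [ht, hqp]; exact h.queue_inj
  · simp only [hz, ht, hqp]; exact h.queue_surj

end Data

/-! ### The procedure UpdateRcPrev -/

namespace Data

/-- The potential that pays for the deletions from the vectors `rcPrev` on side `s`: sixteen times
the number of their entries, since an iteration that deletes an entry takes at most sixteen
steps. -/
def sidePotential (D : Data) (s : Side) (f : Arr → List ℕ → ℕ) : ℕ :=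
  16 * ∑ q ∈ Finset.range D.nR ×ˢ Finset.range (D.nV s) ×ˢ Finset.range (D.nV s.opp),
    f (.rcPrevLen s) [q.1, q.2.1, q.2.2]

/-- The potential that pays for the deletions from the vectors `rcPrev` on both sides. -/
def potential (D : Data) (f : Arr → List ℕ → ℕ) : ℕ :=
  D.sidePotential .left f + D.sidePotential .right f

theorem potential_congr {D : Data} {f g : Arr → List ℕ → ℕ}
    (h : ∀ s, g (.rcPrevLen s) = f (.rcPrevLen s)) : D.potential g = D.potential f := by
  simp [potential, sidePotential, h]

theorem potential_pop {D : Data} {f g : Arr → List ℕ → ℕ} {s : Side} {r y x' k : ℕ}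
    (hr : r < D.nR) (hy : y < D.nV s) (hx : x' < D.nV s.opp)
    (hf : f (.rcPrevLen s) [r, y, x'] = k + 1)
    (hg : g (.rcPrevLen s) = Function.update (f (.rcPrevLen s)) [r, y, x'] k)
    (ho : g (.rcPrevLen s.opp) = f (.rcPrevLen s.opp)) :
    D.potential g + 16 ≤ D.potential f := by
  have h₁ : D.sidePotential s g + 16 ≤ D.sidePotential s f := by
    have : ∑ q ∈ Finset.range D.nR ×ˢ Finset.range (D.nV s) ×ˢ Finset.range (D.nV s.opp),
        g (.rcPrevLen s) [q.1, q.2.1, q.2.2] <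
        ∑ q ∈ Finset.range D.nR ×ˢ Finset.range (D.nV s) ×ˢ Finset.range (D.nV s.opp),
        f (.rcPrevLen s) [q.1, q.2.1, q.2.2] := by
      refine Finset.sum_lt_sum (fun q _ => ?_) ⟨(r, y, x'), by simp [hr, hy, hx], ?_⟩
      · rw [hg, Function.update_apply]
        split_ifs with h
        · rw [h, hf]; omega
        · exact le_rfl
      · rw [hg, Function.update_self, hf]
        omega
    rw [sidePotential, sidePotential]
    omega
  have h₂ : D.sidePotential s.opp g = D.sidePotential s.opp f := by
    rw [sidePotential, sidePotential, ho]
  cases s <;> simp only [Side.opp, potential] at h₁ h₂ ⊢ <;> omega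

variable {D : Data} {N : Side → ℕ → ℕ → ℕ → ℕ → ℕ} {Al : Set (Side × ℕ × ℕ × ℕ × ℕ)}
  {St : Set (Side × ℕ × ℕ × ℕ)} {σ : State}

/-- Entries of `rcPrev` are sources of edges. -/
theorem Core.pos_of_mem (h : D.Core N Al St σ) {s : Side} {r x y x' : ℕ} (hr : r < D.nR)
    (hy : y < D.nV s) (hx' : x' < D.nV s.opp)
    (hx : x ∈ σ.vec (.rcPrev s) (.rcPrevLen s) [r, y, x']) : 0 < D.W s x r y := by
  obtain ⟨dead, h₁, -⟩ := h.rcPrev hr hy hx'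
  have : x ∈ D.keep s x' (σ.vec (.prev s) (.prevLen s) [r, y]) := by
    rw [← h₁]
    exact List.mem_append_left _ hx
  exact (((h.graph s).prev r hr y hy).mem x).1 (mem_keep.1 this).1

/-- The last entry of `rcPrev` has the greatest degree. -/
theorem Core.le_last (h : D.Core N Al St σ) {s : Side} {r x z y x' : ℕ} {l : List ℕ}
    (hr : r < D.nR) (hy : y < D.nV s) (hx' : x' < D.nV s.opp)
    (hl : σ.vec (.rcPrev s) (.rcPrevLen s) [r, y, x'] = l ++ [x]) (hz : z ∈ l ++ [x]) :
    D.W s z r y ≤ D.W s x r y := by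
  obtain ⟨dead, h₁, -⟩ := h.rcPrev hr hy hx'
  have hs : (D.keep s x' (σ.vec (.prev s) (.prevLen s) [r, y])).Pairwise
      fun x z => D.W s x r y ≤ D.W s z r y := ((h.graph s).prev r hr y hy).sorted.filter _
  rw [← h₁, hl] at hs
  rcases List.mem_append.1 hz with hz | hz
  · exact (List.pairwise_append.1 (List.pairwise_append.1 hs).1).2.2 z hz x (by simp)
  · rw [List.mem_singleton.1 hz]

/-- The deletions from the end of `rcPrev[r, y, x']`, when `d` is the greatest degree of an edge
from `x'` to an element of the list. -/
theorem wp_popLoop (h : D.Core N Al St σ) (s : Side) {y : Reg} {r₀ y₀ x₀ : ℕ} {d : unitInterval}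
    (hy : y = .vert s ∨ y = .ext s) (hr : σ.reg .r = r₀) (hy₀ : σ.reg y = y₀)
    (hx : σ.reg (.vert s.opp) = x₀) (hr' : r₀ < D.nR) (hy' : y₀ < D.nV s) (hx' : x₀ < D.nV s.opp)
    (hgo : σ.reg .go = 1) (hd : σ.wreg .d = d)
    (hle : ∀ y', (s, r₀, y₀, x₀, y') ∈ Al → D.W s.opp x₀ r₀ y' ≤ d)
    (hex : d = 0 ∨ ∃ y', (s, r₀, y₀, x₀, y') ∈ Al ∧ d = D.W s.opp x₀ r₀ y') :
    Wp (.loop (.eq .go 1) (block [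
    load .k (.rcPrevLen s) [.r, y, .vert s.opp],
    .ite (.eq .k 0)
      (const .go 0)
      (block [
        pred .k .k,
        load .x (.rcPrev s) [.r, y, .vert s.opp, .k],
        wload .w (.edge s) [.x, .r, y],
        .ite (.wle .w .d)
          (const .go 0)
          (block [
            store (.rcPrevLen s) [.r, y, .vert s.opp] .k,
            load .bit .Z (pairIdx s .x (.vert s.opp)),
            .ite (.eq .bit 1)
              (block [
                const .bit 0,
                store .Z (pairIdx s .x (.vert s.opp)) .bit,
                store (.queue s) [.tail] .x,
                store (.queue s.opp) [.tail] (.vert s.opp),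
                succ .tail .tail])
              .skip])])])) σ fun τ t =>
      D.Core N Al (insert (s, r₀, y₀, x₀) St) τ ∧ QueueLE σ τ ∧
      t + D.potential τ.arr ≤ D.potential σ.arr + 10 := by
  have hyk : ∀ x ∈ [Reg.k, .x, .bit, .tail, .go], y ≠ x := by
    rcases hy with rfl | rfl <;> simp
  simp only [List.mem_cons, List.not_mem_nil, or_false, forall_eq_or_imp, forall_eq] at hyk
  obtain ⟨hy₁, hy₂, hy₃, hy₄, hy₅⟩ := hyk
  refine Wp.mono (wp_loop (fun τ t => D.Core N Al St τ ∧ QueueLE σ τ ∧ τ.reg .r = r₀ ∧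
    τ.reg y = y₀ ∧ τ.reg (.vert s.opp) = x₀ ∧ τ.wreg .d = d ∧
    (τ.reg .go = 1 ∧ t + D.potential τ.arr ≤ D.potential σ.arr ∨
      τ.reg .go ≠ 1 ∧ t + D.potential τ.arr ≤ D.potential σ.arr + 9 ∧
      ∀ x ∈ τ.vec (.rcPrev s) (.rcPrevLen s) [r₀, y₀, x₀], D.W s x r₀ y₀ ≤ d))
    (fun τ => if τ.reg .go = 1 then τ.arr (.rcPrevLen s) [r₀, y₀, x₀] + 1 else 0) ?_
    ⟨h, .refl σ, hr, hy₀, hx, hd, .inl ⟨hgo, by simp⟩⟩) ?_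
  · rintro τ t ⟨hC, hQ, hrτ, hyτ, hxτ, hdτ, hgo⟩ hb
    have hb : τ.reg .go = 1 := hb
    replace hgo : t + D.potential τ.arr ≤ D.potential σ.arr := by tauto
    rw [wp_block_cons, wp_load, wp_block_cons, wp_ite]
    simp only [Test.holds, State.reg_setReg, List.map_cons, List.map_nil, hrτ, hyτ, hxτ, if_true,
      wp_const, wp_block_nil]
    refine ⟨fun hk => ⟨⟨hC.congr rfl rfl (by simp), hQ.trans ⟨by simp, fun _ _ => rfl⟩, by simp,
      by simp [hy₁, hy₅], by simp, hdτ, .inr ⟨by simp, ?_, ?_⟩⟩, by simp [hb]⟩, fun hk => ?_⟩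
    · simp only [State.arr_setReg]
      omega
    · intro x hx
      have hx : x ∈ τ.vec (.rcPrev s) (.rcPrevLen s) [r₀, y₀, x₀] := hx
      rw [List.eq_nil_of_length_eq_zero ((τ.length_vec _ _ _).trans hk)] at hx
      simp at hx
    obtain ⟨l, x, hl⟩ : ∃ l x, τ.vec (.rcPrev s) (.rcPrevLen s) [r₀, y₀, x₀] = l ++ [x] := by
      rw [← τ.length_vec (.rcPrev s)] at hk
      have hne : τ.vec (.rcPrev s) (.rcPrevLen s) [r₀, y₀, x₀] ≠ [] := fun h => hk (by simp [h])
      exact ⟨_, _, (List.dropLast_append_getLast hne).symm⟩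
    have hlen : τ.arr (.rcPrevLen s) [r₀, y₀, x₀] = l.length + 1 := by
      rw [← τ.length_vec (.rcPrev s), hl]
      simp
    have hread : τ.arr (.rcPrev s) [r₀, y₀, x₀, l.length] = x := by
      have := State.arr_eq_of_vec hl (i := l.length) (by simp)
      simpa using this
    have hpos : 0 < D.W s x r₀ y₀ := hC.pos_of_mem hr' hy' hx' (by rw [hl]; simp)
    have hedge : τ.warr (.edge s) [x, r₀, y₀] = D.W s x r₀ y₀ :=
      (hC.graph s).edge _ (lt_of_pos hpos).1 _ hr' _ hy'
    rw [wp_block_cons, wp_pred, wp_block_cons, wp_load, wp_block_cons, wp_wload, wp_block_cons,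
      wp_ite]
    simp only [Test.holds, State.reg_setReg, List.map_cons, List.map_nil, hrτ, hyτ, hxτ, if_true,
      reduceCtorEq, if_false, hy₁, hy₂, hy₅, State.arr_setReg, State.warr_setReg,
      State.wreg_setWReg, State.wreg_setReg, hlen, Nat.add_sub_cancel, hread, hedge, hdτ, hb,
      wp_const, wp_block_nil]
    refine ⟨fun hle' => ⟨⟨hC.congr rfl rfl (by simp), hQ.trans ⟨by simp, fun _ _ => rfl⟩,
      by simp [hrτ], by simp [hy₁, hy₂, hyτ], by simp [hxτ], by simp, .inr ⟨by simp, ?_, ?_⟩⟩, by simp⟩,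
      fun hlt => ?_⟩
    · simp only [State.arr_setReg, State.arr_setWReg]
      omega
    · intro z hz
      have hz : z ∈ τ.vec (.rcPrev s) (.rcPrevLen s) [r₀, y₀, x₀] := hz
      rw [hl] at hz
      exact (hC.le_last hr' hy' hx' hl hz).trans hle'
    have hnle : ∀ y', (s, r₀, y₀, x₀, y') ∈ Al → ¬ D.W s x r₀ y₀ ≤ D.W s.opp x₀ r₀ y' :=
      fun y' hy' h => hlt (h.trans (hle y' hy'))
    have hbit := mem_zset (D := D) (σ := τ) (lt_of_pos hpos).1 hx'
    simp only [wp_block_cons, wp_store, wp_load, wp_ite, wp_const, wp_succ, wp_skip, wp_block_nil,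
      Test.holds]
    simp only [State.reg_setReg, List.map_cons, List.map_nil, hrτ, hyτ, hxτ, if_true, map_pairIdx,
      reduceCtorEq, if_false, hy₁, hy₂, hy₃, hy₄, State.arr_setReg,
      State.wreg_setWReg, State.wreg_setReg, State.reg_setWReg, State.reg_setArr, State.arr_setArr,
      State.arr_setWReg, State.wreg_setArr, hb, ← hbit]
    refine ⟨fun hm => ?_, fun hm => ?_⟩
    · -- first the pair is removed, and then the entry is deleted
      obtain ⟨hK, hQK⟩ := hC.kill (τ := ((((τ.setArr .Z [(mkPair s x x₀).1, (mkPair s x x₀).2]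
        0).setArr (.queue s) [τ.reg .tail] x).setArr (.queue s.opp) [τ.reg .tail] x₀).setReg .tail
        (τ.reg .tail + 1))) hm hpos hnle (by simp) (by simp) (by simp)
        (fun a ha ha' => by simp [ha, ha']) rfl (by simp)
      obtain ⟨hP, -⟩ := hK.pop (s := s) (r := r₀) (x := x) (y := y₀) (x' := x₀) (l := l)
        (τ := ((((((((((((τ.setReg .k (l.length + 1)).setReg .k l.length).setReg .x x).setWReg .w
          (D.W s x r₀ y₀)).setArr (.rcPrevLen s) [r₀, y₀, x₀] l.length).setReg .bit
          (τ.arr .Z [(mkPair s x x₀).1, (mkPair s x x₀).2])).setReg .bit 0).setArr .Z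
          [(mkPair s x x₀).1, (mkPair s x x₀).2] 0).setArr (.queue s) [τ.reg .tail] x).setArr
          (.queue s.opp) [τ.reg .tail] x₀).setReg .tail (τ.reg .tail + 1))))
        (by rw [← hl, State.vec_congr] <;> simp)
        (by rw [mem_zset (lt_of_pos hpos).1 hx']; simp)
        (by simp) (fun a ha => by simp [ha]) rfl (by simp)
      refine ⟨⟨hP, hQ.trans (hQK.trans ⟨by simp, fun i _ => by simp [State.qpair]⟩), by simp,
        by simp, by simp, by simp [hdτ], .inl ⟨trivial, ?_⟩⟩, by simp⟩
      have := potential_pop (D := D) (f := τ.arr) (g := ((((((((((((τ.setReg .k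
          (l.length + 1)).setReg .k l.length).setReg .x x).setWReg .w
          (D.W s x r₀ y₀)).setArr (.rcPrevLen s) [r₀, y₀, x₀] l.length).setReg .bit
          (τ.arr .Z [(mkPair s x x₀).1, (mkPair s x x₀).2])).setReg .bit 0).setArr .Z
          [(mkPair s x x₀).1, (mkPair s x x₀).2] 0).setArr (.queue s) [τ.reg .tail] x).setArr
          (.queue s.opp) [τ.reg .tail] x₀).setReg .tail (τ.reg .tail + 1))).arr) hr' hy' hx' hlen
          (by simp) (by simp)
      rw [State.arr_setReg] at this
      omega
    · obtain ⟨hP, -⟩ := hC.pop (s := s) (r := r₀) (x := x) (y := y₀) (x' := x₀) (l := l)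
        (τ := (((((τ.setReg .k (l.length + 1)).setReg .k l.length).setReg .x x).setWReg .w
          (D.W s x r₀ y₀)).setArr (.rcPrevLen s) [r₀, y₀, x₀] l.length).setReg .bit
          (τ.arr .Z [(mkPair s x x₀).1, (mkPair s x x₀).2])) hl hm
        (by simp) (fun a ha => by simp [ha]) rfl (by simp)
      refine ⟨⟨hP, hQ.trans ⟨by simp, fun i _ => by simp [State.qpair]⟩, by simp,
        by simp, by simp, by simp [hdτ], .inl ⟨trivial, ?_⟩⟩, by simp⟩
      have := potential_pop (D := D) (f := τ.arr) (g := ((((((τ.setReg .k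
          (l.length + 1)).setReg .k l.length).setReg .x x).setWReg .w
          (D.W s x r₀ y₀)).setArr (.rcPrevLen s) [r₀, y₀, x₀] l.length).setReg .bit
          (τ.arr .Z [(mkPair s x x₀).1, (mkPair s x x₀).2])).arr) hr' hy' hx' hlen
          (by simp) (by simp)
      rw [State.arr_setReg] at this
      omega
  · rintro τ t ⟨u, rfl, ⟨hC, hQ, -, -, -, -, hgo⟩, hb⟩
    rcases hgo with hgo | ⟨-, hgo, hall⟩
    · exact absurd hgo.1 hb
    -- the triple is settled: if the list is empty, then `d = 0` and the vector is empty, too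
    refine ⟨⟨hC.graph, hC.alive, hC.node, hC.key, hC.linked, hC.rcPrev, ?_, hC.zset_sub,
      hC.alive_of_mem, hC.sound, hC.queue_mem, hC.queue_inj, hC.queue_surj⟩, hQ, by omega⟩
    intro s₁ r₁ y₁ x₁ hS z hz
    rcases hS with he | hS
    · simp only [Prod.mk.injEq] at he
      obtain ⟨rfl, rfl, rfl, rfl⟩ := he
      have hpos := hC.pos_of_mem hr' hy' hx' hz
      rcases hex with rfl | ⟨y', hA, rfl⟩
      · exact absurd (hpos.trans_le (hall z hz)) (lt_irrefl _)
      · exact ⟨y', hA, hall z hz⟩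
    · exact hC.settled hS z hz

/-- The list is ordered by the degrees, so its last element provides the greatest degree `d` of an edge
from `x'` to an element of the list. Except for the deletions, the time is constant. -/
theorem wp_updateRcPrev (hN : D.Nodes N) (h : D.Core N Al St σ) (s : Side) {y : Reg}
    {r₀ y₀ x₀ : ℕ} (hy : y = .vert s ∨ y = .ext s) (hr : σ.reg .r = r₀) (hy₀ : σ.reg y = y₀)
    (hx : σ.reg (.vert s.opp) = x₀) (hr' : r₀ < D.nR) (hy' : y₀ < D.nV s)
    (hx' : x₀ < D.nV s.opp) :
    Wp (updateRcPrev s y (.vert s.opp)) σ fun τ t =>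
      D.Core N Al (insert (s, r₀, y₀, x₀) St) τ ∧ QueueLE σ τ ∧
      t + D.potential τ.arr ≤ D.potential σ.arr + 15 := by
  have hlink := h.linked hr' hy' hx'
  have hyk : ∀ x ∈ [Reg.u, .z, .go], y ≠ x := by
    rcases hy with rfl | rfl <;> simp
  simp only [List.mem_cons, List.not_mem_nil, or_false, forall_eq_or_imp, forall_eq] at hyk
  obtain ⟨hy₁, hy₂, hy₃⟩ := hyk
  rw [updateRcPrev, wp_block_cons, wp_load, wp_block_cons, wp_ite]
  simp only [Test.holds, State.reg_setReg, List.map_cons, List.map_nil, hr, hy₀, hx, if_true]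
  refine ⟨fun hu => ?_, fun hu => ?_⟩
  · rw [wp_wzero, wp_block_cons, wp_const, wp_block_cons]
    refine Wp.mono (wp_popLoop (D := D) (N := N) (Al := Al) (St := St) (r₀ := r₀) (y₀ := y₀)
      (x₀ := x₀) (d := 0) ?_ s hy ?_ ?_ ?_ hr' hy' hx' ?_ ?_ ?_ (.inl rfl)) ?_
    · exact h.congr rfl rfl (by simp)
    · simp [hr]
    · simp [hy₁, hy₃, hy₀]
    · simp [hx]
    · simp
    · simp
    · intro y' hA
      have := hlink.le_last _ ⟨y', hA, rfl⟩
      rw [hu] at this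
      exact absurd (Nat.le_zero.1 this) (hN.ne_zero (h.alive hA))
    · rintro τ t ⟨h₁, h₂, h₃⟩
      rw [wp_block_nil]
      refine ⟨h₁, ⟨by simpa using h₂.1, fun i hi => ?_⟩, ?_⟩
      · exact h₂.2 i (by simpa using hi)
      · simp only [State.arr_setReg, State.arr_setWReg] at h₃
        omega
  · obtain ⟨z, hz, hzu⟩ := hlink.last_mem.resolve_left hu
    have hkey : σ.arr .elemKey [σ.arr (.rcNextLast s.opp) [r₀, x₀, y₀]] = z := by
      rw [hzu]
      exact h.key hz
    have hI := h.alive hz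
    have hedge : σ.warr (.edge s.opp) [x₀, r₀, z] = D.W s.opp x₀ r₀ z :=
      (h.graph _).edge _ hx' _ hr' _ (lt_of_pos hI.1).2.2
    rw [wp_block_cons, wp_load, wp_block_cons, wp_wload, wp_block_nil, wp_block_cons, wp_const,
      wp_block_cons]
    simp only [State.reg_setReg, List.map_cons, List.map_nil, hr, hx, if_true,
      State.arr_setReg, hkey, reduceCtorEq, if_false, State.warr_setReg, hedge]
    refine Wp.mono (wp_popLoop (D := D) (N := N) (Al := Al) (St := St) (r₀ := r₀) (y₀ := y₀)
      (x₀ := x₀) (d := D.W s.opp x₀ r₀ z) ?_ s hy ?_ ?_ ?_ hr' hy' hx' ?_ ?_ ?_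
      (.inr ⟨z, hz, rfl⟩)) ?_
    · exact h.congr rfl rfl (by simp)
    · simp [hr]
    · simp [hy₁, hy₂, hy₃, hy₀]
    · simp [hx]
    · simp
    · simp
    · intro y' hA
      have := hlink.le_last _ ⟨y', hA, rfl⟩
      rw [hzu] at this
      exact hN.mono (h.alive hA) hI this
    · rintro τ t ⟨h₁, h₂, h₃⟩
      rw [wp_block_nil]
      refine ⟨h₁, ⟨by simpa using h₂.1, fun i hi => ?_⟩, ?_⟩
      · exact h₂.2 i (by simpa using hi)
      · simp only [State.arr_setReg, State.arr_setWReg] at h₃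
        omega

end Data

/-! ### Propagation of the removal of pairs -/

theorem QueueLE.setReg {σ τ : State} (h : QueueLE σ τ) {x : Reg} (k : ℕ) (hx : x ≠ .tail) :
    QueueLE σ (τ.setReg x k) :=
  ⟨by simpa [hx.symm] using h.1, h.2⟩

namespace Data

/-- The indices `[r, y, x']` of the vectors `rcPrev` on both sides `s`. -/
def allTriples (D : Data) : Set (Side × ℕ × ℕ × ℕ) :=
  {q | q.2.1 < D.nR ∧ q.2.2.1 < D.nV q.1 ∧ q.2.2.2 < D.nV q.1.opp}

variable {D : Data} {N : Side → ℕ → ℕ → ℕ → ℕ → ℕ} {Al : Set (Side × ℕ × ℕ × ℕ × ℕ)}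
  {St : Set (Side × ℕ × ℕ × ℕ)} {σ : State}

theorem Core.setReg (h : D.Core N Al St σ) {x : Reg} (k : ℕ) (hx : x ≠ .tail) :
    D.Core N Al St (σ.setReg x k) :=
  h.congr rfl rfl (by simp [hx.symm])

theorem Core.settled_mono {St' : Set (Side × ℕ × ℕ × ℕ)} (h : D.Core N Al St σ) (hS : St' ⊆ St) :
    D.Core N Al St' σ :=
  ⟨h.graph, h.alive, h.node, h.key, h.linked, h.rcPrev, fun hq => h.settled (hS hq), h.zset_sub,
    h.alive_of_mem, h.sound, h.queue_mem, h.queue_inj, h.queue_surj⟩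

theorem wp_updateAll (hN : D.Nodes N) (hσ : D.Sizes σ) (h : D.Core N Al St σ) (s : Side) :
    Wp (updateAll s) σ fun τ t =>
      D.Core N Al ({q | q.1 = s ∧ q ∈ D.allTriples} ∪ St) τ ∧
      t + D.potential τ.arr ≤ D.potential σ.arr +
        (2 + 4 * D.nR + 4 * (D.nR * D.nV s) + D.nR * (D.nV s * (D.nV s.opp * 17))) := by
  refine Wp.mono (wp_for₃ D.nR (D.nV s) (D.nV s.opp)
    (fun S τ => D.Core N Al ({q | q.1 = s ∧ q.2 ∈ S} ∪ St) τ) D.potential (fun _ _ _ => 15)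
    hσ.numR (hσ.numV s) (hσ.numV s.opp) rfl rfl (by cases s <;> rfl) rfl (by cases s <;> rfl) rfl
    ?_ (by simpa using h) ?_) ?_
  · intro S τ x k hC hx
    exact hC.setReg k (by rcases hx with rfl | rfl | rfl <;> simp)
  · intro S r hr y hy x' hx' _ τ hC hrr hyr hxr _
    refine Wp.mono (wp_updateRcPrev hN hC s (.inl rfl) hrr hyr hxr hr hy hx') ?_
    rintro ρ t ⟨h₁, -, h₂⟩
    refine ⟨h₁.settled_mono ?_, h₂⟩
    rintro ⟨s₁, q⟩ (⟨h₁, h₂⟩ | h₁)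
    · obtain rfl : s₁ = s := h₁
      rcases h₂ with h₂ | h₂
      · left
        obtain rfl : q = _ := h₂
        rfl
      · exact .inr (.inl ⟨rfl, h₂⟩)
    · exact .inr (.inr h₁)
  · rintro τ t ⟨h₁, h₂⟩
    refine ⟨h₁.settled_mono (Set.union_subset_union_left _ ?_), by simpa using h₂⟩
    rintro ⟨s₁, r, y, x'⟩ ⟨hs, hq⟩
    obtain rfl : s₁ = s := hs
    exact ⟨rfl, hq⟩

theorem wp_deleteElem (s : Side) {σ : State} {u r x y a b : ℕ} (hu : σ.reg .u = u)
    (hr : σ.reg .r = r) (hx : σ.reg (.vert s.opp) = x) (hy : σ.reg (.ext s) = y)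
    (hb : σ.arr .elemBefore [u] = b) (ha : σ.arr .elemAfter [u] = a) :
    Wp (deleteElem s.opp (.vert s.opp) (.ext s)) σ fun τ t =>
      τ.arr .elemBefore = (if a = 0 then σ.arr .elemBefore else
        Function.update (σ.arr .elemBefore) [a] b) ∧
      τ.arr .elemAfter = (if b = 0 then σ.arr .elemAfter else
        Function.update (σ.arr .elemAfter) [b] a) ∧
      τ.arr (.rcNextLast s.opp) = (if a = 0 then
        Function.update (σ.arr (.rcNextLast s.opp)) [r, x, y] b else
        σ.arr (.rcNextLast s.opp)) ∧ t ≤ 6 := by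
  simp only [deleteElem, wp_block_cons, wp_block_nil, wp_load, wp_ite, wp_skip, wp_store,
    Test.holds, State.reg_setReg, List.map_cons, List.map_nil, reduceCtorEq, if_false, if_true,
    State.arr_setReg, State.reg_setArr, hu, hr, hx, hy, hb, ha]
  refine ⟨fun hb₀ => ⟨fun ha₀ => ?_, fun ha₀ => ?_⟩, fun hb₀ => ⟨fun ha₀ => ?_, fun ha₀ => ?_⟩⟩ <;>
    simp [ha₀, hb₀]

/-- The treatment of one predecessor of the extracted pair. -/
theorem wp_propagate_body (hN : D.Nodes N) (h : D.Core N Al D.allTriples σ) (s : Side)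
    {r₀ y₀ y₁ x₀ i : ℕ} (hr : σ.reg .r = r₀) (hi : σ.reg .i = i) (hy₀ : σ.reg (.ext s) = y₀)
    (hy₁ : σ.reg (.ext s.opp) = y₁) (hx : σ.arr (.prev s.opp) [r₀, y₁, i] = x₀)
    (hA : (s, r₀, y₀, x₀, y₁) ∈ Al) (hmem : mkPair s y₀ y₁ ∉ D.zset σ) :
    Wp (block [
      load (.vert s.opp) (.prev s.opp) [.r, .ext s.opp, .i],
      load .e (.edgeID s.opp) [.vert s.opp, .r, .ext s.opp],
      load .u (.rcNextElem s.opp) [.ext s, .e],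
      deleteElem s.opp (.vert s.opp) (.ext s),
      const .u 0,
      store (.rcNextElem s.opp) [.ext s, .e] .u,
      updateRcPrev s (.ext s) (.vert s.opp)]) σ fun τ t =>
      D.Core N (Al \ {(s, r₀, y₀, x₀, y₁)}) D.allTriples τ ∧ QueueLE σ τ ∧
      t + D.potential τ.arr ≤ D.potential σ.arr + 26 := by
  have hI := h.alive hA
  have hr' : r₀ < D.nR := (lt_of_pos hI.1).2.1
  have hy' : y₀ < D.nV s := (lt_of_mem_labelPairs hI.2).1
  have hx' : x₀ < D.nV s.opp := (lt_of_pos hI.1).1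
  rw [wp_block_cons, wp_load, wp_block_cons, wp_load, wp_block_cons, wp_load, wp_block_cons]
  simp only [State.reg_setReg, List.map_cons, List.map_nil, reduceCtorEq, if_false, if_true,
    State.arr_setReg, hr, hi, hy₀, hy₁, hx]
  refine Wp.mono (Wp.frame (wp_deleteElem s (u := σ.node s r₀ y₀ x₀ y₁) (r := r₀) (x := x₀) (y := y₀)
    ?_ ?_ ?_ ?_ rfl rfl)) ?_
  · simp [State.node]
  · simp [hr]
  · simp
  · simp [hy₀]
  rintro τ t ⟨⟨hB, hAf, hL, ht⟩, hF⟩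
  have hrτ : τ.reg .r = r₀ := by rw [hF.reg _ rfl]; simp [hr]
  have hyτ : τ.reg (.ext s) = y₀ := by rw [hF.reg _ rfl]; simp [hy₀]
  have hxτ : τ.reg (.vert s.opp) = x₀ := by rw [hF.reg _ rfl]; simp
  have heτ : τ.reg .e = σ.arr (.edgeID s.opp) [x₀, r₀, y₁] := by rw [hF.reg _ rfl]; simp
  have htτ : τ.reg .tail = σ.reg .tail := by rw [hF.reg _ rfl]; simp
  have hEτ : τ.arr (.rcNextElem s.opp) = σ.arr (.rcNextElem s.opp) := hF.arr _ rfl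
  have hwτ : τ.warr = σ.warr := by
    funext a
    exact hF.warr _ rfl
  have hoτ : ∀ a, a ≠ .elemBefore → a ≠ .elemAfter → a ≠ .rcNextLast s.opp →
      τ.arr a = σ.arr a := by
    intro a h₁ h₂ h₃
    refine hF.arr a ?_
    simp [deleteElem, block, Cmd.writesArr, Instr.writesArr, Cmd.load, Cmd.store, h₁.symm, h₂.symm,
      h₃.symm]
  rw [wp_block_cons, wp_const, wp_block_cons, wp_store, wp_block_cons]
  simp only [State.reg_setReg, List.map_cons, List.map_nil, reduceCtorEq, if_false, if_true,
    hyτ, heτ]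
  have hC := h.delete hN (τ := (τ.setReg .u 0).setArr (.rcNextElem s.opp)
    [y₀, σ.arr (.edgeID s.opp) [x₀, r₀, y₁]] 0) hA hmem rfl rfl rfl
    (by rw [State.arr_setArr, if_neg (by simp)]; exact hB)
    (by rw [State.arr_setArr, if_neg (by simp)]; exact hAf)
    (by rw [State.arr_setArr, if_neg (by simp)]; exact hL) (by simp [hEτ])
    (fun a h₁ h₂ h₃ h₄ => by simpa [h₄] using hoτ a h₁ h₂ h₃) (by simpa using hwτ)
    (by simpa using htτ)
  refine Wp.mono (wp_updateRcPrev hN hC s (.inr rfl) (by simpa using hrτ) (by simpa using hyτ)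
    (by simpa using hxτ) hr' hy' hx') ?_
  rintro ρ u ⟨hC', hQ, hu⟩
  rw [wp_block_nil]
  have hT : (s, r₀, y₀, x₀) ∈ D.allTriples := ⟨hr', hy', hx'⟩
  rw [Set.insert_sdiff_singleton, Set.insert_eq_of_mem hT] at hC'
  refine ⟨hC', QueueLE.trans ⟨?_, fun i _ => ?_⟩ hQ, ?_⟩
  · simp [htτ]
  · simp [State.qpair, hoτ]
  · have hpot : D.potential ((τ.setReg .u 0).setArr (.rcNextElem s.opp)
        [y₀, σ.arr (.edgeID s.opp) [x₀, r₀, y₁]] 0).arr = D.potential σ.arr :=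
      potential_congr fun s' => by simp [hoτ]
    omega

/-- The amortized time of `propagate s` for a pair whose component on the opposite side is `y'`. -/
def propagateTime (D : Data) (s : Side) (y' : ℕ) : ℕ :=
  2 + ∑ r ∈ Finset.range D.nR, (28 * (D.prevList s.opp r y' (D.m s.opp)).length + 5)

/-- The treatment of an extracted pair deletes the list elements that belong to it, and all triples are
settled again afterwards. -/
theorem wp_propagate (hN : D.Nodes N) (hσ : D.Sizes σ) (h : D.Core N Al D.allTriples σ) (s : Side)
    {y₀ y₁ : ℕ} (hy₀ : σ.reg (.ext s) = y₀) (hy₁ : σ.reg (.ext s.opp) = y₁)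
    (hq : ∃ i < σ.reg .tail, σ.qpair i = mkPair s y₀ y₁)
    (hA : ∀ r x', 0 < D.W s.opp x' r y₁ → (s, r, y₀, x', y₁) ∈ Al) :
    Wp (propagate s) σ fun τ t =>
      D.Core N (Al \ {q | ∃ r x', q = (s, r, y₀, x', y₁)}) D.allTriples τ ∧ QueueLE σ τ ∧
      t + D.potential τ.arr ≤ D.potential σ.arr + D.propagateTime s y₁ := by
  obtain ⟨j, hj, hj'⟩ := hq
  have hlt := lt_of_mem_labelPairs (hj' ▸ (h.queue_mem j hj).1)
  have hnot : ∀ {Al' : Set (Side × ℕ × ℕ × ℕ × ℕ)} {τ : State}, D.Core N Al' D.allTriples τ →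
      QueueLE σ τ → mkPair s y₀ y₁ ∉ D.zset τ := by
    intro Al' τ hC hQ
    rw [← hj', ← hQ.2 j hj]
    exact (hC.queue_mem j (hj.trans_le hQ.1)).2
  -- the elements with a label less than `k` have been deleted
  refine Wp.mono (wp_for D.nR (fun k τ => D.Core N
    (Al \ {q | ∃ r x', r < k ∧ q = (s, r, y₀, x', y₁)}) D.allTriples τ ∧ QueueLE σ τ) D.potential
    (fun r => 3 + 28 * (D.prevList s.opp r y₁ (D.m s.opp)).length) hσ.numR rfl rfl ?_ ?_) ?_
  · refine ⟨?_, (QueueLE.refl σ).setReg _ (by simp)⟩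
    simpa using h.setReg 0 (by simp)
  · rintro k hk τ ⟨hC, hQ⟩ hrk hF
    have hP := (hC.graph s.opp).prev k hk y₁ hlt.2
    have hlen := τ.length_vec (.prev s.opp) (.prevLen s.opp) [k, y₁]
    generalize hl : τ.vec (.prev s.opp) (.prevLen s.opp) [k, y₁] = l at *
    have hy₀τ : τ.reg (.ext s) = y₀ := (hF.reg _ (by cases s <;> rfl)).trans hy₀
    have hy₁τ : τ.reg (.ext s.opp) = y₁ := (hF.reg _ (by cases s <;> rfl)).trans hy₁
    rw [wp_block_cons, wp_load, wp_block_cons]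
    simp only [List.map_cons, List.map_nil, hrk, hy₁τ]
    refine Wp.mono (wp_for l.length (fun i ρ => D.Core N (Al \ {q | ∃ r x',
      (r < k ∨ r = k ∧ x' ∈ l.take i) ∧ q = (s, r, y₀, x', y₁)}) D.allTriples ρ ∧ QueueLE σ ρ)
      D.potential (fun _ => 26) ?_ (by cases s <;> rfl) (by cases s <;> rfl) ?_ ?_) ?_
    · simp [hlen]
    · refine ⟨?_, (hQ.setReg _ (by simp)).setReg _ (by simp)⟩
      have := (hC.setReg (x := .len) (τ.arr (.prevLen s.opp) [k, y₁]) (by simp)).setReg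
        (x := .i) 0 (by simp)
      simpa using this
    · rintro i hi ρ ⟨hC', hQ'⟩ hri hF'
      have hread : ρ.arr (.prev s.opp) [k, y₁, i] = l[i] := by
        rw [hF'.arr _ (by cases s <;> rfl)]
        exact State.arr_eq_of_vec hl hi
      have hpos : 0 < D.W s.opp l[i] k y₁ := (hP.mem _).1 (List.getElem_mem hi)
      refine Wp.mono (wp_propagate_body hN hC' s (r₀ := k) (y₀ := y₀) (y₁ := y₁) (x₀ := l[i])
        (i := i) ?_ hri ?_ ?_ hread ⟨hA _ _ hpos, ?_⟩ (hnot hC' hQ')) ?_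
      · rw [hF'.reg _ (by cases s <;> rfl)]
        simpa using hrk
      · rw [hF'.reg _ (by cases s <;> rfl)]
        simpa using hy₀τ
      · rw [hF'.reg _ (by cases s <;> rfl)]
        simpa using hy₁τ
      · -- the vertex has not been treated before, since the vector has no repetitions
        rintro ⟨r, x', hrx, he⟩
        simp only [Prod.mk.injEq, true_and, and_true] at he
        obtain ⟨rfl, rfl⟩ := he
        have hmem := (hrx.resolve_left (lt_irrefl _)).2
        have hnd := hP.nodup
        rw [← List.take_append_drop i l, List.nodup_append, List.drop_eq_getElem_cons hi] at hnd
        exact hnd.2.2 _ hmem _ List.mem_cons_self rfl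
      · rintro ω t ⟨h₁, h₂, h₃⟩
        refine ⟨⟨?_, (hQ'.trans h₂).setReg _ (by simp)⟩, by simpa using h₃⟩
        have htake : l.take (i + 1) = l.take i ++ [l[i]] := by simp
        have hset : (Al \ {q | ∃ r x', (r < k ∨ r = k ∧ x' ∈ l.take (i + 1)) ∧
            q = (s, r, y₀, x', y₁)}) = (Al \ {q | ∃ r x', (r < k ∨ r = k ∧ x' ∈ l.take i) ∧
            q = (s, r, y₀, x', y₁)}) \ {(s, k, y₀, l[i], y₁)} := by
          rw [Set.sdiff_sdiff, htake]
          congr 1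
          ext q
          simp only [List.mem_append, List.mem_singleton, Set.mem_ofPred_eq, Set.mem_union,
            Set.mem_singleton_iff]
          constructor
          · rintro ⟨r, x', h | ⟨rfl, h | rfl⟩, rfl⟩
            · exact .inl ⟨r, x', .inl h, rfl⟩
            · exact .inl ⟨r, x', .inr ⟨rfl, h⟩, rfl⟩
            · exact .inr rfl
          · rintro (⟨r, x', h | h, rfl⟩ | rfl)
            · exact ⟨r, x', .inl h, rfl⟩
            · exact ⟨r, x', .inr ⟨h.1, .inl h.2⟩, rfl⟩
            · exact ⟨k, l[i], .inr ⟨rfl, .inr rfl⟩, rfl⟩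
        rw [hset]
        exact h₁.setReg _ (by simp)
    · rintro ρ t ⟨⟨h₁, h₂⟩, h₃⟩
      rw [wp_block_nil]
      refine ⟨⟨?_, h₂.setReg _ (by simp)⟩, ?_⟩
      · have hset : (Al \ {q | ∃ r x', r < k + 1 ∧ q = (s, r, y₀, x', y₁)}) =
            Al \ {q | ∃ r x', (r < k ∨ r = k ∧ x' ∈ l.take l.length) ∧
            q = (s, r, y₀, x', y₁)} := by
          ext q
          refine and_congr_right fun hq => not_congr ⟨?_, ?_⟩
          · rintro ⟨r, x', hr, rfl⟩
            refine ⟨r, x', ?_, rfl⟩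
            rcases Nat.lt_succ_iff_lt_or_eq.1 hr with hr | rfl
            · exact .inl hr
            · rw [List.take_length, hP.mem]
              exact .inr ⟨rfl, (h.alive hq).1⟩
          · rintro ⟨r, x', hr, rfl⟩
            exact ⟨r, x', by omega, rfl⟩
        rw [hset]
        exact h₁.setReg _ (by simp)
      · rw [hP.length] at h₃
        simp only [Finset.sum_const, Finset.card_range, smul_eq_mul, State.arr_setReg] at h₃
        omega
  · rintro τ t ⟨⟨h₁, h₂⟩, h₃⟩
    refine ⟨?_, h₂, h₃.trans_eq ?_⟩
    · convert h₁ using 1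
      ext q
      refine and_congr_right fun hq => not_congr ⟨?_, ?_⟩
      · rintro ⟨r, x', rfl⟩
        exact ⟨r, x', (lt_of_pos (h.alive hq).1).2.1, rfl⟩
      · rintro ⟨r, x', -, rfl⟩
        exact ⟨r, x', rfl⟩
    · rw [propagateTime]
      congr 2
      exact Finset.sum_congr rfl fun r _ => by ring

end Data

/-! ### The main loop -/

namespace Data

variable {D : Data} {N : Side → ℕ → ℕ → ℕ → ℕ → ℕ} {Al : Set (Side × ℕ × ℕ × ℕ × ℕ)}
  {σ : State}

/-- The list elements that remain when the first `k` pairs of the queue have been treated. -/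
def remaining (D : Data) (σ : State) (k : ℕ) : Set (Side × ℕ × ℕ × ℕ × ℕ) :=
  {q | D.InitAlive q.1 q.2.1 q.2.2.1 q.2.2.2.1 q.2.2.2.2 ∧
    ∀ i < k, σ.qpair i ≠ mkPair q.1 q.2.2.1 q.2.2.2.2}

theorem remaining_congr {τ : State} {k : ℕ} (h : ∀ i < k, τ.qpair i = σ.qpair i) :
    D.remaining τ k = D.remaining σ k := by
  ext q
  refine and_congr_right fun _ => forall₂_congr fun i hi => ?_
  rw [h i hi]

theorem remaining_succ (k : ℕ) : D.remaining σ (k + 1) =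
    (D.remaining σ k \ {q | ∃ r x', q = (.left, r, (σ.qpair k).1, x', (σ.qpair k).2)}) \
      {q | ∃ r x', q = (.right, r, (σ.qpair k).2, x', (σ.qpair k).1)} := by
  ext ⟨s, r, y, x', y'⟩
  simp only [remaining, Set.mem_ofPred_eq, Set.mem_sdiff, Nat.lt_succ_iff_lt_or_eq, or_imp,
    forall_and, forall_eq, Prod.mk.injEq, and_assoc]
  refine and_congr_right fun _ => and_congr_right fun _ => ?_
  generalize σ.qpair k = p
  obtain ⟨a, b⟩ := p
  cases s <;> simp [mkPair] <;> grind

/-- The amortized time of one iteration of the main loop. -/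
def iterTime (D : Data) (p : ℕ × ℕ) : ℕ :=
  4 + D.propagateTime .left p.2 + D.propagateTime .right p.1

/-- The vectors Prev that are traversed for all vertices contain every edge once. -/
theorem sum_propagateTime (D : Data) (s : Side) :
    ∑ y ∈ Finset.range (D.nV s.opp), D.propagateTime s y =
      2 * D.nV s.opp + 28 * D.m s.opp + 5 * (D.nR * D.nV s.opp) := by
  have h := sum_length_prevList (D := D) s.opp
  simp only [propagateTime]
  rw [Finset.sum_add_distrib, Finset.sum_comm]
  simp only [Finset.sum_add_distrib, ← Finset.mul_sum, Finset.sum_const, Finset.card_range,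
    smul_eq_mul, h]
  ring

theorem sum_iterTime (D : Data) :
    ∑ p ∈ Finset.range (D.nV .left) ×ˢ Finset.range (D.nV .right), D.iterTime p =
      4 * (D.nV .left * D.nV .right) +
      D.nV .left * (2 * D.nV .right + 28 * D.m .right + 5 * (D.nR * D.nV .right)) +
      D.nV .right * (2 * D.nV .left + 28 * D.m .left + 5 * (D.nR * D.nV .left)) := by
  have h₁ := D.sum_propagateTime .left
  have h₂ := D.sum_propagateTime .right
  simp only [Side.opp] at h₁ h₂
  simp only [iterTime, Finset.sum_product, Finset.sum_add_distrib, Finset.sum_const,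
    Finset.card_product, Finset.card_range, smul_eq_mul, h₁, ← Finset.mul_sum, h₂]
  ring

/-- The queue contains no pair twice. -/
theorem Core.sum_queue_le {St : Set (Side × ℕ × ℕ × ℕ)} (h : D.Core N Al St σ) (f : ℕ × ℕ → ℕ) :
    ∑ i ∈ Finset.range (σ.reg .tail), f (σ.qpair i) ≤
      ∑ p ∈ Finset.range (D.nV .left) ×ˢ Finset.range (D.nV .right), f p := by
  rw [← Finset.sum_image (f := f) (g := σ.qpair)]
  · refine Finset.sum_le_sum_of_subset fun p hp => ?_
    simp only [Finset.mem_image, Finset.mem_range] at hp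
    obtain ⟨i, hi, rfl⟩ := hp
    have := (h.queue_mem i hi).1
    simpa using ⟨this.1, this.2.1⟩
  · intro i hi j hj he
    exact h.queue_inj i (by simpa using hi) j (by simpa using hj) he

theorem Core.tail_le {St : Set (Side × ℕ × ℕ × ℕ)} (h : D.Core N Al St σ) :
    σ.reg .tail ≤ D.nV .left * D.nV .right := by
  simpa using h.sum_queue_le fun _ => 1

/-- When all pairs of the queue have been treated, the relation is a directed simulation. -/
theorem Core.isSim (h : D.Core N (D.remaining σ (σ.reg .tail)) D.allTriples σ) :
    D.IsSim (D.zset σ) := by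
  refine ⟨h.zset_sub, fun s x x' r y hm hpos => ?_⟩
  have hlt := lt_of_mem_labelPairs (h.zset_sub hm)
  have hlt' := lt_of_pos hpos
  obtain ⟨dead, h₁, h₂⟩ := h.rcPrev hlt'.2.1 hlt'.2.2 hlt.2
  have hx : x ∈ D.keep s x' (σ.vec (.prev s) (.prevLen s) [r, y]) :=
    mem_keep.2 ⟨(((h.graph s).prev r hlt'.2.1 y hlt'.2.2).mem x).2 hpos, h.zset_sub hm⟩
  -- the vertex `x` has not been deleted from `rcPrev[r, y, x']`, since the pair is in the relation
  rw [← h₁, List.mem_append] at hx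
  have hx' := hx.resolve_right fun hx => h₂ x hx hm
  obtain ⟨y', ⟨hI, hne⟩, hle⟩ := h.settled ⟨hlt'.2.1, hlt'.2.2, hlt.2⟩ x hx'
  refine ⟨y', ?_, hle⟩
  -- otherwise the pair has been removed and treated, and `y'` does not belong to the list any more
  by_contra hn
  obtain ⟨i, hi, he⟩ := h.queue_surj _ hI.2 hn
  exact hne i hi he

/-- One iteration of the main loop. -/
theorem wp_iteration (hN : D.Nodes N) (hσ : D.Sizes σ) {k : ℕ} (hk : σ.reg .head = k)
    (hlt : k < σ.reg .tail) (h : D.Core N (D.remaining σ k) D.allTriples σ) :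
    Wp (block [
      load (.ext .left) (.queue .left) [.head],
      load (.ext .right) (.queue .right) [.head],
      succ .head .head,
      propagate .left,
      propagate .right]) σ fun τ t =>
      D.Core N (D.remaining τ (k + 1)) D.allTriples τ ∧ QueueLE σ τ ∧ τ.reg .head = k + 1 ∧
      t + 1 + D.potential τ.arr ≤ D.potential σ.arr + D.iterTime (σ.qpair k) := by
  have hmem := (h.queue_mem k hlt).1
  have hne : ∀ i < k, σ.qpair i ≠ σ.qpair k := fun i hi he =>
    hi.ne (h.queue_inj i (hi.trans hlt) k hlt he)
  have hsucc := D.remaining_succ (σ := σ) k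
  have hq : σ.qpair k = (σ.arr (.queue .left) [k], σ.arr (.queue .right) [k]) := rfl
  generalize hp : σ.qpair k = p at *
  obtain ⟨a, b⟩ := p
  simp only [Prod.mk.injEq] at hq
  obtain ⟨ha, hb⟩ := hq
  simp only [wp_block_cons, wp_load, wp_succ, List.map_cons, List.map_nil, State.reg_setReg,
    reduceCtorEq, if_false, State.arr_setReg, hk, ← ha, ← hb]
  set ρ := ((σ.setReg (.ext .left) a).setReg (.ext .right) b).setReg .head (k + 1) with hρ
  have hρC : D.Core N (D.remaining σ k) D.allTriples ρ :=
    ((h.setReg _ (by simp)).setReg _ (by simp)).setReg _ (by simp)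
  have hρS : D.Sizes ρ := ⟨by simpa [hρ] using hσ.numP, by simpa [hρ] using hσ.numR,
    fun s => by simpa [hρ] using hσ.numV s, fun s => by simpa [hρ] using hσ.numE s⟩
  have hρQ : QueueLE σ ρ :=
    (((QueueLE.refl σ).setReg _ (by simp)).setReg _ (by simp)).setReg _ (by simp)
  refine Wp.mono (Wp.frame (wp_propagate hN hρS hρC .left (y₀ := a) (y₁ := b) (by simp [hρ])
    (by simp [hρ, Side.opp]) ⟨k, hlt.trans_le hρQ.1, (hρQ.2 k hlt).trans hp⟩ ?_)) ?_
  · intro r x' hpos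
    exact ⟨⟨hpos, hmem⟩, hne⟩
  rintro τ t ⟨⟨hτC, hτQ, ht⟩, hF⟩
  have hτS : D.Sizes τ := hρS.frame hF rfl rfl (fun s => by cases s <;> rfl)
    (fun s => by cases s <;> rfl)
  have hQ := hρQ.trans hτQ
  refine Wp.mono (Wp.frame (wp_propagate hN hτS hτC .right (y₀ := b) (y₁ := a) ?_ ?_
    ⟨k, hlt.trans_le hQ.1, (hQ.2 k hlt).trans hp⟩ ?_)) ?_
  · rw [hF.reg _ rfl]; simp [hρ]
  · rw [hF.reg _ rfl]; simp [hρ, Side.opp]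
  · intro r x' hpos
    refine ⟨⟨⟨hpos, hmem⟩, hne⟩, ?_⟩
    rintro ⟨_, _, he⟩
    simp at he
  rintro ω u ⟨⟨hωC, hωQ, hu⟩, hF'⟩
  rw [wp_block_nil]
  have hQ' := hQ.trans hωQ
  refine ⟨?_, hQ', ?_, ?_⟩
  · rw [remaining_congr fun i hi => hQ'.2 i (by omega), hsucc]
    exact hωC
  · rw [hF'.reg _ rfl, hF.reg _ rfl]; simp [hρ]
  · have : D.potential ρ.arr = D.potential σ.arr := rfl
    simp only [iterTime]
    omega

/-- The loop terminates since the queue contains pairs of vertices without repetitions. The first `head`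
pairs of the queue are those that have been treated. -/
theorem wp_mainLoop (hN : D.Nodes N) (hσ : D.Sizes σ) (hh : σ.reg .head = 0)
    (h : D.Core N (D.remaining σ 0) D.allTriples σ) :
    Wp (.loop (.lt .head .tail) (block [
      load (.ext .left) (.queue .left) [.head],
      load (.ext .right) (.queue .right) [.head],
      succ .head .head,
      propagate .left,
      propagate .right])) σ fun τ t =>
      D.IsSim (D.zset τ) ∧ (∀ Y, D.IsSim Y → Y ⊆ D.zset τ) ∧
      t ≤ 1 + D.potential σ.arr +
        ∑ p ∈ Finset.range (D.nV .left) ×ˢ Finset.range (D.nV .right), D.iterTime p := by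
  refine Wp.mono (wp_loop (fun τ t => D.Core N (D.remaining τ (τ.reg .head)) D.allTriples τ ∧
    τ.reg .head ≤ τ.reg .tail ∧ D.Sizes τ ∧ t + D.potential τ.arr ≤ D.potential σ.arr +
      ∑ i ∈ Finset.range (τ.reg .head), D.iterTime (τ.qpair i))
    (fun τ => D.nV .left * D.nV .right - τ.reg .head) ?_ ?_) ?_
  · rintro τ t ⟨hC, hle, hS, ht⟩ hlt
    have hlt : τ.reg .head < τ.reg .tail := hlt
    refine Wp.mono (Wp.frame (wp_iteration hN hS rfl hlt hC)) ?_
    rintro ρ u ⟨⟨h₁, h₂, h₃, h₄⟩, hF⟩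
    have := h₂.1
    refine ⟨⟨h₃ ▸ h₁, by omega, hS.frame hF rfl rfl (fun s => by cases s <;> rfl)
      (fun s => by cases s <;> rfl), ?_⟩, ?_⟩
    · rw [h₃, Finset.sum_range_succ, h₂.2 _ hlt, Finset.sum_congr rfl fun i hi => by
        rw [h₂.2 i ((Finset.mem_range.1 hi).trans hlt)]]
      omega
    · have := hC.tail_le
      omega
  · exact ⟨hh ▸ h, by omega, hσ, by omega⟩
  · rintro τ t ⟨u, rfl, ⟨hC, hle, -, hu⟩, hlt⟩
    have hlt : ¬ τ.reg .head < τ.reg .tail := hlt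
    have he : τ.reg .head = τ.reg .tail := by omega
    rw [he] at hC hu
    have := hC.sum_queue_le D.iterTime
    exact ⟨hC.isSim, hC.sound, by omega⟩

end Data

/-! ### The output -/

/-- The pair at position `i` of the output. -/
def State.outPair (σ : State) (i : ℕ) : ℕ × ℕ :=
  (σ.arr (.out .left) [i], σ.arr (.out .right) [i])

namespace Data

variable {D : Data} {σ : State}

/-- The output array may contain junk from `outLen` on, and the Boolean array `Z` outside the range of
the vertex numbers. -/
theorem wp_returnZ (hσ : D.Sizes σ) :
    Wp returnZ σ fun τ t =>
      (∀ p, (∃ i < τ.reg .outLen, τ.outPair i = p) ↔ p ∈ D.zset σ) ∧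
      t ≤ 3 + 4 * D.nV .left + 7 * (D.nV .left * D.nV .right) := by
  rw [returnZ, wp_block_cons, wp_const, wp_block_cons]
  refine Wp.mono (wp_for₂ (D.nV .left) (D.nV .right)
    (fun S τ => ∀ p, (∃ i < τ.reg .outLen, τ.outPair i = p) ↔ p ∈ S ∧ σ.arr .Z [p.1, p.2] = 1)
    (fun _ => 0) (fun _ _ => 5) (by simpa using hσ.numV .left) (by simpa using hσ.numV .right)
    rfl rfl rfl rfl ?_ (by simp) ?_) ?_
  · rintro S τ x k h (rfl | rfl) <;> simpa [State.outPair] using h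
  · intro S k hk l hl hS τ h hkr hlr hF
    have hZ : τ.arr .Z = σ.arr .Z := hF.arr _ rfl
    simp only [wp_block_cons, wp_load, wp_ite, wp_block_nil, wp_store, wp_succ, wp_skip, Test.holds,
      List.map_cons, List.map_nil, State.reg_setReg, State.reg_setArr, reduceCtorEq, if_false,
      if_true, hkr, hlr, hZ]
    refine ⟨fun h1 => ⟨?_, by omega⟩, fun h1 => ⟨?_, by omega⟩⟩
    · intro p
      set ρ := (((τ.setReg .bit (σ.arr .Z [k, l])).setArr (.out .left) [τ.reg .outLen] k).setArr
        (.out .right) [τ.reg .outLen] l).setReg .outLen (τ.reg .outLen + 1) with hρ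
      have hpair : ∀ i, ρ.outPair i = if i = τ.reg .outLen then (k, l) else τ.outPair i := by
        intro i
        simp only [hρ, State.outPair, State.arr_setReg, State.arr_setArr, reduceCtorEq,
          Arr.out.injEq, if_false, if_true, Function.update_apply, List.cons.injEq, and_true]
        split_ifs <;> rfl
      rw [Set.mem_insert_iff]
      constructor
      · rintro ⟨i, hi, rfl⟩
        rw [hpair]
        split_ifs with he
        · exact ⟨.inl rfl, h1⟩
        · have := (h (τ.outPair i)).1 ⟨i, by omega, rfl⟩
          exact ⟨.inr this.1, this.2⟩
      · rintro ⟨rfl | hp, hp'⟩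
        · exact ⟨τ.reg .outLen, by omega, by rw [hpair, if_pos rfl]⟩
        · obtain ⟨i, hi, he⟩ := (h p).2 ⟨hp, hp'⟩
          exact ⟨i, by omega, by rw [hpair, if_neg hi.ne, he]⟩
    · intro p
      have h := h p
      simp only [State.outPair, State.arr_setReg, Set.mem_insert_iff] at h ⊢
      rw [h]
      refine ⟨fun h => ⟨.inr h.1, h.2⟩, fun ⟨h', h''⟩ => ⟨h'.resolve_left ?_, h''⟩⟩
      rintro rfl
      exact h1 h''
  · rintro τ t ⟨h₁, h₂⟩
    rw [wp_block_nil]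
    refine ⟨fun p => (h₁ p).trans ⟨fun h => ⟨h.1.1, h.1.2, h.2⟩, fun h => ⟨⟨h.1, h.2.1⟩, h.2.2⟩⟩, ?_⟩
    simp only [Finset.sum_const, Finset.card_range, smul_eq_mul] at h₂
    linarith

end Data

/-! ### The initialization of the graph arrays -/

theorem wp_block_append {cs ds : List Cmd} {σ : State} {Q : State → ℕ → Prop} :
    Wp (block (cs ++ ds)) σ Q ↔
      Wp (block cs) σ fun τ t => Wp (block ds) τ fun ρ u => Q ρ (t + u) := by
  induction cs generalizing σ Q with
  | nil => simp
  | cons c cs ih => simp only [List.cons_append, wp_block_cons, ih, add_assoc]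

namespace Data

variable {D : Data} {σ τ : State}

theorem Built.congr {s : Side} {e : ℕ} (h : D.Built s e σ)
    (h₁ : τ.warr (.edge s) = σ.warr (.edge s)) (h₂ : τ.arr (.edgeID s) = σ.arr (.edgeID s))
    (h₃ : τ.arr (.next s) = σ.arr (.next s)) (h₄ : τ.arr (.nextLen s) = σ.arr (.nextLen s))
    (h₅ : τ.arr (.prev s) = σ.arr (.prev s)) (h₆ : τ.arr (.prevLen s) = σ.arr (.prevLen s)) :
    D.Built s e τ := by
  constructor
  · rw [h₁]; exact h.edge
  · rw [h₂]; exact h.edgeID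
  · rw [State.vec_congr h₃ h₄]; exact h.next
  · rw [State.vec_congr h₅ h₆]; exact h.prev

/-- A bound for the time of `buildGraph`. -/
def buildTime (D : Data) (s : Side) : ℕ :=
  4 + 4 * D.nR + D.nR * (D.nV s * (3 * D.nV s + 10)) + 16 * D.m s

theorem wp_buildGraphs (hσ : D.Sizes σ) (hin : D.Input σ) :
    Wp (block [buildGraph .left, buildGraph .right, initZ, const .head 0, const .tail 0]) σ
      fun τ t => (∀ s, D.Built s (D.m s) τ) ∧ D.ZInit τ ∧ τ.reg .head = 0 ∧ τ.reg .tail = 0 ∧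
        t ≤ D.buildTime .left + D.buildTime .right + (4 + 4 * D.nV .left +
          D.nV .left * (D.nV .right * (6 * D.nP + 6))) := by
  rw [wp_block_cons]
  refine Wp.mono (Wp.frame (D.wp_buildGraph .left hσ hin)) ?_
  rintro σ₁ t₁ ⟨⟨hB₁, ht₁⟩, hF₁⟩
  have hσ₁ : D.Sizes σ₁ := hσ.frame hF₁ rfl rfl (fun _ => rfl) fun _ => rfl
  have hin₁ : D.Input σ₁ := hin.frame hF₁ (fun _ => rfl) (fun _ => rfl) (fun _ => rfl)
    (fun _ => rfl) fun _ => rfl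
  rw [wp_block_cons]
  refine Wp.mono (Wp.frame (D.wp_buildGraph .right hσ₁ hin₁)) ?_
  rintro σ₂ t₂ ⟨⟨hB₂, ht₂⟩, hF₂⟩
  have hσ₂ : D.Sizes σ₂ := hσ₁.frame hF₂ rfl rfl (fun _ => rfl) fun _ => rfl
  have hin₂ : D.Input σ₂ := hin₁.frame hF₂ (fun _ => rfl) (fun _ => rfl) (fun _ => rfl)
    (fun _ => rfl) fun _ => rfl
  have hB₁' : D.Built .left (D.m .left) σ₂ := hB₁.congr (hF₂.warr _ rfl) (hF₂.arr _ rfl)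
    (hF₂.arr _ rfl) (hF₂.arr _ rfl) (hF₂.arr _ rfl) (hF₂.arr _ rfl)
  rw [wp_block_cons]
  refine Wp.mono (Wp.frame (D.wp_initZ hσ₂ hin₂)) ?_
  rintro σ₃ t₃ ⟨⟨hZ, ht₃⟩, hF₃⟩
  simp only [wp_block_cons, wp_const, wp_block_nil]
  refine ⟨fun s => ?_, hZ, by simp, by simp, ?_⟩
  · have : D.Built s (D.m s) σ₂ := by cases s <;> assumption
    exact this.congr (hF₃.warr _ rfl) (hF₃.arr _ rfl) (hF₃.arr _ rfl) (hF₃.arr _ rfl)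
      (hF₃.arr _ rfl) (hF₃.arr _ rfl)
  · simp only [buildTime]
    omega

theorem wp_sortVectors (hσ : D.Sizes σ) (hB : ∀ s, D.Built s (D.m s) σ) :
    Wp (block [sortNext .left, sortNext .right, sortPrev .left, sortPrev .right]) σ fun τ t =>
      (∀ s, D.GraphReady s τ) ∧ t ≤ 2 * D.sortTime .left + 2 * D.sortTime .right := by
  have hE : ∀ τ : State, (∀ s, τ.warr (.edge s) = σ.warr (.edge s)) → ∀ s, ∀ x < D.nV s,
      ∀ r < D.nR, ∀ y < D.nV s, τ.warr (.edge s) [x, r, y] = D.W s x r y := by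
    intro τ h s x hx r hr y hy
    rw [h]
    exact (hB s).edge_eq hx hr hy
  rw [wp_block_cons]
  refine Wp.mono (Wp.frame (D.wp_sortNext .left hσ (hE σ (fun _ => rfl) _) (hB _).next)) ?_
  rintro σ₁ t₁ ⟨⟨h₁, ht₁⟩, hF₁⟩
  have hσ₁ : D.Sizes σ₁ := hσ.frame hF₁ rfl rfl (fun _ => rfl) fun _ => rfl
  have hw₁ : ∀ s, σ₁.warr (.edge s) = σ.warr (.edge s) := fun s => hF₁.warr _ rfl
  rw [wp_block_cons]
  refine Wp.mono (Wp.frame (D.wp_sortNext .right hσ₁ (hE σ₁ hw₁ _) ?_)) ?_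
  · rw [State.vec_congr (hF₁.arr _ rfl) (hF₁.arr _ rfl)]
    exact (hB _).next
  rintro σ₂ t₂ ⟨⟨h₂, ht₂⟩, hF₂⟩
  have hσ₂ : D.Sizes σ₂ := hσ₁.frame hF₂ rfl rfl (fun _ => rfl) fun _ => rfl
  have hw₂ : ∀ s, σ₂.warr (.edge s) = σ.warr (.edge s) := fun s => (hF₂.warr _ rfl).trans (hw₁ s)
  rw [wp_block_cons]
  refine Wp.mono (Wp.frame (D.wp_sortPrev .left hσ₂ (hE σ₂ hw₂ _) ?_)) ?_
  · rw [State.vec_congr (hF₂.arr _ rfl) (hF₂.arr _ rfl),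
      State.vec_congr (hF₁.arr _ rfl) (hF₁.arr _ rfl)]
    exact (hB _).prev
  rintro σ₃ t₃ ⟨⟨h₃, ht₃⟩, hF₃⟩
  have hσ₃ : D.Sizes σ₃ := hσ₂.frame hF₃ rfl rfl (fun _ => rfl) fun _ => rfl
  have hw₃ : ∀ s, σ₃.warr (.edge s) = σ.warr (.edge s) := fun s => (hF₃.warr _ rfl).trans (hw₂ s)
  rw [wp_block_cons]
  refine Wp.mono (Wp.frame (D.wp_sortPrev .right hσ₃ (hE σ₃ hw₃ _) ?_)) ?_
  · rw [State.vec_congr (hF₃.arr _ rfl) (hF₃.arr _ rfl),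
      State.vec_congr (hF₂.arr _ rfl) (hF₂.arr _ rfl),
      State.vec_congr (hF₁.arr _ rfl) (hF₁.arr _ rfl)]
    exact (hB _).prev
  rintro σ₄ t₄ ⟨⟨h₄, ht₄⟩, hF₄⟩
  have hw₄ : ∀ s, σ₄.warr (.edge s) = σ.warr (.edge s) := fun s => (hF₄.warr _ rfl).trans (hw₃ s)
  have hid : ∀ s, σ₄.arr (.edgeID s) = σ.arr (.edgeID s) := fun s =>
    (hF₄.arr _ rfl).trans ((hF₃.arr _ rfl).trans ((hF₂.arr _ rfl).trans (hF₁.arr _ rfl)))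
  rw [wp_block_nil]
  refine ⟨fun s => ⟨hE σ₄ hw₄ s, fun h h' => by rw [hid]; exact (hB s).edgeID_inj h h', ?_, ?_⟩,
    by omega⟩
  · cases s
    · rw [State.vec_congr (hF₄.arr _ rfl) (hF₄.arr _ rfl),
        State.vec_congr (hF₃.arr _ rfl) (hF₃.arr _ rfl),
        State.vec_congr (hF₂.arr _ rfl) (hF₂.arr _ rfl)]
      exact h₁
    · rw [State.vec_congr (hF₄.arr _ rfl) (hF₄.arr _ rfl),
        State.vec_congr (hF₃.arr _ rfl) (hF₃.arr _ rfl)]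
      exact h₂
  · cases s
    · rw [State.vec_congr (hF₄.arr _ rfl) (hF₄.arr _ rfl)]
      exact h₃
    · exact h₄

theorem wp_clearElems (hσ : D.Sizes σ) :
    Wp (block [clearElem .right, clearElem .left, const .alloc 0]) σ fun _ t =>
      t ≤ 7 + 4 * D.nV .left + 4 * D.nV .right +
        3 * (D.nV .left * D.m .right + D.nV .right * D.m .left) := by
  rw [wp_block_cons]
  refine Wp.mono (Wp.frame (D.wp_clearElem .right hσ)) ?_
  rintro σ₁ t₁ ⟨ht₁, hF₁⟩
  have hσ₁ : D.Sizes σ₁ := hσ.frame hF₁ rfl rfl (fun _ => rfl) fun _ => rfl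
  rw [wp_block_cons]
  refine Wp.mono (D.wp_clearElem .left hσ₁) ?_
  rintro σ₂ t₂ ht₂
  simp only [wp_block_cons, wp_const, wp_block_nil]
  simp only [Side.opp] at ht₁ ht₂
  linarith

end Data

/-! ### The initialization of the lists and the whole algorithm -/

namespace Data

variable {D : Data} {σ τ : State}

theorem RcBuilt.congr {s : Side} {a r y x' : ℕ} (h : D.RcBuilt s a r y x' σ)
    (hv : τ.vec (.rcPrev s) (.rcPrevLen s) = σ.vec (.rcPrev s) (.rcPrevLen s))
    (hv' : τ.vec (.prev s) (.prevLen s) = σ.vec (.prev s) (.prevLen s))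
    (hid : τ.arr (.edgeID s.opp) = σ.arr (.edgeID s.opp))
    (hel : τ.arr (.rcNextElem s.opp) = σ.arr (.rcNextElem s.opp))
    (hla : τ.arr (.rcNextLast s.opp) = σ.arr (.rcNextLast s.opp))
    (hal : σ.reg .alloc ≤ τ.reg .alloc)
    (hu : ∀ u ≤ σ.reg .alloc, τ.arr .elemKey [u] = σ.arr .elemKey [u] ∧
      τ.arr .elemBefore [u] = σ.arr .elemBefore [u] ∧
      τ.arr .elemAfter [u] = σ.arr .elemAfter [u]) : D.RcBuilt s a r y x' τ := by
  have hn : ∀ y', τ.node s r y x' y' = σ.node s r y x' y' := fun y' => by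
    simp only [State.node, hid, hel]
  refine ⟨by rw [hv, hv']; exact h.rcPrev, ?_, ?_, ?_, ?_, ?_⟩
  · simp only [hn]; exact h.lt_node
  · simp only [hn]; exact fun y' hy => (h.node_le y' hy).trans hal
  · intro y' hy
    rw [hn, (hu _ (h.node_le y' hy)).1]
    exact h.key y' hy
  · simp only [hn]; exact h.mono
  · simp only [hn, hla]
    refine h.linked.congr ?_ ?_
    · rintro u ⟨y', hy, rfl⟩
      exact (hu _ (h.node_le y' hy)).2.1
    · rintro u ⟨y', hy, rfl⟩
      exact (hu _ (h.node_le y' hy)).2.2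

/-- The vectors `rcPrev` have few entries at the beginning. -/
theorem sidePotential_le {s : Side} {a : ℕ} (hG : D.GraphReady s σ)
    (h : ∀ r < D.nR, ∀ y < D.nV s, ∀ x' < D.nV s.opp, D.RcBuilt s a r y x' σ) :
    D.sidePotential s σ.arr ≤ 16 * (D.nV s.opp * D.m s) := by
  rw [sidePotential, Finset.sum_product]
  refine Nat.mul_le_mul_left _ ?_
  calc _ ≤ ∑ r ∈ Finset.range D.nR, ∑ q ∈ Finset.range (D.nV s) ×ˢ Finset.range (D.nV s.opp),
        (D.prevList s r q.1 (D.m s)).length := by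
        refine Finset.sum_le_sum fun r hr => Finset.sum_le_sum fun q hq => ?_
        simp only [Finset.mem_product, Finset.mem_range] at hr hq
        rw [← σ.length_vec (.rcPrev s), (h r hr _ hq.1 _ hq.2).rcPrev,
          ← (hG.prev r hr _ hq.1).length]
        exact List.length_filter_le _ _
    _ = D.nV s.opp * D.m s := by
        simp only [Finset.sum_product, Finset.sum_const, Finset.card_range, smul_eq_mul,
          ← Finset.mul_sum]
        rw [sum_length_prevList]

theorem wp_buildLists (hσ : D.Sizes σ) (hZ : D.ZInit σ) (hG : ∀ s, D.GraphReady s σ)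
    (ht : σ.reg .tail = 0) :
    Wp (block [buildRc .left, buildRc .right]) σ fun τ t =>
      (∃ N, D.Nodes N ∧ D.Core N (D.remaining τ 0) ∅ τ) ∧
      t + D.potential τ.arr ≤ D.rcTime .left + D.rcTime .right +
        16 * (D.nV .right * D.m .left + D.nV .left * D.m .right) := by
  rw [wp_block_cons]
  refine Wp.mono (Wp.frame (D.wp_buildRc .left hσ hZ (hG _) (hG _))) ?_
  rintro σ₁ t₁ ⟨⟨hb₁, hi₁, -, ha₁, ht₁⟩, hF₁⟩
  have hσ₁ : D.Sizes σ₁ := hσ.frame hF₁ rfl rfl (fun _ => rfl) fun _ => rfl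
  have hG₁ : ∀ s, D.GraphReady s σ₁ := fun s => (hG s).congr (hF₁.warr _ rfl) (hF₁.arr _ rfl)
    (hF₁.arr _ rfl) (hF₁.arr _ rfl) (hF₁.arr _ rfl) (hF₁.arr _ rfl)
  have hZ₁ : D.ZInit σ₁ := by
    rw [ZInit, hF₁.arr _ rfl]
    exact hZ
  rw [wp_block_cons]
  refine Wp.mono (Wp.frame (D.wp_buildRc .right hσ₁ hZ₁ (hG₁ _) (hG₁ _))) ?_
  rintro σ₂ t₂ ⟨⟨hb₂, hi₂, hu, ha₂, ht₂⟩, hF₂⟩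
  have hG₂ : ∀ s, D.GraphReady s σ₂ := fun s => (hG₁ s).congr (hF₂.warr _ rfl) (hF₂.arr _ rfl)
    (hF₂.arr _ rfl) (hF₂.arr _ rfl) (hF₂.arr _ rfl) (hF₂.arr _ rfl)
  have hZ₂ : D.zset σ₂ = D.labelPairs := by
    ext p
    have hz := hF₂.arr .Z rfl
    simp only [zset, Set.mem_ofPred_eq, hz]
    exact ⟨fun h => (hZ₁ _ h.1 _ h.2.1).1 h.2.2, fun h => ⟨h.1, h.2.1, (hZ₁ _ h.1 _ h.2.1).2 h⟩⟩
  have htail : σ₂.reg .tail = 0 := by rw [hF₂.reg _ rfl, hF₁.reg _ rfl, ht]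
  have hnode : ∀ r y x' y', σ₂.node .left r y x' y' = σ₁.node .left r y x' y' := fun r y x' y' => by
    simp only [State.node, Side.opp, hF₂.arr (.edgeID .right) rfl, hF₂.arr (.rcNextElem .right) rfl]
  have hb₁' : ∀ r < D.nR, ∀ y < D.nV .left, ∀ x' < D.nV .right,
      D.RcBuilt .left (σ.reg .alloc) r y x' σ₂ := fun r hr y hy x' hx' =>
    (hb₁ r hr y hy x' hx').congr (State.vec_congr (hF₂.arr _ rfl) (hF₂.arr _ rfl))
      (State.vec_congr (hF₂.arr _ rfl) (hF₂.arr _ rfl)) (hF₂.arr _ rfl) (hF₂.arr _ rfl)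
      (hF₂.arr _ rfl) ha₂ hu
  have hb : ∀ s, ∃ a, ∀ r < D.nR, ∀ y < D.nV s, ∀ x' < D.nV s.opp, D.RcBuilt s a r y x' σ₂ := by
    intro s
    cases s
    · exact ⟨_, hb₁'⟩
    · exact ⟨_, hb₂⟩
  have hlt : ∀ {s r y x' y'}, D.InitAlive s r y x' y' →
      r < D.nR ∧ y < D.nV s ∧ x' < D.nV s.opp := fun h =>
    ⟨(lt_of_pos h.1).2.1, (lt_of_mem_labelPairs h.2).1, (lt_of_pos h.1).1⟩
  -- the elements of the lists on the two sides are separated by the value of `alloc` in between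
  have hleft : ∀ {r y x' y'}, D.InitAlive .left r y x' y' →
      σ₂.node .left r y x' y' ≤ σ₁.reg .alloc := fun h => by
    rw [hnode]
    exact (hb₁ _ (hlt h).1 _ (hlt h).2.1 _ (hlt h).2.2).node_le _ h
  have hright : ∀ {r y x' y'}, D.InitAlive .right r y x' y' →
      σ₁.reg .alloc < σ₂.node .right r y x' y' := fun h =>
    (hb₂ _ (hlt h).1 _ (hlt h).2.1 _ (hlt h).2.2).lt_node _ h
  have hinj : ∀ {s r y x' y' r₁ y₁ x₁ z₁}, D.InitAlive s r y x' y' → D.InitAlive s r₁ y₁ x₁ z₁ →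
      σ₂.node s r y x' y' = σ₂.node s r₁ y₁ x₁ z₁ → r = r₁ ∧ y = y₁ ∧ x' = x₁ := by
    intro s r y x' y' r₁ y₁ x₁ z₁ h h' he
    cases s
    · rw [hnode, hnode] at he
      exact hi₁ _ (hlt h).1 _ (hlt h).2.1 _ (hlt h).2.2 _ (hlt h').1 _ (hlt h').2.1 _ (hlt h').2.2
        _ _ h h' he
    · exact hi₂ _ (hlt h).1 _ (hlt h).2.1 _ (hlt h).2.2 _ (hlt h').1 _ (hlt h').2.1 _ (hlt h').2.2
        _ _ h h' he
  rw [wp_block_nil]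
  refine ⟨⟨fun s r y x' y' => σ₂.node s r y x' y', ⟨?_, ?_, ?_⟩, ⟨hG₂, fun h => h.1, fun _ => rfl,
    ?_, ?_, ?_, ?_, hZ₂.le, ?_, ?_, ?_, ?_, ?_⟩⟩, ?_⟩
  · intro s r y x' y' h
    obtain ⟨a, hb⟩ := hb s
    exact ((hb _ (hlt h).1 _ (hlt h).2.1 _ (hlt h).2.2).lt_node _ h).ne_bot
  · intro s r y x' y' s₁ r₁ y₁ x₁ z₁ h h' he
    have hs : s = s₁ := by
      cases s <;> cases s₁
      · rfl
      · exact absurd he ((hleft h).trans_lt (hright h')).ne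
      · exact absurd he ((hleft h').trans_lt (hright h)).ne'
      · rfl
    subst hs
    obtain ⟨rfl, rfl, rfl⟩ := hinj h h' he
    obtain ⟨a, hb⟩ := hb s
    have hB := hb _ (hlt h).1 _ (hlt h).2.1 _ (hlt h).2.2
    refine ⟨rfl, rfl, rfl, rfl, ?_⟩
    rw [← hB.key _ h, ← hB.key _ h', he]
  · intro s r y x' y₁ y₂ h h' hle
    obtain ⟨a, hb⟩ := hb s
    exact (hb _ (hlt h).1 _ (hlt h).2.1 _ (hlt h).2.2).mono _ _ h h' hle
  · intro s r y x' y' h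
    obtain ⟨a, hb⟩ := hb s
    have h := h.1
    exact (hb _ (hlt h).1 _ (hlt h).2.1 _ (hlt h).2.2).key _ h
  · intro s r y x' hr hy hx'
    obtain ⟨a, hb⟩ := hb s
    convert (hb r hr y hy x' hx').linked using 1
    ext u
    simp [members, remaining]
  · intro s r y x' hr hy hx'
    obtain ⟨a, hb⟩ := hb s
    exact ⟨[], by rw [List.append_nil, (hb r hr y hy x' hx').rcPrev], by simp⟩
  · simp
  · intro s r y x' y' h hpos
    exact ⟨⟨hpos, hZ₂ ▸ h⟩, by simp⟩
  · intro Y hY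
    rw [hZ₂]
    exact hY.1
  · simp [htail]
  · simp [htail]
  · intro p hp hp'
    exact absurd (hZ₂ ▸ hp) hp'
  · have h₁ := sidePotential_le (hG₂ .left) hb₁'
    have h₂ := sidePotential_le (hG₂ .right) hb₂
    simp only [potential, Side.opp] at h₁ h₂ ⊢
    omega

/-- A bound for the time of the initialization. -/
def initTime (D : Data) : ℕ :=
  (D.buildTime .left + D.buildTime .right + (4 + 4 * D.nV .left +
    D.nV .left * (D.nV .right * (6 * D.nP + 6)))) +
  (2 * D.sortTime .left + 2 * D.sortTime .right) +
  (7 + 4 * D.nV .left + 4 * D.nV .right +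
    3 * (D.nV .left * D.m .right + D.nV .right * D.m .left)) +
  (D.rcTime .left + D.rcTime .right +
    16 * (D.nV .right * D.m .left + D.nV .left * D.m .right)) +
  (2 + 4 * D.nR + 4 * (D.nR * D.nV .left) + D.nR * (D.nV .left * (D.nV .right * 17))) +
  (2 + 4 * D.nR + 4 * (D.nR * D.nV .right) + D.nR * (D.nV .right * (D.nV .left * 17)))

theorem wp_initializeDS (hσ : D.Sizes σ) (hin : D.Input σ) :
    Wp initializeDS σ fun τ t =>
      (∃ N, D.Nodes N ∧ D.Core N (D.remaining τ 0) D.allTriples τ) ∧ τ.reg .head = 0 ∧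
      t + D.potential τ.arr ≤ D.initTime := by
  have heq : initializeDS = block (
      [buildGraph .left, buildGraph .right, initZ, const .head 0, const .tail 0] ++
      ([sortNext .left, sortNext .right, sortPrev .left, sortPrev .right] ++
      ([clearElem .right, clearElem .left, const .alloc 0] ++
      ([buildRc .left, buildRc .right] ++ [updateAll .left, updateAll .right])))) := rfl
  rw [heq, wp_block_append]
  refine Wp.mono (Wp.frame (wp_buildGraphs hσ hin)) ?_
  rintro σ₁ t₁ ⟨⟨hB₁, hZ₁, hh₁, hl₁, ht₁⟩, hF₁⟩
  have hσ₁ : D.Sizes σ₁ := hσ.frame hF₁ rfl rfl (fun _ => rfl) fun _ => rfl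
  rw [wp_block_append]
  refine Wp.mono (Wp.frame (wp_sortVectors hσ₁ hB₁)) ?_
  rintro σ₂ t₂ ⟨⟨hG₂, ht₂⟩, hF₂⟩
  have hσ₂ : D.Sizes σ₂ := hσ₁.frame hF₂ rfl rfl (fun _ => rfl) fun _ => rfl
  rw [wp_block_append]
  refine Wp.mono (Wp.frame (wp_clearElems hσ₂)) ?_
  rintro σ₃ t₃ ⟨ht₃, hF₃⟩
  have hσ₃ : D.Sizes σ₃ := hσ₂.frame hF₃ rfl rfl (fun _ => rfl) fun _ => rfl
  have hG₃ : ∀ s, D.GraphReady s σ₃ := fun s => (hG₂ s).congr (hF₃.warr _ rfl) (hF₃.arr _ rfl)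
    (hF₃.arr _ rfl) (hF₃.arr _ rfl) (hF₃.arr _ rfl) (hF₃.arr _ rfl)
  have hZ₃ : D.ZInit σ₃ := by
    rw [ZInit, hF₃.arr _ rfl, hF₂.arr _ rfl]
    exact hZ₁
  rw [wp_block_append]
  refine Wp.mono (Wp.frame (wp_buildLists hσ₃ hZ₃ hG₃ ?_)) ?_
  · rw [hF₃.reg _ rfl, hF₂.reg _ rfl, hl₁]
  rintro σ₄ t₄ ⟨⟨⟨N, hN, hC₄⟩, ht₄⟩, hF₄⟩
  have hσ₄ : D.Sizes σ₄ := hσ₃.frame hF₄ rfl rfl (fun _ => rfl) fun _ => rfl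
  rw [wp_block_cons]
  refine Wp.mono (Wp.frame (wp_updateAll hN hσ₄ hC₄ .left)) ?_
  rintro σ₅ t₅ ⟨⟨hC₅, ht₅⟩, hF₅⟩
  have hσ₅ : D.Sizes σ₅ := hσ₄.frame hF₅ rfl rfl (fun _ => rfl) fun _ => rfl
  rw [wp_block_cons]
  refine Wp.mono (Wp.frame (wp_updateAll hN hσ₅ hC₅ .right)) ?_
  rintro σ₆ t₆ ⟨⟨hC₆, ht₆⟩, hF₆⟩
  rw [wp_block_nil]
  refine ⟨⟨N, hN, ?_⟩, ?_, ?_⟩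
  · rw [remaining_congr (σ := σ₄) (by simp)]
    refine hC₆.settled_mono ?_
    rintro ⟨s, q⟩ hq
    cases s
    · exact .inr (.inl ⟨rfl, hq⟩)
    · exact .inl ⟨rfl, hq⟩
  · rw [hF₆.reg _ rfl, hF₅.reg _ rfl, hF₄.reg _ rfl, hF₃.reg _ rfl, hF₂.reg _ rfl, hh₁]
  · simp only [Side.opp] at ht₅ ht₆
    simp only [initTime]
    omega

/-- A bound for the time of the algorithm. -/
def totalTime (D : Data) : ℕ :=
  D.initTime + (1 + (4 * (D.nV .left * D.nV .right) +
      D.nV .left * (2 * D.nV .right + 28 * D.m .right + 5 * (D.nR * D.nV .right)) +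
      D.nV .right * (2 * D.nV .left + 28 * D.m .left + 5 * (D.nR * D.nV .left)))) +
    (3 + 4 * D.nV .left + 7 * (D.nV .left * D.nV .right))

theorem wp_compute (hσ : D.Sizes σ) (hin : D.Input σ) :
    Wp computeDirectedSimulationEfficiently σ fun τ t =>
      ∃ Z, D.IsSim Z ∧ (∀ Y, D.IsSim Y → Y ⊆ Z) ∧
        (∀ p, (∃ i < τ.reg .outLen, τ.outPair i = p) ↔ p ∈ Z) ∧ t ≤ D.totalTime := by
  rw [computeDirectedSimulationEfficiently, wp_block_cons]
  refine Wp.mono (Wp.frame (wp_initializeDS hσ hin)) ?_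
  rintro σ₁ t₁ ⟨⟨⟨N, hN, hC⟩, hh, ht₁⟩, hF₁⟩
  have hσ₁ : D.Sizes σ₁ := hσ.frame hF₁ rfl rfl (fun _ => rfl) fun _ => rfl
  rw [wp_block_cons]
  refine Wp.mono (Wp.frame (wp_mainLoop hN hσ₁ hh hC)) ?_
  rintro σ₂ t₂ ⟨⟨hsim, hmax, ht₂⟩, hF₂⟩
  have hσ₂ : D.Sizes σ₂ := hσ₁.frame hF₂ rfl rfl (fun s => by cases s <;> rfl)
    fun s => by cases s <;> rfl
  rw [wp_block_cons]
  refine Wp.mono (wp_returnZ hσ₂) ?_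
  rintro σ₃ t₃ ⟨hout, ht₃⟩
  rw [wp_block_nil]
  refine ⟨D.zset σ₂, hsim, hmax, hout, ?_⟩
  rw [sum_iterTime] at ht₂
  simp only [totalTime]
  omega

end Data

/-! ### The time bound -/

namespace Data

/-- The constant in the time bound, for given numbers of vertex labels and edge labels; `500` exceeds
the sums of the numerical coefficients in `totalTime`. -/
def timeConst (nP nR : ℕ) : ℕ := 500 * (1 + nP + nR)

theorem totalTime_le (D : Data) {n m : ℕ} (hn : n = D.nV .left + D.nV .right)
    (hm : m = D.m .left + D.m .right) (hpos : 0 < n) :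
    D.totalTime ≤ timeConst D.nP D.nR * ((m + n) * n) := by
  simp only [totalTime, initTime, buildTime, sortTime, rcTime, timeConst, Side.opp]
  generalize D.nV .left = a at *
  generalize D.nV .right = b at *
  generalize D.m .left = k at *
  generalize D.m .right = l at *
  generalize D.nR = r
  generalize D.nP = p
  -- every monomial in the bound that is free of the numbers of labels is at most `(m + n) * n`
  have hA : ∀ x y, x ≤ m + n → y ≤ n → x * y ≤ (m + n) * n := fun x y hx hy => Nat.mul_le_mul hx hy
  have h₀ := hA 1 1 (by omega) hpos
  have h₁ := hA a 1 (by omega) hpos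
  have h₂ := hA b 1 (by omega) hpos
  have h₃ := hA k 1 (by omega) hpos
  have h₄ := hA l 1 (by omega) hpos
  have h₅ := hA a a (by omega) (by omega)
  have h₆ := hA a b (by omega) (by omega)
  have h₇ := hA b b (by omega) (by omega)
  have h₈ := hA k a (by omega) (by omega)
  have h₉ := hA k b (by omega) (by omega)
  have h₁₀ := hA l a (by omega) (by omega)
  have h₁₁ := hA l b (by omega) (by omega)
  generalize (m + n) * n = A at *
  have r₀ := Nat.mul_le_mul_left r h₀
  have r₁ := Nat.mul_le_mul_left r h₁
  have r₂ := Nat.mul_le_mul_left r h₂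
  have r₅ := Nat.mul_le_mul_left r h₅
  have r₆ := Nat.mul_le_mul_left r h₆
  have r₇ := Nat.mul_le_mul_left r h₇
  have p₆ := Nat.mul_le_mul_left p h₆
  have hp := Nat.zero_le (p * A)
  linarith

end Data

/-! ### Numbering the vertices and labels of fuzzy graphs -/

/-- The degree of the edge between vertices and with a label that are given by their numbers; it is
zero if some argument is not the number of anything. -/
noncomputable def edgeDeg {P R V : Type*} [Fintype R] [Fintype V]
    (numR : R ≃ Fin (Fintype.card R)) (numV : V ≃ Fin (Fintype.card V)) (G : FuzzyGraph P R V)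
    (x r y : ℕ) : unitInterval :=
  if h : x < Fintype.card V ∧ r < Fintype.card R ∧ y < Fintype.card V then
    G.E (numV.symm ⟨x, h.1⟩) (numR.symm ⟨r, h.2.1⟩) (numV.symm ⟨y, h.2.2⟩) else 0

/-- The degree of a vertex label of a vertex, both given by their numbers. -/
noncomputable def labelDeg {P R V : Type*} [Fintype P] [Fintype V]
    (numP : P ≃ Fin (Fintype.card P)) (numV : V ≃ Fin (Fintype.card V)) (G : FuzzyGraph P R V)
    (x p : ℕ) : unitInterval :=
  if h : x < Fintype.card V ∧ p < Fintype.card P then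
    G.L (numV.symm ⟨x, h.1⟩) (numP.symm ⟨p, h.2⟩) else 0

theorem exists_num {α : Type*} [Fintype α] (num : α ≃ Fin (Fintype.card α)) {i : ℕ}
    (h : i < Fintype.card α) : ∃ a, i = num a :=
  ⟨num.symm ⟨i, h⟩, by simp⟩

theorem num_inj {α : Type*} [Fintype α] (num : α ≃ Fin (Fintype.card α)) {a b : α}
    (h : (num a : ℕ) = num b) : a = b :=
  num.injective (Fin.ext h)

@[simp] theorem labelDeg_num {P R V : Type*} [Fintype P] [Fintype V]
    {numP : P ≃ Fin (Fintype.card P)} {numV : V ≃ Fin (Fintype.card V)} {G : FuzzyGraph P R V}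
    (a : V) (q : P) : labelDeg numP numV G (numV a) (numP q) = G.L a q := by
  simp [labelDeg]

section OneGraph

variable {P R V : Type*} [Fintype R] [Fintype V] {numR : R ≃ Fin (Fintype.card R)}
  {numV : V ≃ Fin (Fintype.card V)} {G : FuzzyGraph P R V}

@[simp] theorem edgeDeg_num (a : V) (q : R) (b : V) :
    edgeDeg numR numV G (numV a) (numR q) (numV b) = G.E a q b := by
  simp [edgeDeg]

theorem exists_of_edgeDeg_pos {x r y : ℕ} (h : 0 < edgeDeg numR numV G x r y) :
    ∃ a q b, x = numV a ∧ r = numR q ∧ y = numV b ∧ 0 < G.E a q b := by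
  have hlt : x < Fintype.card V ∧ r < Fintype.card R ∧ y < Fintype.card V := by
    by_contra hn
    simp [edgeDeg, hn] at h
  obtain ⟨a, rfl⟩ := exists_num numV hlt.1
  obtain ⟨q, rfl⟩ := exists_num numR hlt.2.1
  obtain ⟨b, rfl⟩ := exists_num numV hlt.2.2
  exact ⟨a, q, b, rfl, rfl, rfl, by simpa using h⟩

namespace HoldsGraph

variable [Fintype P] {numP : P ≃ Fin (Fintype.card P)} {s : Side} {σ : State}

theorem edge_of_lt (h : HoldsGraph numP numR numV G s σ) {i : ℕ} (hi : i < σ.reg (.numE s)) :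
    ∃ a q b, 0 < G.E a q b ∧ σ.arr (.inSrc s) [i] = numV a ∧ σ.arr (.inLab s) [i] = numR q ∧
      σ.arr (.inDst s) [i] = numV b ∧ σ.warr (.inDeg s) [i] = G.E a q b := by
  obtain ⟨f, hf⟩ := h.edges
  rw [h.numEdges] at hi
  exact ⟨_, _, _, (f ⟨i, hi⟩).2, hf ⟨i, hi⟩⟩

theorem exists_edge (h : HoldsGraph numP numR numV G s σ) {x r y : ℕ}
    (hpos : 0 < edgeDeg numR numV G x r y) : ∃ i < σ.reg (.numE s),
      σ.arr (.inSrc s) [i] = x ∧ σ.arr (.inLab s) [i] = r ∧ σ.arr (.inDst s) [i] = y := by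
  obtain ⟨a, q, b, rfl, rfl, rfl, hE⟩ := exists_of_edgeDeg_pos hpos
  obtain ⟨f, hf⟩ := h.edges
  have := hf (f.symm ⟨(a, q, b), hE⟩)
  rw [Equiv.apply_symm_apply] at this
  exact ⟨_, (Fin.is_lt _).trans_eq h.numEdges.symm, this.1, this.2.1, this.2.2.1⟩

theorem edge_inj (h : HoldsGraph numP numR numV G s σ) {i j : ℕ} (hi : i < σ.reg (.numE s))
    (hj : j < σ.reg (.numE s)) (h₁ : σ.arr (.inSrc s) [i] = σ.arr (.inSrc s) [j])
    (h₂ : σ.arr (.inLab s) [i] = σ.arr (.inLab s) [j])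
    (h₃ : σ.arr (.inDst s) [i] = σ.arr (.inDst s) [j]) : i = j := by
  obtain ⟨f, hf⟩ := h.edges
  rw [h.numEdges] at hi hj
  have hi' := hf ⟨i, hi⟩
  have hj' := hf ⟨j, hj⟩
  have : f ⟨i, hi⟩ = f ⟨j, hj⟩ := by
    refine Subtype.ext (Prod.ext ?_ (Prod.ext ?_ ?_))
    · exact num_inj numV (by rw [← hi'.1, ← hj'.1]; exact h₁)
    · exact num_inj numR (by rw [← hi'.2.1, ← hj'.2.1]; exact h₂)
    · exact num_inj numV (by rw [← hi'.2.2.1, ← hj'.2.2.1]; exact h₃)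
  simpa using f.injective this

end HoldsGraph

end OneGraph

section TwoGraphs

variable {P R V W : Type*} [Fintype P] [Fintype R] [Fintype V] [Fintype W]
  {numP : P ≃ Fin (Fintype.card P)} {numR : R ≃ Fin (Fintype.card R)}
  {numV : V ≃ Fin (Fintype.card V)} {numW : W ≃ Fin (Fintype.card W)}
  {G : FuzzyGraph P R V} {H : FuzzyGraph P R W} {σ : State}

/-- The numerical form of an input. -/
noncomputable def IsInput.toData (h : IsInput numP numR numV numW G H σ) : Data where
  nP := Fintype.card P
  nR := Fintype.card R
  nV s := σ.reg (.numV s)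
  m s := σ.reg (.numE s)
  W
    | .left => edgeDeg numR numV G
    | .right => edgeDeg numR numW H
  L
    | .left => labelDeg numP numV G
    | .right => labelDeg numP numW H
  src s i := σ.arr (.inSrc s) [i]
  lab s i := σ.arr (.inLab s) [i]
  dst s i := σ.arr (.inDst s) [i]
  src_lt {s i} hi := by
    cases s
    · obtain ⟨a, q, b, -, h₁, -⟩ := h.left.edge_of_lt hi
      simp [h₁, h.left.vertices]
    · obtain ⟨a, q, b, -, h₁, -⟩ := h.right.edge_of_lt hi
      simp [h₁, h.right.vertices]
  lab_lt {s i} hi := by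
    cases s
    · obtain ⟨a, q, b, -, -, h₁, -⟩ := h.left.edge_of_lt hi
      simp [h₁]
    · obtain ⟨a, q, b, -, -, h₁, -⟩ := h.right.edge_of_lt hi
      simp [h₁]
  dst_lt {s i} hi := by
    cases s
    · obtain ⟨a, q, b, -, -, -, h₁, -⟩ := h.left.edge_of_lt hi
      simp [h₁, h.left.vertices]
    · obtain ⟨a, q, b, -, -, -, h₁, -⟩ := h.right.edge_of_lt hi
      simp [h₁, h.right.vertices]
  pos {s i} hi := by
    cases s
    · obtain ⟨a, q, b, h₀, h₁, h₂, h₃, -⟩ := h.left.edge_of_lt hi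
      simpa [h₁, h₂, h₃] using h₀
    · obtain ⟨a, q, b, h₀, h₁, h₂, h₃, -⟩ := h.right.edge_of_lt hi
      simpa [h₁, h₂, h₃] using h₀
  exists_edge {s x r y} hpos := by
    cases s
    · exact h.left.exists_edge hpos
    · exact h.right.exists_edge hpos
  edge_inj {s i j} hi hj h₁ h₂ h₃ := by
    cases s
    · exact h.left.edge_inj hi hj h₁ h₂ h₃
    · exact h.right.edge_inj hi hj h₁ h₂ h₃

namespace IsInput

variable (h : IsInput numP numR numV numW G H σ)

theorem sizes : h.toData.Sizes σ :=
  ⟨h.vertexLabels, h.edgeLabels, fun _ => rfl, fun _ => rfl⟩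

theorem input : h.toData.Input σ := by
  refine ⟨?_, fun _ _ _ => rfl, fun _ _ _ => rfl, fun _ _ _ => rfl, ?_⟩
  · intro s x hx p hp
    obtain ⟨p, rfl⟩ := exists_num numP hp
    cases s
    · obtain ⟨x, rfl⟩ := exists_num numV (hx.trans_eq h.left.vertices)
      exact (h.left.labels x p).trans (labelDeg_num x p).symm
    · obtain ⟨x, rfl⟩ := exists_num numW (hx.trans_eq h.right.vertices)
      exact (h.right.labels x p).trans (labelDeg_num x p).symm
  · intro s i hi
    cases s
    · obtain ⟨a, q, b, -, h₁, h₂, h₃, h₄⟩ := h.left.edge_of_lt hi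
      simp [toData, h₁, h₂, h₃, h₄]
    · obtain ⟨a, q, b, -, h₁, h₂, h₃, h₄⟩ := h.right.edge_of_lt hi
      simp [toData, h₁, h₂, h₃, h₄]

/-- A directed simulation between fuzzy graphs is one between their numerical forms. -/
theorem isSim_image {Z : Set (V × W)} (hZ : G.IsDirectedSimulation H Z) :
    h.toData.IsSim {p | ∃ q ∈ Z, p = (↑(numV q.1), ↑(numW q.2))} := by
  refine ⟨?_, ?_⟩
  · rintro _ ⟨⟨x, x'⟩, hx, rfl⟩
    refine ⟨(Fin.is_lt _).trans_eq h.left.vertices.symm,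
      (Fin.is_lt _).trans_eq h.right.vertices.symm, fun p hp => ?_⟩
    obtain ⟨p, rfl⟩ := exists_num numP hp
    simpa [toData] using hZ.label x x' hx p
  · rintro s x x' r y ⟨⟨a, a'⟩, ha, he⟩ hpos
    cases s
    · obtain ⟨x, q, b, rfl, rfl, rfl, hE⟩ := exists_of_edgeDeg_pos hpos
      simp only [mkPair, Prod.mk.injEq] at he
      obtain ⟨he, rfl⟩ := he
      obtain rfl := num_inj numV he
      obtain ⟨b', hb', hle⟩ := hZ.forward _ _ _ _ ha hE
      exact ⟨numW b', ⟨(b, b'), hb', rfl⟩, by simpa [toData, Side.opp] using hle⟩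
    · obtain ⟨x, q, b', rfl, rfl, rfl, hE⟩ := exists_of_edgeDeg_pos hpos
      simp only [mkPair, Prod.mk.injEq] at he
      obtain ⟨rfl, he⟩ := he
      obtain rfl := num_inj numW he
      obtain ⟨b, hb, hle⟩ := hZ.backward _ _ _ _ ha hE
      exact ⟨numV b, ⟨(b, b'), hb, rfl⟩, by simpa [toData, Side.opp] using hle⟩

/-- A directed simulation between the numerical forms of fuzzy graphs is one between the graphs. -/
theorem isDirectedSimulation_preimage {Y : Set (ℕ × ℕ)} (hY : h.toData.IsSim Y) :
    G.IsDirectedSimulation H {q | ((numV q.1 : ℕ), (numW q.2 : ℕ)) ∈ Y} := by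
  refine ⟨?_, ?_, ?_⟩
  · intro x x' hx p
    simpa [toData] using (hY.1 hx).2.2 (numP p) (Fin.is_lt _)
  · intro x x' r y hx hpos
    obtain ⟨y', hy', hle⟩ := hY.2 .left (numV x) (numW x') (numR r) (numV y) hx
      (by simpa [toData] using hpos)
    obtain ⟨y', rfl⟩ := exists_num numW ((Data.lt_of_mem_labelPairs (hY.1 hy')).2.trans_eq
      h.right.vertices)
    exact ⟨y', hy', by simpa [toData, Side.opp] using hle⟩
  · intro x x' r y' hx hpos
    obtain ⟨y, hy, hle⟩ := hY.2 .right (numW x') (numV x) (numR r) (numW y') hx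
      (by simpa [toData] using hpos)
    obtain ⟨y, rfl⟩ := exists_num numV ((Data.lt_of_mem_labelPairs (hY.1 hy)).2.trans_eq
      h.left.vertices)
    exact ⟨y, hy, by simpa [toData, Side.opp] using hle⟩

end IsInput

end TwoGraphs

end DirSim

theorem mainTheorem2 {P R : Type*} [Fintype P] [Fintype R] :
    ∃ C : ℕ, ∀ (V W : Type*) [Fintype V] [Fintype W]
      (G : FuzzyGraph P R V) (H : FuzzyGraph P R W)
      (numP : P ≃ Fin (Fintype.card P)) (numR : R ≃ Fin (Fintype.card R))
      (numV : V ≃ Fin (Fintype.card V)) (numW : W ≃ Fin (Fintype.card W))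
      (σ : DirSim.State), DirSim.IsInput numP numR numV numW G H σ →
      (∃ τ t, DirSim.Exec DirSim.computeDirectedSimulationEfficiently σ τ t) ∧
      ∀ τ t, DirSim.Exec DirSim.computeDirectedSimulationEfficiently σ τ t →
        IsGreatest {Z : Set (V × W) | G.IsDirectedSimulation H Z} (DirSim.output numV numW τ) ∧
        ∀ n m : ℕ, n = Fintype.card V + Fintype.card W → m = G.numEdges + H.numEdges →
          0 < n → t ≤ C * ((m + n) * n) := by
  refine ⟨DirSim.Data.timeConst (Fintype.card P) (Fintype.card R), ?_⟩
  intro V W _ _ G H numP numR numV numW σ h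
  obtain ⟨τ, t, hexec, Z, hsim, hmax, hout, htime⟩ := DirSim.Data.wp_compute h.sizes h.input
  refine ⟨⟨τ, t, hexec⟩, fun τ' t' hexec' => ?_⟩
  obtain ⟨rfl, rfl⟩ := hexec.unique hexec'
  have heq : DirSim.output numV numW τ = {q | ((numV q.1 : ℕ), (numW q.2 : ℕ)) ∈ Z} := by
    ext q
    simp only [Set.mem_ofPred_eq, ← hout, DirSim.State.outPair, Prod.mk.injEq]
    rfl
  rw [heq]
  refine ⟨⟨h.isDirectedSimulation_preimage hsim, fun Y hY q hq => ?_⟩, ?_⟩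
  · exact hmax _ (h.isSim_image hY) ⟨q, hq, rfl⟩
  · rintro n m hn hm hpos
    refine htime.trans (h.toData.totalTime_le (hn.trans ?_) (hm.trans ?_) hpos)
    · rw [← h.left.vertices, ← h.right.vertices]
      rfl
    · rw [← h.left.numEdges, ← h.right.numEdges]
      rfl
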